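/- Let $n\ge 3$ be an integer and let $0<\theta<\pi$ with $\theta\neq\pi/2$. Let $P=ABCDE$ be a simple pentagon, labelled in either orientation, with interior angles $$A=\tfrac{2\pi}{n},\quad B=\tfrac{\pi}{2}+\theta,\quad C=\pi-\tfrac{2\pi}{n},\quad D=\delta+\tfrac{\pi}{n},\quad E=\tfrac{3\pi}{2}-\theta-\delta-\tfrac{\pi}{n},$$ and $EA=AB=BC=CD$, where $\delta=\arctan\frac{\sin\theta}{\tan\alpha-\cos\theta}\in(0,\pi)$, $\alpha=\frac{\pi}{2}-\frac{\pi}{n}$. (The pentagon may be convex, concave, or a trapezoid with $E=\pi$.) Let $\ell=AC$, $\omega=e^{2\pi i/n}$, $P_k=\ell\omega^k/(\omega-1)$ for $k\in\mathbb Z/n$; these are the vertices of a regular $n$-gon with centre $0$ and edge length $\ell$. Consider the rhombic pattern around this $n$-gon that consists, for $k\in\mathbb Z/n$ and $i,j\in\mathbb Z_{\ge0}$, of the rhombuses with vertices $P_k+\ell(i'\omega^{k-1}+j'\omega^k)$, $i'\in\{i,i+1\}$, $j'\in\{j,j+1\}$. A *conversion* of it into pentagons replaces every rhombus by a congruent copy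 (reflections allowed) of the pair formed by $P$ and its image $P'$ under the half-turn about the midpoint of $DE$, placed so that the four vertices $A,C$ of the two pentagons are the vertices of the rhombus. 1. If $n$ is even, there are a conversion and a simple equilateral concave $2n$-gon $H$ with no flat vertex and with edge length $AB$ such that the pentagons have pairwise disjoint interiors and cover exactly the complement of the open region enclosed by $H$. The hole $H$ arises from the regular $n$-gon $P_0\cdots P_{n-1}$ by replacing its edges by two-edge paths with apex alternately inside and outside the $n$-gon, and the symmetry group of the region bounded by $H$ is exactly $D_{n/2}$ (the rotations about $0$ by multiples of $4\pi/n$ and $n/2$ reflections). The rotations and translations of the plane that permute the pentagons are exactly the rotations about $0$ by multiples of $4\pi/n$; if $n\ne4$, no other isometry permutes the pentagons, so that the pattern has symmetry group exactly $C_{n/2}$. 2. If $n$ is odd, the hole cannot close with this arrangement: in every conversion, some two distinct pentagons have common interior points. -/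

import Mathlib

open Set Complex

namespace PentagonTiling

noncomputable section

/-! ### Polygons in the plane `ℂ` -/

/-- The closed polygonal curve of `p` is a simple closed curve: distinct pairs
(edge, parameter in `[0, 1)`) give distinct points. -/
def IsSimple {m : ℕ} (p : Polygon ℂ m) : Prop :=
  InjOn (fun x : Fin m × ℝ => p.edgePath ℝ x.1 x.2) (univ ×ˢ Ico (0 : ℝ) 1)

/-- The open region enclosed by `p`: the union of the bounded connected components of the
complement of its boundary curve. -/
def inside {m : ℕ} (p : Polygon ℂ m) : Set ℂ :=
  {z | z ∉ p.boundary ℝ ∧ Bornology.IsBounded (connectedComponentIn (p.boundary ℝ)ᶜ z)}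

/-- The closed region bounded by `p`. -/
def region {m : ℕ} (p : Polygon ℂ m) : Set ℂ := p.boundary ℝ ∪ inside p

/-- The counterclockwise angle in `[0, 2π)` at the vertex `p i` from the side towards `p (i + 1)`
to the side towards `p (i - 1)`. For a simple polygon whose vertices are listed counterclockwise
this is the interior angle (reflex angles included). -/
def vertexAngle {m : ℕ} [NeZero m] (p : Polygon ℂ m) (i : Fin m) : ℝ :=
  toIcoMod Real.two_pi_pos 0 (((p (i - 1) - p i) / (p (i + 1) - p i)).arg)

/-- The mirror image of a polygon. -/
def mirror {m : ℕ} (p : Polygon ℂ m) : Polygon ℂ m := ⟨fun i => (starRingEnd ℂ) (p i)⟩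

/-! ### The pentagons. The vertices `A, B, C, D, E` are `p 0, p 1, p 2, p 3, p 4`. -/

/-- The angle `δ = arctan (sin θ / (tan α - cos θ))` with `α = π / 2 - π / n`, in the branch with
values in `(0, π)` when `0 < θ < π` (it is the angle `BDE` of a triangle). -/
def delta (n : ℕ) (θ : ℝ) : ℝ :=
  arg (⟨Real.tan (Real.pi / 2 - Real.pi / n) - Real.cos θ, Real.sin θ⟩ : ℂ)

/-- The angle and edge conditions on a simple pentagon `ABCDE` listed counterclockwise.
(The prescribed angles add up to `3π`, which forces the counterclockwise orientation.) -/
def SatisfiesCcw (n : ℕ) (θ : ℝ) (p : Polygon ℂ 5) : Prop :=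
  IsSimple p ∧
  vertexAngle p 0 = 2 * Real.pi / n ∧
  vertexAngle p 1 = Real.pi / 2 + θ ∧
  vertexAngle p 2 = Real.pi - 2 * Real.pi / n ∧
  vertexAngle p 3 = delta n θ + Real.pi / n ∧
  vertexAngle p 4 = 3 * Real.pi / 2 - θ - delta n θ - Real.pi / n ∧
  dist (p 0) (p 1) = dist (p 4) (p 0) ∧
  dist (p 1) (p 2) = dist (p 4) (p 0) ∧
  dist (p 2) (p 3) = dist (p 4) (p 0)

/-- The pentagon `ABCDE`, listed in either orientation, has interior angles
`A = 2π/n`, `B = π/2 + θ`, `C = π - 2π/n`, `D = δ + π/n`, `E = 3π/2 - θ - δ - π/n`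
and four equal edges `EA = AB = BC = CD`. -/
def Satisfies (n : ℕ) (θ : ℝ) (p : Polygon ℂ 5) : Prop :=
  SatisfiesCcw n θ p ∨ SatisfiesCcw n θ (mirror p)

/-- The pentagon obtained from `p` by the half-turn about the midpoint of the edge `DE`.
Together with `p` it forms a pentagonal pair (the basic unit of the tilings). -/
def partner (p : Polygon ℂ 5) : Polygon ℂ 5 := ⟨fun i => p 3 + p 4 - p i⟩

/-! ### The rhombic pattern with a regular `n`-gonal hole -/

/-- The unit vector of direction `2πk/n`. -/
def unitDir (n : ℕ) (k : ℤ) : ℂ := exp ((2 * Real.pi * k / n : ℝ) * I)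

/-- The vertices of the regular `n`-gon with centre `0` and edge length `ℓ`, listed
counterclockwise; the edge from vertex `k` to vertex `k + 1` has direction `2πk/n`. -/
def ngonVertex (n : ℕ) (ℓ : ℝ) (k : ℤ) : ℂ := ℓ * unitDir n k / (unitDir n 1 - 1)

/-- The exterior of the regular `n`-gon is the union of the `n` angular sectors with apex a vertex
`k` of the `n`-gon, bounded by the rays of directions `2π(k-1)/n` and `2πk/n`.
These are the points of the lattice of rhombuses in the `k`-th sector. -/
def latticePoint (n : ℕ) (ℓ : ℝ) (k : ℤ) (i j : ℕ) : ℂ :=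
  ngonVertex n ℓ k + ℓ * (i * unitDir n (k - 1) + j * unitDir n k)

/-- Indices of the rhombuses: the sector and the two lattice coordinates. -/
abbrev RhombusIndex (n : ℕ) : Type := Fin n × ℕ × ℕ

/-- The four vertices of the rhombus `(k, i, j)`: a rhombus with edge length `ℓ` and interior
angles `2π/n` and `π - 2π/n`. -/
def rhombusVertices (n : ℕ) (ℓ : ℝ) : RhombusIndex n → Set ℂ
  | (k, i, j) => {latticePoint n ℓ k.val i j, latticePoint n ℓ k.val (i + 1) j,
      latticePoint n ℓ k.val (i + 1) (j + 1), latticePoint n ℓ k.val i (j + 1)}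

/-! ### Converting the rhombic pattern into a pentagonal one -/

/-- A conversion of the rhombic pattern with edge length `AC` into pentagons: for every rhombus
`r`, a congruent copy under `g r` (reflections allowed) of the pair formed by `p` and its partner,
placed so that the vertices `A` and `C` of the two pentagons are the four vertices of `r`. -/
def IsConversion (n : ℕ) (p : Polygon ℂ 5) (g : RhombusIndex n → (ℂ ≃ᵢ ℂ)) : Prop :=
  ∀ r, g r '' {p 0, p 2, partner p 0, partner p 2} = rhombusVertices n (dist (p 0) (p 2)) r

/-- The tiles of a conversion: two congruent copies of the pentagon `p` for every rhombus. -/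
def tiles {n : ℕ} (p : Polygon ℂ 5) (g : RhombusIndex n → (ℂ ≃ᵢ ℂ)) : Set (Set ℂ) :=
  {T | ∃ r, T = g r '' region p ∨ T = g r '' region (partner p)}

/-- Distinct tiles have no interior points in common. -/
def NonOverlapping (𝒯 : Set (Set ℂ)) : Prop := 𝒯.PairwiseDisjoint interior

/-- The tiles cover, without gaps and overlaps, exactly the complement of the open region enclosed
by the polygon `h`. -/
def IsTilingWithHole {m : ℕ} (𝒯 : Set (Set ℂ)) (h : Polygon ℂ m) : Prop :=
  NonOverlapping 𝒯 ∧ ⋃₀ 𝒯 = (inside h)ᶜ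

/-! ### Symmetry -/

/-- The isometries of the plane that map the set `S` onto itself. -/
def setSymmetries (S : Set ℂ) : Set (ℂ ≃ᵢ ℂ) := {f | f '' S = S}

/-- The isometries of the plane that permute the tiles of `𝒯`. -/
def tilingSymmetries (𝒯 : Set (Set ℂ)) : Set (ℂ ≃ᵢ ℂ) := {f | (fun T => f '' T) '' 𝒯 = 𝒯}

/-- The `m` rotations about `0` by multiples of `2π/m`. -/
def rotations (m : ℕ) : Set (ℂ ≃ᵢ ℂ) := {f | ∃ j : ℤ, ∀ z, f z = unitDir m j * z}

/-- The orientation-preserving isometries of the plane (rotations about arbitrary points and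
translations). -/
def orientationPreserving : Set (ℂ ≃ᵢ ℂ) := {f | ∃ a b : ℂ, ∀ z, f z = a * z + b}

/-- `G` consists of the `m` rotations about `0` by multiples of `2π/m` and of the reflections in
`m` axes through `0`, consecutive ones at angle `π/m`: it is the point group `D_m`. -/
def IsDihedral (m : ℕ) (G : Set (ℂ ≃ᵢ ℂ)) : Prop :=
  ∃ w : ℂ, ‖w‖ = 1 ∧
    G = rotations m ∪ {f | ∃ j : ℤ, ∀ z, f z = w * unitDir m j * (starRingEnd ℂ) z}

/-! ### The hole -/

/-- `h` is a (nondegenerate, simple) equilateral concave polygon with edge length `a`. -/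
def IsEquilateralConcave {m : ℕ} [NeZero m] (a : ℝ) (h : Polygon ℂ m) : Prop :=
  IsSimple h ∧ h.HasNondegenerateVertices ℝ ∧
  (∀ i, dist (h i) (h (i + 1)) = a) ∧ ¬ Convex ℝ (region h)

/-- `h` arises from the regular `n`-gon with edge length `ℓ` and centre `0` by replacing its edges
by two-edge paths that point alternately into and out of the `n`-gon. -/
def IsAlternating (n : ℕ) (ℓ : ℝ) (h : Polygon ℂ (2 * n)) : Prop :=
  ∀ k : Fin n, h ⟨2 * k.val, by omega⟩ = ngonVertex n ℓ k.val ∧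
    (Even k.val → h ⟨2 * k.val + 1, by omega⟩ ∈
      interior (convexHull ℝ (range fun i : ℤ => ngonVertex n ℓ i))) ∧
    (Odd k.val → h ⟨2 * k.val + 1, by omega⟩ ∉
      convexHull ℝ (range fun i : ℤ => ngonVertex n ℓ i))

end

end PentagonTiling

/-!
The proof starts by normalizing the pentagon. The angles at `A`, `B`, `C` and the four equal sides
determine it up to an isometry (`exists_isometry_of_satisfies`): it is `stdPentagon n τ`, where
`τ` is the common side length times `exp (i (θ / 2 - π / 4))`, so that `τ.re > 0`, `τ.im ≠ 0` and
`(τ ^ 2).re > 0`. The pentagon is the union of the positively oriented triangles `BCD`, `BDE`,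
`BEA` (`fan`), and it is star-shaped with respect to `B`; this identifies its region. The pair
formed by the pentagon and its partner arises from a rhombus with edge length `AC = 2 * τ.re` by
replacing every edge by a path of two edges of length `‖τ‖`; the first leg of such a path is `τ`
or `conj τ` times the direction of the edge (`leg`), so every edge is bent to the left or to the
right.

For even `n`, the pentagons are placed with chiralities that alternate like a checkerboard in
every sector and from sector to sector (`chir`, `placed`). Then the two rhombuses at an edge
induce the same bent edge. That the pentagons and the hole tile the plane is proved by counting
angles: seen from a point `z` on no line through two vertices, a positively oriented triangle has
total angle `2π` if it contains `z` and `0` otherwise (`angTri_eq`). In the sum over all pentagons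
with bounded indices the contributions of inner bent edges cancel (`sum_pairAngle_sector`), the
inner boundary contributes the angle of the hole, and the outer boundary, which is far away from
`z`, contributes `2π` (`exists_total_angle`). Hence `z` lies in exactly one pentagon or in the
hole, and density of such points gives the tiling (`isTilingWithHole_stdConversion`). The hole is
star-shaped with respect to `0`; polygons of this kind are studied through the gauge given by the
coordinates in the sectors between consecutive vertices (`starSet`).

Since the hole is bounded and invariant under a rotation, all symmetries fix `0`, and they permute
the points of the exterior of the hole that are nearest to `0`, which are the inner apices; this
determines them (`isometry_cases_of_image_holeExterior`). A reflection that permutes the pentagons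
would map a pentagon to its partner, and together with the half-turn that exchanges the two it
would yield a glide reflection that preserves a bounded set; its translation part vanishes only
for `n = 4` (`re_unitDir_one_eq_zero_of_reflection`).

For odd `n`, the rhombuses are not squares, so a conversion amounts to a choice of chirality for
every rhombus (`exists_place_of_conversion`). The corners of the pentagons at the vertices of the
rhombuses are the corners of the rhombuses, rotated by plus or minus the argument of `τ`. Adjacent
corners rotated towards each other overlap (`leg_im_pos_of_adjacent`), because this argument is
less than `π / 4` and one of the two corners is not acute. So around every inner vertex of a
sector all corners are rotated in the same sense, and a similar comparison across the boundary
rays of the sectors shows that the chiralities of the innermost rhombuses alternate from sector to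
sector, which is impossible for an odd number of sectors (`even_of_nonOverlapping`).
-/

namespace PentagonTiling

open scoped ComplexConjugate

/-! ### Triangles in the plane -/

/-- Twice the signed area of the triangle `a b z`; it is positive if `z` lies to the left of the
oriented line from `a` to `b`. -/
noncomputable def cr (a b z : ℂ) : ℝ := (conj (b - a) * (z - a)).im

/-- The closed triangle with vertices `a`, `b`, `c`. -/
def tri (a b c : ℂ) : Set ℂ := convexHull ℝ {a, b, c}

lemma cr_def (a b z : ℂ) :
    cr a b z = (b.re - a.re) * (z.im - a.im) - (b.im - a.im) * (z.re - a.re) := by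
  simp [cr]; ring

lemma cr_rotate (a b c : ℂ) : cr b c a = cr a b c := by simp only [cr_def]; ring

lemma cr_rotate' (a b c : ℂ) : cr c a b = cr a b c := by simp only [cr_def]; ring

lemma cr_swap (a b z : ℂ) : cr b a z = -cr a b z := by simp only [cr_def]; ring

lemma cr_add (a b c z : ℂ) : cr a b z + cr b c z + cr c a z = cr a b c := by
  simp only [cr_def]; ring

lemma continuous_cr (a b : ℂ) : Continuous (cr a b) := by unfold cr; fun_prop

lemma cr_self_left (a b : ℂ) : cr a b a = 0 := by simp [cr_def]

lemma cr_self_right (a b : ℂ) : cr a b b = 0 := by simp [cr_def]; ring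

lemma cr_comb (a b p q r : ℂ) (x y w : ℝ) (h : x + y + w = 1) :
    cr a b (x * p + y * q + w * r) = x * cr a b p + y * cr a b q + w * cr a b r := by
  obtain rfl : w = 1 - x - y := by linarith
  simp [cr_def]; ring

lemma mem_tri {a b c z : ℂ} : z ∈ tri a b c ↔
    ∃ x y w : ℝ, 0 ≤ x ∧ 0 ≤ y ∧ 0 ≤ w ∧ x + y + w = 1 ∧ z = x * a + y * b + w * c := by
  rw [tri, convexHull_insert (by simp), convexHull_pair]
  simp only [convexJoin_singleton_left, mem_iUnion, segment, mem_ofPred_eq]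
  constructor
  · rintro ⟨p, ⟨s, t, hs, ht, hst, rfl⟩, u, v, hu, hv, huv, rfl⟩
    refine ⟨u, v * s, v * t, hu, by positivity, by positivity, ?_, ?_⟩
    · rw [add_assoc, ← mul_add, hst, mul_one, huv]
    · simp; ring
  · rintro ⟨x, y, w, hx, hy, hw, h, rfl⟩
    rcases eq_or_lt_of_le (add_nonneg hy hw) with h0 | h0
    · obtain rfl : y = 0 := by linarith
      obtain rfl : w = 0 := by linarith
      obtain rfl : x = 1 := by linarith
      exact ⟨b, ⟨1, 0, by simp⟩, 1, 0, by simp⟩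
    · refine ⟨_, ⟨y / (y + w), w / (y + w), by positivity, by positivity, by field_simp, rfl⟩,
        x, y + w, hx, h0.le, by linarith, ?_⟩
      have : ((y : ℂ) + w) ≠ 0 := by exact_mod_cast h0.ne'
      simp
      field_simp
      ring

lemma isCompact_tri (a b c : ℂ) : IsCompact (tri a b c) :=
  (Set.toFinite _).isCompact_convexHull ℝ

lemma left_mem_tri (a b c : ℂ) : a ∈ tri a b c := subset_convexHull ℝ _ (by simp)

lemma mid_mem_tri (a b c : ℂ) : b ∈ tri a b c := subset_convexHull ℝ _ (by simp)

lemma right_mem_tri (a b c : ℂ) : c ∈ tri a b c := subset_convexHull ℝ _ (by simp)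

lemma tri_swap (a b c : ℂ) : tri a c b = tri a b c := by
  unfold tri; rw [Set.pair_comm]

lemma tri_rotate (a b c : ℂ) : tri b c a = tri a b c := by
  unfold tri; congr 1; ext; simp; tauto

lemma tri_rotate' (a b c : ℂ) : tri c a b = tri a b c := by rw [tri_rotate, tri_rotate]

/-- A positively oriented triangle is the intersection of the half-planes to the left of its
sides. -/
lemma mem_tri_iff {a b c z : ℂ} (h : 0 < cr a b c) :
    z ∈ tri a b c ↔ 0 ≤ cr a b z ∧ 0 ≤ cr b c z ∧ 0 ≤ cr c a z := by
  rw [mem_tri]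
  constructor
  · rintro ⟨x, y, w, hx, hy, hw, h1, rfl⟩
    simp only [cr_comb _ _ _ _ _ _ _ _ h1, cr_self_left, cr_self_right, cr_rotate a b c,
      cr_rotate' a b c]
    refine ⟨?_, ?_, ?_⟩ <;> (simp; positivity)
  · rintro ⟨h1, h2, h3⟩
    refine ⟨cr b c z / cr a b c, cr c a z / cr a b c, cr a b z / cr a b c, by positivity,
      by positivity, by positivity, ?_, ?_⟩
    · rw [← add_div, ← add_div, div_eq_one_iff_eq h.ne', ← cr_add a b c z]; ring
    · have hne : ((cr a b c : ℝ) : ℂ) ≠ 0 := by exact_mod_cast h.ne'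
      push_cast
      field_simp
      apply Complex.ext <;> simp [cr_def] <;> ring

lemma mem_interior_tri {a b c z : ℂ} (h1 : 0 < cr a b z) (h2 : 0 < cr b c z) (h3 : 0 < cr c a z) :
    z ∈ interior (tri a b c) := by
  have h : 0 < cr a b c := by rw [← cr_add a b c z]; linarith
  refine mem_interior.2 ⟨{y | 0 < cr a b y} ∩ {y | 0 < cr b c y} ∩ {y | 0 < cr c a y}, ?_, ?_, ?_⟩
  · rintro y ⟨⟨k1, k2⟩, k3⟩
    exact (mem_tri_iff h).2 ⟨le_of_lt k1, le_of_lt k2, le_of_lt k3⟩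
  · exact ((isOpen_lt continuous_const (continuous_cr a b)).inter
      (isOpen_lt continuous_const (continuous_cr b c))).inter
      (isOpen_lt continuous_const (continuous_cr c a))
  · exact ⟨⟨h1, h2⟩, h3⟩

lemma tri_subset_closure_interior {a b c : ℂ} (h : 0 < cr a b c) :
    tri a b c ⊆ closure (interior (tri a b c)) := by
  have hc : Convex ℝ (tri a b c) := convex_convexHull ℝ _
  have hne : (interior (tri a b c)).Nonempty := by
    refine ⟨((1 / 3 : ℝ) : ℂ) * a + ((1 / 3 : ℝ) : ℂ) * b + ((1 / 3 : ℝ) : ℂ) * c,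
      mem_interior_tri ?_ ?_ ?_⟩ <;>
    rw [cr_comb _ _ _ _ _ _ _ _ (by norm_num)] <;>
    simp only [cr_self_left, cr_self_right, cr_rotate a b c, cr_rotate' a b c] <;> linarith
  rw [hc.closure_interior_eq_closure_of_nonempty_interior hne]
  exact subset_closure

/-- If two positively oriented triangles lie on different sides of a common side `b d`, then the
relatively open side is in the interior of their union. -/
lemma openSegment_mem_interior {b c d e z : ℂ} (h1 : 0 < cr b c d) (h2 : 0 < cr b d e)
    {t : ℝ} (t0 : 0 < t) (t1 : t < 1) (hz : z = ((1 - t : ℝ) : ℂ) * b + (t : ℝ) * d) :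
    z ∈ interior (tri b c d ∪ tri b d e) := by
  have key : ∀ p q : ℂ, cr p q z = (1 - t) * cr p q b + t * cr p q d := by
    intro p q
    have := cr_comb p q b d 0 (1 - t) t 0 (by ring)
    simpa [hz] using this
  have a1 : 0 < cr b c z := by
    rw [key, cr_self_left]; simp; positivity
  have a2 : 0 < cr c d z := by
    rw [key, cr_self_right, cr_rotate b c d]
    have : 0 < 1 - t := by linarith
    simp; positivity
  have a3 : 0 < cr d e z := by
    rw [key, cr_self_left, cr_rotate b d e]
    have : 0 < 1 - t := by linarith
    simp; positivity
  have a4 : 0 < cr e b z := by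
    rw [key, cr_self_right, cr_rotate' b d e]
    simp; positivity
  refine mem_interior.2 ⟨({y | 0 < cr b c y} ∩ {y | 0 < cr c d y}) ∩
    ({y | 0 < cr d e y} ∩ {y | 0 < cr e b y}), ?_, ?_, ⟨⟨a1, a2⟩, ⟨a3, a4⟩⟩⟩
  · rintro y ⟨⟨k1, k2⟩, ⟨k3, k4⟩⟩
    rcases le_total 0 (cr d b y) with k | k
    · exact Or.inl ((mem_tri_iff h1).2 ⟨le_of_lt k1, le_of_lt k2, k⟩)
    · exact Or.inr ((mem_tri_iff h2).2 ⟨by rw [cr_swap]; linarith, le_of_lt k3, le_of_lt k4⟩)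
  · exact ((isOpen_lt continuous_const (continuous_cr b c)).inter
      (isOpen_lt continuous_const (continuous_cr c d))).inter
      ((isOpen_lt continuous_const (continuous_cr d e)).inter
      (isOpen_lt continuous_const (continuous_cr e b)))

/-! ### Isometries of the plane -/

/-- Every isometry of the plane is a rotation, a translation or an orientation-reversing map
`z ↦ a * conj z + b`. -/
lemma isometry_cases (f : ℂ ≃ᵢ ℂ) : ∃ a b : ℂ, ‖a‖ = 1 ∧
    ((∀ z, f z = a * z + b) ∨ (∀ z, f z = a * conj z + b)) := by
  obtain ⟨a, ha⟩ : ∃ a : Circle, _ := linear_isometry_complex (f.toRealLinearIsometryEquiv)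
  refine ⟨(a : ℂ), f 0, Circle.norm_coe a, ?_⟩
  have key : ∀ z, f z = f.toRealLinearIsometryEquiv z + f 0 := by
    intro z; simp [IsometryEquiv.toRealLinearIsometryEquiv_apply]
  rcases ha with ha | ha
  · left; intro z; rw [key, ha]; simp [rotation_apply]
  · right; intro z; rw [key, ha]; simp [rotation_apply]

/-- The isometry `z ↦ a * z + b`. -/
noncomputable def directIso (a b : ℂ) (ha : ‖a‖ = 1) : ℂ ≃ᵢ ℂ :=
  IsometryEquiv.mk' (fun z => a * z + b) (fun z => a⁻¹ * (z - b))
    (fun z => by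
      have : a ≠ 0 := by rintro rfl; simp at ha
      field_simp; ring)
    (Isometry.of_dist_eq fun x y => by
      rw [dist_eq_norm, dist_eq_norm]
      have : a * x + b - (a * y + b) = a * (x - y) := by ring
      rw [this, norm_mul, ha, one_mul])

/-- The isometry `z ↦ a * conj z + b`. -/
noncomputable def reverseIso (a b : ℂ) (ha : ‖a‖ = 1) : ℂ ≃ᵢ ℂ :=
  (Complex.conjLIE.toIsometryEquiv).trans (directIso a b ha)

@[simp] lemma directIso_apply (a b : ℂ) (ha : ‖a‖ = 1) (z : ℂ) : directIso a b ha z = a * z + b :=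
  rfl

@[simp] lemma reverseIso_apply (a b : ℂ) (ha : ‖a‖ = 1) (z : ℂ) :
    reverseIso a b ha z = a * conj z + b := rfl

lemma isometry_comb (f : ℂ ≃ᵢ ℂ) (a b c : ℂ) (x y w : ℝ) (h : x + y + w = 1) :
    f (x * a + y * b + w * c) = x * f a + y * f b + w * f c := by
  have h' : (x : ℂ) + y + w = 1 := by exact_mod_cast h
  obtain ⟨u, v, -, hf | hf⟩ := isometry_cases f
  · simp only [hf]; linear_combination (-v) * h'
  · simp only [hf, map_add, map_mul, conj_ofReal]; linear_combination (-v) * h'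

lemma image_tri (f : ℂ ≃ᵢ ℂ) (a b c : ℂ) : f '' tri a b c = tri (f a) (f b) (f c) := by
  ext z
  simp only [mem_image, mem_tri]
  constructor
  · rintro ⟨_, ⟨x, y, w, hx, hy, hw, h, rfl⟩, rfl⟩
    exact ⟨x, y, w, hx, hy, hw, h, isometry_comb f a b c x y w h⟩
  · rintro ⟨x, y, w, hx, hy, hw, h, rfl⟩
    exact ⟨_, ⟨x, y, w, hx, hy, hw, h, rfl⟩, isometry_comb f a b c x y w h⟩

/-- A nonempty bounded set is not mapped into itself by a nontrivial translation. -/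
lemma eq_zero_of_translation {U : Set ℂ} (hb : Bornology.IsBounded U) (hne : U.Nonempty) {t : ℂ}
    (h : ∀ y ∈ U, y + t ∈ U) : t = 0 := by
  obtain ⟨y, hy⟩ := hne
  have hm : ∀ m : ℕ, y + m * t ∈ U := by
    intro m
    induction m with
    | zero => simpa
    | succ m ih =>
      have := h _ ih
      push_cast
      convert this using 1; ring
  obtain ⟨R, hR⟩ := hb.exists_norm_le
  by_contra ht
  have ht' : 0 < ‖t‖ := norm_pos_iff.2 ht
  obtain ⟨m, hm'⟩ := exists_nat_gt ((R + ‖y‖) / ‖t‖)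
  rw [div_lt_iff₀ ht'] at hm'
  have h1 := hR _ (hm m)
  have h2 : ‖(m : ℂ) * t‖ ≤ ‖y + m * t‖ + ‖y‖ := by
    calc ‖(m : ℂ) * t‖ = ‖(y + m * t) - y‖ := by ring_nf
      _ ≤ _ := norm_sub_le _ _
  rw [norm_mul, Complex.norm_natCast] at h2
  linarith

/-- If a nonempty bounded set is invariant under a nontrivial rotation about `0`, then every
isometry that preserves it fixes `0`: otherwise a commutator would be a nontrivial translation. -/
lemma map_zero_of_rotation_invariant {U : Set ℂ} (hb : Bornology.IsBounded U) (hne : U.Nonempty)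
    {q : ℂ} (hq : q ≠ 1) (hq1 : ‖q‖ = 1) (hU : ∀ z ∈ U, q * z ∈ U) (hU' : ∀ z ∈ U, conj q * z ∈ U)
    (f : ℂ ≃ᵢ ℂ) (hf : f '' U = U) : f 0 = 0 := by
  have hqq : q * conj q = 1 := by rw [mul_conj, normSq_eq_norm_sq, hq1]; simp
  have hq' : conj q ≠ 1 := by
    intro h; apply hq; have := congrArg conj h; simpa using this
  have step : ∀ {r s : ℂ}, r * s = 1 → (∀ z ∈ U, s * z ∈ U) → (∀ z ∈ U, f z ∈ U → r * (f z - f 0) + f 0 ∈ U) →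
      (s - 1) * f 0 = 0 := by
    intro r s hrs hs h
    refine eq_zero_of_translation hb hne fun y hy => ?_
    rw [← hf] at hy
    obtain ⟨z, hz, rfl⟩ := hy
    have h1 := hs _ (h z hz (hf ▸ mem_image_of_mem f hz))
    convert h1 using 1
    linear_combination (f 0 - f z) * hrs
  obtain ⟨a, b, ha, h | h⟩ := isometry_cases f
  · have := step hqq hU' fun z hz _ => by
      have h1 : f (q * z) ∈ U := hf ▸ mem_image_of_mem f (hU z hz)
      convert h1 using 1
      simp only [h]; ring
    rcases mul_eq_zero.1 this with h' | h'
    · exact absurd (sub_eq_zero.1 h') hq'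
    · exact h'
  · have := step (r := conj q) (s := q) (by rw [mul_comm]; exact hqq) hU fun z hz _ => by
      have h1 : f (q * z) ∈ U := hf ▸ mem_image_of_mem f (hU z hz)
      convert h1 using 1
      simp only [h, map_mul, map_zero]; ring
    rcases mul_eq_zero.1 this with h' | h'
    · exact absurd (sub_eq_zero.1 h') hq
    · exact h'

/-! ### The region bounded by a star-shaped polygon -/

lemma mem_edgeSet {m : ℕ} (p : Polygon ℂ m) (i : Fin m) (z : ℂ) : z ∈ p.edgeSet ℝ i ↔
    ∃ t : ℝ, 0 ≤ t ∧ t ≤ 1 ∧ z = ((1 - t : ℝ) : ℂ) * p i + (t : ℝ) * p (finRotate m i) := by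
  rw [Polygon.edgeSet_eq_image_edgePath]
  constructor
  · rintro ⟨t, ht, rfl⟩
    refine ⟨t, ht.1, ht.2, ?_⟩
    simp [Polygon.edgePath, AffineMap.lineMap_apply]; ring
  · rintro ⟨t, h0, h1, rfl⟩
    refine ⟨t, ⟨h0, h1⟩, ?_⟩
    simp [Polygon.edgePath, AffineMap.lineMap_apply]; ring

/-- If `K` is compact and star-shaped, contains the boundary curve of `p`, and becomes open when
that curve is removed, then `p` encloses exactly the rest of `K`: points outside `K` can escape to
infinity along the ray from the star centre. -/
lemma inside_eq_of_starConvex {m : ℕ} (p : Polygon ℂ m) {K : Set ℂ} {c : ℂ} (hK : IsCompact K)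
    (hs : StarConvex ℝ c K) (hcK : c ∈ K) (hb : p.boundary ℝ ⊆ K) (ho : IsOpen (K \ p.boundary ℝ)) :
    inside p = K \ p.boundary ℝ := by
  have hdis : Disjoint (K \ p.boundary ℝ) Kᶜ :=
    disjoint_left.2 fun x hx hx' => hx' hx.1
  have hcov : (p.boundary ℝ)ᶜ ⊆ (K \ p.boundary ℝ) ∪ Kᶜ := by
    intro x hx
    by_cases h : x ∈ K
    · exact Or.inl ⟨h, hx⟩
    · exact Or.inr h
  ext z
  constructor
  · rintro ⟨hz, hzb⟩
    refine ⟨?_, hz⟩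
    by_contra hzK
    -- the ray from `z` away from `c`
    set S : Set ℂ := (fun t : ℝ => z + t * (z - c)) '' Ici 0 with hS
    have hSK : S ⊆ Kᶜ := by
      rintro _ ⟨t, ht, rfl⟩ h
      apply hzK
      have ht' : (0 : ℝ) ≤ t := ht
      have h1 := hs h (a := t / (1 + t)) (b := 1 / (1 + t)) (by positivity) (by positivity)
        (by field_simp; ring)
      convert h1 using 1
      have : (1 + (t : ℂ)) ≠ 0 := by
        have : (1 + t : ℝ) ≠ 0 := by positivity
        exact_mod_cast this
      simp
      field_simp
      ring
    have hSc : IsPreconnected S := by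
      refine (isPreconnected_Ici).image _ ?_
      fun_prop
    have hzS : z ∈ S := ⟨0, by simp, by simp⟩
    have hsub : S ⊆ connectedComponentIn (p.boundary ℝ)ᶜ z :=
      hSc.subset_connectedComponentIn hzS fun x hx hx' => hSK hx (hb hx')
    obtain ⟨R, hR⟩ := (hzb.subset hsub).exists_norm_le
    have hzc : z - c ≠ 0 := by
      intro h; apply hzK; rw [sub_eq_zero.1 h]; exact hcK
    have hpos : 0 < ‖z - c‖ := norm_pos_iff.2 hzc
    set t : ℝ := (|R| + ‖z‖ + 1) / ‖z - c‖ with ht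
    have ht0 : 0 ≤ t := by positivity
    have h1 := hR _ ⟨t, ht0, rfl⟩
    have h2 : ‖(t : ℂ) * (z - c)‖ ≤ ‖z + t * (z - c)‖ + ‖z‖ := by
      calc ‖(t : ℂ) * (z - c)‖ = ‖(z + t * (z - c)) - z‖ := by ring_nf
        _ ≤ _ := norm_sub_le _ _
    rw [norm_mul, Complex.norm_real, Real.norm_of_nonneg ht0, ht, div_mul_cancel₀ _ hpos.ne'] at h2
    have := le_abs_self R
    rw [← ht] at h2
    linarith
  · intro hz
    refine ⟨hz.2, hK.isBounded.subset ?_⟩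
    have := isPreconnected_connectedComponentIn (x := z) (F := (p.boundary ℝ)ᶜ)
      |>.subset_left_of_subset_union ho hK.isClosed.isOpen_compl hdis
      ((connectedComponentIn_subset _ _).trans hcov)
      ⟨z, mem_connectedComponentIn hz.2, hz⟩
    exact this.trans sdiff_subset

lemma region_eq_of_starConvex {m : ℕ} (p : Polygon ℂ m) {K : Set ℂ} {c : ℂ} (hK : IsCompact K)
    (hs : StarConvex ℝ c K) (hcK : c ∈ K) (hb : p.boundary ℝ ⊆ K) (ho : IsOpen (K \ p.boundary ℝ)) :
    region p = K := by
  rw [region, inside_eq_of_starConvex p hK hs hcK hb ho, union_sdiff_cancel hb]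

/-! ### The directions of the rhombic pattern -/

lemma unitDir_zero (n : ℕ) : unitDir n 0 = 1 := by simp [unitDir]

lemma unitDir_add (n : ℕ) (j k : ℤ) : unitDir n (j + k) = unitDir n j * unitDir n k := by
  rw [unitDir, unitDir, unitDir, ← Complex.exp_add]; congr 1; push_cast; ring

lemma norm_unitDir (n : ℕ) (k : ℤ) : ‖unitDir n k‖ = 1 := Complex.norm_exp_ofReal_mul_I _

lemma conj_unitDir (n : ℕ) (k : ℤ) : conj (unitDir n k) = unitDir n (-k) := by
  rw [unitDir, unitDir, ← Complex.exp_conj]; congr 1; simp [neg_div, Complex.conj_ofNat]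

lemma unitDir_mul_conj (n : ℕ) (k : ℤ) : unitDir n k * conj (unitDir n k) = 1 := by
  rw [conj_unitDir, ← unitDir_add]; simp [unitDir_zero]

lemma unitDir_ne_zero (n : ℕ) (k : ℤ) : unitDir n k ≠ 0 := Complex.exp_ne_zero _

lemma unitDir_re (n : ℕ) (k : ℤ) : (unitDir n k).re = Real.cos (2 * Real.pi * k / n) := by
  rw [unitDir, Complex.exp_ofReal_mul_I_re]

lemma unitDir_im (n : ℕ) (k : ℤ) : (unitDir n k).im = Real.sin (2 * Real.pi * k / n) := by
  rw [unitDir, Complex.exp_ofReal_mul_I_im]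

lemma unitDir_mul_period {n : ℕ} (hn : n ≠ 0) (m : ℤ) : unitDir n (n * m) = 1 := by
  rw [unitDir, Complex.exp_eq_one_iff]
  refine ⟨m, ?_⟩
  have : (n : ℂ) ≠ 0 := by exact_mod_cast hn
  push_cast; field_simp

lemma unitDir_emod {n : ℕ} (hn : n ≠ 0) (k : ℤ) : unitDir n (k % n) = unitDir n k := by
  conv_rhs => rw [← Int.emod_add_mul_ediv k n, unitDir_add, unitDir_mul_period hn, mul_one]

lemma unitDir_one_im_pos {n : ℕ} (hn : 3 ≤ n) : 0 < (unitDir n 1).im := by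
  rw [unitDir_im]
  have hn' : (3 : ℝ) ≤ n := by exact_mod_cast hn
  apply Real.sin_pos_of_pos_of_lt_pi
  · have := Real.pi_pos; push_cast; positivity
  · rw [div_lt_iff₀ (by linarith)]; push_cast; nlinarith [Real.pi_pos]

lemma unitDir_one_ne_one {n : ℕ} (hn : 3 ≤ n) : unitDir n 1 ≠ 1 := by
  intro h
  have := unitDir_one_im_pos hn
  rw [h] at this; simp at this

lemma sq_add_sq_unitDir (n : ℕ) (k : ℤ) : (unitDir n k).re ^ 2 + (unitDir n k).im ^ 2 = 1 := by
  rw [unitDir_re, unitDir_im]; exact Real.cos_sq_add_sin_sq _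

/-! ### The pentagon in standard position -/

/-- The pentagon `ABCDE` in standard position. Its side length is `‖τ‖`, the vertex `B` is `0`, and
the edge `AC` is real, of length `2 * τ.re`. The argument of `τ` is `θ / 2 - π / 4`. -/
noncomputable def stdPentagon (n : ℕ) (τ : ℂ) : Polygon ℂ 5 :=
  ⟨![-τ, 0, conj τ, conj τ * (1 + unitDir n 1), τ * (unitDir n 1 - 1)]⟩

section
variable (n : ℕ) (τ : ℂ)
@[simp] lemma stdPentagon_zero : stdPentagon n τ 0 = -τ := rfl
@[simp] lemma stdPentagon_one : stdPentagon n τ 1 = 0 := rfl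
@[simp] lemma stdPentagon_two : stdPentagon n τ 2 = conj τ := rfl
@[simp] lemma stdPentagon_three : stdPentagon n τ 3 = conj τ * (1 + unitDir n 1) := rfl
@[simp] lemma stdPentagon_four : stdPentagon n τ 4 = τ * (unitDir n 1 - 1) := rfl
end

/-- The union of the three triangles `BCD`, `BDE`, `BEA`. -/
def fan (q : Polygon ℂ 5) : Set ℂ :=
  tri (q 1) (q 2) (q 3) ∪ tri (q 1) (q 3) (q 4) ∪ tri (q 1) (q 4) (q 0)

/-- The three triangles `BCD`, `BDE`, `BEA` are positively oriented. -/
def IsFan (q : Polygon ℂ 5) : Prop :=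
  0 < cr (q 1) (q 2) (q 3) ∧ 0 < cr (q 1) (q 3) (q 4) ∧ 0 < cr (q 1) (q 4) (q 0)

lemma isCompact_fan (q : Polygon ℂ 5) : IsCompact (fan q) :=
  ((isCompact_tri _ _ _).union (isCompact_tri _ _ _)).union (isCompact_tri _ _ _)

lemma mem_interior_tri_of_coords {b c d z : ℂ} (h : 0 < cr b c d) {x y w : ℝ} (hx : 0 < x)
    (hy : 0 < y) (hw : 0 < w) (h1 : x + y + w = 1) (hz : z = x * b + y * c + w * d) :
    z ∈ interior (tri b c d) := by
  subst hz
  apply mem_interior_tri <;> rw [cr_comb _ _ _ _ _ _ _ _ h1] <;>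
    simp only [cr_self_left, cr_self_right, cr_rotate b c d, cr_rotate' b c d] <;> simp <;>
    positivity

/-- The side from `b` to `d` is listed without its end points because it will be a diagonal of a
fan, whose end points are vertices already covered by the other two sides. -/
lemma tri_cases {b c d z : ℂ} (h : 0 < cr b c d) (hz : z ∈ tri b c d) :
    z ∈ interior (tri b c d) ∨
    (∃ t : ℝ, 0 ≤ t ∧ t ≤ 1 ∧ z = ((1 - t : ℝ) : ℂ) * b + (t : ℝ) * c) ∨
    (∃ t : ℝ, 0 ≤ t ∧ t ≤ 1 ∧ z = ((1 - t : ℝ) : ℂ) * c + (t : ℝ) * d) ∨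
    (∃ t : ℝ, 0 < t ∧ t < 1 ∧ z = ((1 - t : ℝ) : ℂ) * b + (t : ℝ) * d) := by
  obtain ⟨x, y, w, hx, hy, hw, h1, hz⟩ := mem_tri.1 hz
  rcases hw.eq_or_lt with rfl | hw'
  · right; left
    refine ⟨y, hy, by linarith, ?_⟩
    rw [hz, show (1 - y) = x by linarith]; simp
  rcases hx.eq_or_lt with rfl | hx'
  · right; right; left
    refine ⟨w, hw, by linarith, ?_⟩
    rw [hz, show (1 - w) = y by linarith]; simp
  rcases hy.eq_or_lt with rfl | hy'
  · right; right; right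
    refine ⟨w, hw', by linarith, ?_⟩
    rw [hz, show (1 - w) = x by linarith]; simp
  · left; exact mem_interior_tri_of_coords h hx' hy' hw' h1 hz

lemma isCompact_boundary {m : ℕ} (p : Polygon ℂ m) : IsCompact (p.boundary ℝ) := by
  refine isCompact_iUnion fun i => ?_
  rw [Polygon.edgeSet_eq_image_edgePath]
  refine isCompact_Icc.image ?_
  simp only [Polygon.edgePath]
  exact AffineMap.lineMap_continuous

lemma boundary_image {m : ℕ} (f : ℂ ≃ᵢ ℂ) {p q : Polygon ℂ m} (h : ∀ i, p i = f (q i)) :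
    p.boundary ℝ = f '' q.boundary ℝ := by
  have key : ∀ (i : Fin m) (t : ℝ), ((1 - t : ℝ) : ℂ) * p i + (t : ℝ) * p (finRotate m i) =
      f (((1 - t : ℝ) : ℂ) * q i + (t : ℝ) * q (finRotate m i)) := by
    intro i t
    have := isometry_comb f (q i) (q (finRotate m i)) 0 (1 - t) t 0 (by ring)
    simp only [ofReal_zero, zero_mul, add_zero] at this
    rw [this, h, h]
  ext z
  simp only [Polygon.boundary, mem_iUnion, mem_image, mem_edgeSet]
  constructor
  · rintro ⟨i, t, h0, h1, rfl⟩
    exact ⟨_, ⟨i, t, h0, h1, rfl⟩, (key i t).symm⟩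
  · rintro ⟨_, ⟨i, t, h0, h1, rfl⟩, rfl⟩
    exact ⟨i, t, h0, h1, (key i t).symm⟩

lemma boundary_subset_fan (q : Polygon ℂ 5) : q.boundary ℝ ⊆ fan q := by
  intro z hz
  simp only [Polygon.boundary, mem_iUnion, mem_edgeSet] at hz
  obtain ⟨i, t, h0, h1, rfl⟩ := hz
  have h1' : 0 ≤ 1 - t := by linarith
  fin_cases i
  · refine Or.inr (mem_tri.2 ⟨t, 0, 1 - t, h0, le_rfl, h1', by ring, ?_⟩)
    simp; ring
  · refine Or.inl (Or.inl (mem_tri.2 ⟨1 - t, t, 0, h1', h0, le_rfl, by ring, ?_⟩))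
    simp
  · refine Or.inl (Or.inl (mem_tri.2 ⟨0, 1 - t, t, le_rfl, h1', h0, by ring, ?_⟩))
    simp
  · refine Or.inl (Or.inr (mem_tri.2 ⟨0, 1 - t, t, le_rfl, h1', h0, by ring, ?_⟩))
    simp
  · refine Or.inr (mem_tri.2 ⟨0, 1 - t, t, le_rfl, h1', h0, by ring, ?_⟩)
    simp

/-- A point of a diagonal `BD` or `BE` that is not a vertex is interior to the union of the two
triangles that share the diagonal. -/
lemma fan_diff_boundary_subset {q : Polygon ℂ 5} (h : IsFan q) :
    fan q \ q.boundary ℝ ⊆ interior (fan q) := by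
  obtain ⟨h1, h2, h3⟩ := h
  have hedge : ∀ (i : Fin 5) (t : ℝ), 0 ≤ t → t ≤ 1 →
      ((1 - t : ℝ) : ℂ) * q i + (t : ℝ) * q (finRotate 5 i) ∈ q.boundary ℝ := by
    intro i t h0 h1
    exact mem_iUnion.2 ⟨i, (mem_edgeSet _ _ _).2 ⟨t, h0, h1, rfl⟩⟩
  have hv : ∀ i : Fin 5, q i ∈ q.boundary ℝ := fun i => by
    simpa using hedge i 0 le_rfl zero_le_one
  have d1 : ∀ t : ℝ, 0 < t → t < 1 →
      ((1 - t : ℝ) : ℂ) * q 1 + (t : ℝ) * q 3 ∈ interior (fan q) := fun t t0 t1 =>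
    interior_mono subset_union_left (openSegment_mem_interior h1 h2 t0 t1 rfl)
  have d2 : ∀ t : ℝ, 0 < t → t < 1 →
      ((1 - t : ℝ) : ℂ) * q 1 + (t : ℝ) * q 4 ∈ interior (fan q) := fun t t0 t1 =>
    interior_mono (union_subset_union_left _ subset_union_right)
      (openSegment_mem_interior h2 h3 t0 t1 rfl)
  rintro z ⟨(hz | hz) | hz, hzb⟩
  · rcases tri_cases h1 hz with h | ⟨t, t0, t1, rfl⟩ | ⟨t, t0, t1, rfl⟩ | ⟨t, t0, t1, rfl⟩
    · exact interior_mono (subset_union_left.trans subset_union_left) h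
    · exact absurd (hedge 1 t t0 t1) hzb
    · exact absurd (hedge 2 t t0 t1) hzb
    · exact d1 t t0 t1
  · rcases tri_cases h2 hz with h | ⟨t, t0, t1, rfl⟩ | ⟨t, t0, t1, rfl⟩ | ⟨t, t0, t1, rfl⟩
    · exact interior_mono (subset_union_right.trans subset_union_left) h
    · rcases t0.eq_or_lt with rfl | t0'
      · simp at hzb; exact absurd (hv 1) hzb
      · rcases t1.eq_or_lt with rfl | t1'
        · simp at hzb; exact absurd (hv 3) hzb
        · exact d1 t t0' t1'
    · exact absurd (hedge 3 t t0 t1) hzb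
    · exact d2 t t0 t1
  · rw [← tri_rotate] at hz
    rw [← cr_rotate] at h3
    rcases tri_cases h3 hz with h | ⟨t, t0, t1, rfl⟩ | ⟨t, t0, t1, rfl⟩ | ⟨t, t0, t1, rfl⟩
    · rw [tri_rotate] at h
      exact interior_mono subset_union_right h
    · exact absurd (hedge 4 t t0 t1) hzb
    · exact absurd (hedge 0 t t0 t1) hzb
    · convert d2 (1 - t) (by linarith) (by linarith) using 1
      push_cast; ring

/-- A pentagon congruent to a pentagon that is star-shaped about its vertex `B` bounds the
corresponding union of three triangles. -/
lemma region_eq_image_fan {q p : Polygon ℂ 5} (hq : IsFan q) (f : ℂ ≃ᵢ ℂ) (hp : ∀ i, p i = f (q i)) :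
    region p = f '' fan q := by
  have hb := boundary_image f hp
  refine region_eq_of_starConvex p (c := f (q 1)) ((isCompact_fan q).image f.continuous) ?_ ?_ ?_ ?_
  · rw [fan, image_union, image_union, image_tri, image_tri, image_tri]
    have : ∀ a b c : ℂ, StarConvex ℝ a (tri a b c) := fun a b c =>
      (convex_convexHull ℝ _).starConvex (left_mem_tri a b c)
    exact ((this _ _ _).union (this _ _ _)).union (this _ _ _)
  · exact mem_image_of_mem f (Or.inr (left_mem_tri _ _ _))
  · rw [hb]; exact image_mono (boundary_subset_fan q)
  · rw [hb, ← image_sdiff f.injective]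
    have : IsOpen (fan q \ q.boundary ℝ) := by
      have he : fan q \ q.boundary ℝ = interior (fan q) ∩ (q.boundary ℝ)ᶜ := by
        apply Subset.antisymm
        · exact fun z hz => ⟨fan_diff_boundary_subset hq hz, hz.2⟩
        · exact fun z hz => ⟨interior_subset hz.1, hz.2⟩
      rw [he]
      exact isOpen_interior.inter (isCompact_boundary q).isClosed.isOpen_compl
    exact f.toHomeomorph.isOpenMap _ this

section
variable {n : ℕ} {τ : ℂ}

lemma cr_zero_left (x y : ℂ) : cr 0 x y = x.re * y.im - x.im * y.re := by simp [cr_def]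

lemma isFan_stdPentagon (hn : 3 ≤ n) (hτ : 0 < (τ ^ 2).re) : IsFan (stdPentagon n τ) := by
  have hs := unitDir_one_im_pos hn
  have h1 := sq_add_sq_unitDir n 1
  have hτ2 : 0 < τ.re ^ 2 - τ.im ^ 2 := by
    have : (τ ^ 2).re = τ.re ^ 2 - τ.im ^ 2 := by simp [sq]
    linarith
  have hτ3 : 0 < τ.re ^ 2 + τ.im ^ 2 := by nlinarith [sq_nonneg τ.im]
  set c := (unitDir n 1).re with hc
  set s := (unitDir n 1).im with hs'
  refine ⟨?_, ?_, ?_⟩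
  · have : cr (stdPentagon n τ 1) (stdPentagon n τ 2) (stdPentagon n τ 3) =
        (τ.re ^ 2 + τ.im ^ 2) * s := by
      simp [cr_def, ← hc, ← hs']; ring
    rw [this]; positivity
  · have : cr (stdPentagon n τ 1) (stdPentagon n τ 3) (stdPentagon n τ 4) =
        2 * (τ.re ^ 2 - τ.im ^ 2) * s + 2 * τ.re * τ.im * (c ^ 2 + s ^ 2 - 1) := by
      simp [cr_def, ← hc, ← hs']; ring
    rw [this, h1]; simp; positivity
  · have : cr (stdPentagon n τ 1) (stdPentagon n τ 4) (stdPentagon n τ 0) =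
        (τ.re ^ 2 + τ.im ^ 2) * s := by
      simp [cr_def, ← hc, ← hs']; ring
    rw [this]; positivity

/-- `T` has a corner at `v`: near `v` it coincides with the triangle `v x y`. -/
def Corner (T : Set ℂ) (v x y : ℂ) : Prop :=
  tri v x y ⊆ T ∧ ∃ ε > 0, ∀ z ∈ T, dist z v < ε → z ∈ tri v x y

lemma Corner.image {T : Set ℂ} {v x y : ℂ} (h : Corner T v x y) (f : ℂ ≃ᵢ ℂ) :
    Corner (f '' T) (f v) (f x) (f y) := by
  obtain ⟨h1, ε, hε, h2⟩ := h
  refine ⟨by rw [← image_tri]; exact image_mono h1, ε, hε, ?_⟩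
  rintro _ ⟨z, hz, rfl⟩ hd
  rw [f.dist_eq] at hd
  rw [← image_tri]
  exact mem_image_of_mem f (h2 z hz hd)

lemma Corner.swap {T : Set ℂ} {v x y : ℂ} (h : Corner T v x y) : Corner T v y x := by
  unfold Corner; rw [tri_swap]; exact h

/-- Near a vertex at which only one piece of a closed decomposition lies, the set is the corner of
that piece. -/
lemma corner_of_union {T S : Set ℂ} {v x y : ℂ} (hT : T = tri v x y ∪ S) (hS : IsClosed S)
    (hv : v ∉ S) : Corner T v x y := by
  refine ⟨hT ▸ subset_union_left, ?_⟩
  obtain ⟨ε, hε, h⟩ := Metric.isOpen_iff.1 hS.isOpen_compl v hv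
  refine ⟨ε, hε, fun z hz hd => ?_⟩
  rw [hT] at hz
  exact hz.resolve_right (h hd)

lemma cr_zero_comb (a p q : ℂ) (x y w : ℝ) :
    cr 0 a (x * 0 + y * p + w * q) = y * cr 0 a p + w * cr 0 a q := by
  simp [cr_zero_left]; ring

/-- At `A` the pentagon coincides locally with the triangle `A B E`, since the other two triangles
of the fan avoid `A`. -/
lemma corner_A (hn : 3 ≤ n) (hτ : 0 < (τ ^ 2).re) :
    Corner (fan (stdPentagon n τ)) (-τ) 0 (τ * (unitDir n 1 - 1)) := by
  obtain ⟨f1, f2, f3⟩ := isFan_stdPentagon hn hτ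
  have h1 := sq_add_sq_unitDir n 1
  have hτ2 : 0 < τ.re ^ 2 - τ.im ^ 2 := by
    have : (τ ^ 2).re = τ.re ^ 2 - τ.im ^ 2 := by simp [sq]
    linarith
  have hT : fan (stdPentagon n τ) = tri (-τ) 0 (τ * (unitDir n 1 - 1)) ∪
      (tri 0 (conj τ) (conj τ * (1 + unitDir n 1)) ∪
        tri 0 (conj τ * (1 + unitDir n 1)) (τ * (unitDir n 1 - 1))) := by
    rw [tri_rotate' 0, union_comm]; rfl
  refine corner_of_union hT ((isCompact_tri _ _ _).union (isCompact_tri _ _ _)).isClosed ?_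
  simp only [stdPentagon_zero, stdPentagon_one, stdPentagon_two, stdPentagon_three,
    stdPentagon_four] at *
  rintro (h | h)
  · obtain ⟨x, y, w, hx, hy, hw, -, h⟩ := mem_tri.1 h
    have h2 := congrArg Complex.re (congrArg (fun z => z * τ) h)
    simp at h2
    have hc : -1 ≤ (unitDir n 1).re := by nlinarith [sq_nonneg (unitDir n 1).im]
    have : 0 ≤ (τ.re ^ 2 + τ.im ^ 2) * (y + w * (1 + (unitDir n 1).re)) := by
      have : 0 ≤ w * (1 + (unitDir n 1).re) := mul_nonneg hw (by linarith)
      positivity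
    nlinarith
  · obtain ⟨x, y, w, hx, hy, hw, -, h⟩ := mem_tri.1 h
    rw [h, cr_zero_comb, cr_self_right] at f3
    have : cr 0 (τ * (unitDir n 1 - 1)) (conj τ * (1 + unitDir n 1)) =
      - cr 0 (conj τ * (1 + unitDir n 1)) (τ * (unitDir n 1 - 1)) := by
        simp only [cr_zero_left]; ring
    rw [this] at f3
    nlinarith

/-- At `C` the pentagon coincides locally with the triangle `C B D`, since the other two triangles
of the fan avoid `C`. -/
lemma corner_C (hn : 3 ≤ n) (hτ : 0 < (τ ^ 2).re) :
    Corner (fan (stdPentagon n τ)) (conj τ) 0 (conj τ * (1 + unitDir n 1)) := by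
  obtain ⟨f1, f2, f3⟩ := isFan_stdPentagon hn hτ
  have h1 := sq_add_sq_unitDir n 1
  have hτ2 : 0 < τ.re ^ 2 - τ.im ^ 2 := by
    have : (τ ^ 2).re = τ.re ^ 2 - τ.im ^ 2 := by simp [sq]
    linarith
  have hT : fan (stdPentagon n τ) = tri (conj τ) 0 (conj τ * (1 + unitDir n 1)) ∪
      (tri 0 (conj τ * (1 + unitDir n 1)) (τ * (unitDir n 1 - 1)) ∪
        tri 0 (τ * (unitDir n 1 - 1)) (-τ)) := by
    rw [← tri_swap, tri_rotate, ← union_assoc]; rfl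
  refine corner_of_union hT ((isCompact_tri _ _ _).union (isCompact_tri _ _ _)).isClosed ?_
  simp only [stdPentagon_zero, stdPentagon_one, stdPentagon_two, stdPentagon_three,
    stdPentagon_four] at *
  rintro (h | h)
  · obtain ⟨x, y, w, hx, hy, hw, -, h⟩ := mem_tri.1 h
    have h2 : cr 0 (conj τ * (1 + unitDir n 1)) (conj τ) =
      - cr 0 (conj τ) (conj τ * (1 + unitDir n 1)) := by
        simp only [cr_zero_left]; ring
    have h3 : 0 ≤ cr 0 (conj τ * (1 + unitDir n 1)) (conj τ) := by
      conv_rhs => arg 3; rw [h]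
      rw [cr_zero_comb, cr_self_right]
      simp only [mul_zero, zero_add]; positivity
    linarith
  · obtain ⟨x, y, w, hx, hy, hw, -, h⟩ := mem_tri.1 h
    have h2 := congrArg Complex.re (congrArg (fun z => z * conj τ) h)
    simp at h2
    have hc : (unitDir n 1).re ≤ 1 := by nlinarith [sq_nonneg (unitDir n 1).im]
    have : 0 ≤ (τ.re ^ 2 + τ.im ^ 2) * (w + y * (1 - (unitDir n 1).re)) := by
      have : 0 ≤ y * (1 - (unitDir n 1).re) := mul_nonneg hy (by linarith)
      positivity
    nlinarith

end

/-! ### The angle conditions determine the pentagon up to congruence -/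

lemma sub_eq_exp_mul_of_vertexAngle {m : ℕ} [NeZero m] {p : Polygon ℂ m} {i : Fin m} {v : ℝ}
    (h : vertexAngle p i = v) (hd : dist (p (i - 1)) (p i) = dist (p (i + 1)) (p i)) :
    p (i - 1) - p i = exp (v * I) * (p (i + 1) - p i) := by
  rw [dist_eq_norm, dist_eq_norm] at hd
  by_cases h0 : p (i + 1) - p i = 0
  · rw [h0, norm_zero, norm_eq_zero] at hd
    rw [h0, hd, mul_zero]
  have h1 : ((p (i - 1) - p i) / (p (i + 1) - p i)).arg =
      v + toIcoDiv Real.two_pi_pos 0 ((p (i - 1) - p i) / (p (i + 1) - p i)).arg * (2 * Real.pi) := by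
    have := toIcoMod_add_toIcoDiv_zsmul Real.two_pi_pos 0
      ((p (i - 1) - p i) / (p (i + 1) - p i)).arg
    rw [vertexAngle] at h
    rw [h, zsmul_eq_mul] at this
    exact this.symm
  have h2 := Complex.norm_mul_exp_arg_mul_I ((p (i - 1) - p i) / (p (i + 1) - p i))
  rw [norm_div, hd, div_self (by rwa [norm_ne_zero_iff]), h1] at h2
  push_cast at h2
  rw [add_mul, Complex.exp_add, mul_assoc _ (2 * _ : ℂ), Complex.exp_int_mul_two_pi_mul_I] at h2
  rw [eq_div_iff h0] at h2
  rw [← h2]; simp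

lemma ne_of_isSimple {m : ℕ} {p : Polygon ℂ m} (h : IsSimple p) {i j : Fin m} (hij : i ≠ j) :
    p i ≠ p j := by
  intro he
  have := @h (i, 0) (by simp) (j, 0) (by simp) (by simpa [Polygon.edgePath] using he)
  exact hij (congrArg Prod.fst this)

/-- The angles at `A`, `B`, `C` and the equal sides fix a counterclockwise pentagon up to a direct
isometry. -/
lemma exists_direct_of_satisfiesCcw {n : ℕ} {θ : ℝ} (hθ0 : 0 < θ) (hθπ : θ < Real.pi)
    (hθ : θ ≠ Real.pi / 2) {p : Polygon ℂ 5} (hp : SatisfiesCcw n θ p) :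
    ∃ τ a b : ℂ, ‖a‖ = 1 ∧ 0 < τ.re ∧ τ.im ≠ 0 ∧ 0 < (τ ^ 2).re ∧
      ∀ i, p i = a * stdPentagon n τ i + b := by
  obtain ⟨hs, hA, hB, hC, -, -, d1, d2, d3⟩ := hp
  have eA := sub_eq_exp_mul_of_vertexAngle hA (by
    show dist (p 4) (p 0) = dist (p 1) (p 0)
    rw [dist_comm (p 1)]; exact d1.symm)
  have eB := sub_eq_exp_mul_of_vertexAngle hB (by
    show dist (p 0) (p 1) = dist (p 2) (p 1)
    rw [dist_comm (p 2)]; exact d1.trans d2.symm)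
  have eC := sub_eq_exp_mul_of_vertexAngle hC (by
    show dist (p 1) (p 2) = dist (p 3) (p 2)
    rw [dist_comm (p 3)]; exact d2.trans d3.symm)
  replace eA : p 4 - p 0 = exp ((2 * Real.pi / n : ℝ) * I) * (p 1 - p 0) := eA
  replace eB : p 0 - p 1 = exp ((Real.pi / 2 + θ : ℝ) * I) * (p 2 - p 1) := eB
  replace eC : p 1 - p 2 = exp ((Real.pi - 2 * Real.pi / n : ℝ) * I) * (p 3 - p 2) := eC
  set ω := unitDir n 1 with hω
  have hω' : exp ((2 * Real.pi / n : ℝ) * I) = ω := by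
    rw [hω, unitDir]; congr 2; push_cast; ring_nf
  have hω1 : ω * conj ω = 1 := unitDir_mul_conj n 1
  set η : ℝ := θ / 2 - Real.pi / 4 with hη
  set e : ℂ := exp (η * I) with he
  have he1 : e * conj e = 1 := by
    rw [mul_conj, normSq_eq_norm_sq, he, Complex.norm_exp_ofReal_mul_I]; simp
  have heB : exp ((Real.pi / 2 + θ : ℝ) * I) = -e ^ 2 := by
    rw [he, ← Complex.exp_nat_mul, ← mul_neg_one, ← Complex.exp_pi_mul_I, ← Complex.exp_add]
    congr 1; rw [hη]; push_cast; ring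
  have heC : exp ((Real.pi - 2 * Real.pi / n : ℝ) * I) = - conj ω := by
    rw [← hω', ← Complex.exp_conj, ← mul_neg_one, ← Complex.exp_pi_mul_I, ← Complex.exp_add]
    congr 1; simp [Complex.conj_ofNat]; ring
  rw [hω'] at eA
  rw [heB] at eB
  rw [heC] at eC
  have hne : p 2 - p 1 ≠ 0 := sub_ne_zero.2 (ne_of_isSimple hs (by decide))
  -- `c` is the common similarity factor
  set c : ℂ := e * (p 2 - p 1) with hc
  have hc0 : c ≠ 0 := mul_ne_zero (Complex.exp_ne_zero _) hne
  have hcn : (‖c‖ : ℂ) ≠ 0 := by exact_mod_cast norm_ne_zero_iff.2 hc0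
  have hpos : 0 < ‖c‖ := norm_pos_iff.2 hc0
  have η1 : -(Real.pi / 4) < η := by rw [hη]; linarith
  have η2 : η < Real.pi / 4 := by rw [hη]; linarith
  have ere : e.re = Real.cos η := Complex.exp_ofReal_mul_I_re _
  have eim : e.im = Real.sin η := Complex.exp_ofReal_mul_I_im _
  have h4 : p 4 = c * (e * (ω - 1)) + p 1 := by
    rw [hc]; linear_combination eA + (1 - ω) * eB
  refine ⟨‖c‖ * e, c / ‖c‖, p 1, by simp [hc0], ?_, ?_, ?_, ?_⟩
  · rw [re_ofReal_mul, ere]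
    exact mul_pos hpos (Real.cos_pos_of_mem_Ioo ⟨by linarith [Real.pi_pos], by linarith [Real.pi_pos]⟩)
  · rw [im_ofReal_mul, eim]
    refine mul_ne_zero hpos.ne' fun h0 => hθ ?_
    have := (Real.sin_eq_zero_iff_of_lt_of_lt (by linarith [Real.pi_pos])
      (by linarith [Real.pi_pos])).1 h0
    rw [hη] at this; linarith
  · have : ((‖c‖ : ℂ) * e) ^ 2 = ((‖c‖ ^ 2 : ℝ) : ℂ) * exp ((2 * η : ℝ) * I) := by
      rw [mul_pow, he, ← Complex.exp_nat_mul]; push_cast; ring_nf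
    rw [this, re_ofReal_mul, Complex.exp_ofReal_mul_I_re]
    exact mul_pos (by positivity) (Real.cos_pos_of_mem_Ioo ⟨by linarith, by linarith⟩)
  · intro i
    have hcc : c * conj e = p 2 - p 1 := by
      rw [hc]; linear_combination (p 2 - p 1) * he1
    fin_cases i
    · simp; field_simp; rw [hc]; linear_combination eB
    · simp
    · simp; field_simp; linear_combination -hcc
    · simp; field_simp; rw [← hω]; linear_combination (-1 - ω) * hcc + ω * eC - (p 3 - p 2) * hω1
    · simp; field_simp; rw [← hω]; linear_combination h4

lemma exists_isometry_of_satisfies {n : ℕ} {θ : ℝ} (hθ0 : 0 < θ) (hθπ : θ < Real.pi)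
    (hθ : θ ≠ Real.pi / 2) {p : Polygon ℂ 5} (hp : Satisfies n θ p) :
    ∃ (τ : ℂ) (f : ℂ ≃ᵢ ℂ), 0 < τ.re ∧ τ.im ≠ 0 ∧ 0 < (τ ^ 2).re ∧
      ∀ i, p i = f (stdPentagon n τ i) := by
  rcases hp with hp | hp
  · obtain ⟨τ, a, b, ha, h1, h2, h3, h⟩ := exists_direct_of_satisfiesCcw hθ0 hθπ hθ hp
    exact ⟨τ, directIso a b ha, h1, h2, h3, h⟩
  · obtain ⟨τ, a, b, ha, h1, h2, h3, h⟩ := exists_direct_of_satisfiesCcw hθ0 hθπ hθ hp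
    refine ⟨τ, reverseIso (conj a) (conj b) (by simpa), h1, h2, h3, fun i => ?_⟩
    have := congrArg conj (h i)
    simp only [mirror] at this
    simpa using this

/-! ### Polygons that are star-shaped about the origin -/

/-- The vertex number `j` of a polygon that is star-shaped about `0`: it has distance `‖q‖ * r j`
from `0`, and consecutive vertices are seen from `0` at the angle `2π/m`. -/
noncomputable def starVertex (m : ℕ) (q : ℂ) (r : ℤ → ℝ) (j : ℤ) : ℂ := q * (r j * unitDir m j)

/-- The polygon with vertices `starVertex m q r j`. -/
noncomputable def starPolygon (m : ℕ) (q : ℂ) (r : ℤ → ℝ) : Polygon ℂ m :=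
  ⟨fun j => starVertex m q r (j.val : ℤ)⟩

/-- The points `a * h j + b * h (j + 1)` of the sectors between consecutive vertices `h j` with
nonnegative coordinates `a`, `b` whose sum (the gauge of the point) satisfies the condition `C`. -/
def starSet (m : ℕ) (q : ℂ) (r : ℤ → ℝ) (C : ℝ → Prop) : Set ℂ :=
  {z | ∃ (j : ℤ) (a b : ℝ), 0 ≤ a ∧ 0 ≤ b ∧ C (a + b) ∧
    z = a * starVertex m q r j + b * starVertex m q r (j + 1)}

lemma arg_mem_of_im {ζ : ℂ} {β : ℝ} (hβ : 0 < β) (h1 : 0 ≤ ζ.im)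
    (h2 : (ζ * exp ((-β : ℝ) * I)).im < 0) : 0 ≤ ζ.arg ∧ ζ.arg < β := by
  have h0 := Complex.arg_nonneg_iff.2 h1
  refine ⟨h0, ?_⟩
  by_contra! h
  have h3 : ζ * exp ((-β : ℝ) * I) = ((‖ζ‖ : ℝ) : ℂ) * exp ((ζ.arg - β : ℝ) * I) := by
    conv_lhs => rw [← Complex.norm_mul_exp_arg_mul_I ζ]
    rw [mul_assoc, ← Complex.exp_add]; congr 2; push_cast; ring
  rw [h3, im_ofReal_mul, Complex.exp_ofReal_mul_I_im] at h2
  have := Real.sin_nonneg_of_nonneg_of_le_pi (x := ζ.arg - β) (by linarith)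
    (by linarith [Complex.arg_le_pi ζ])
  have := mul_nonneg (norm_nonneg ζ) this
  linarith

section
variable {m : ℕ} {q : ℂ} {r : ℤ → ℝ}

lemma starVertex_period (hm : 3 ≤ m) (hper : ∀ j, r (j + m) = r j) (j k : ℤ) :
    starVertex m q r (j + m * k) = starVertex m q r j := by
  have : r (j + m * k) = r j := by
    have h := Function.Periodic.int_mul (f := r) (c := (m : ℤ)) hper k j
    rw [mul_comm] at h
    exact h
  rw [starVertex, starVertex, this, unitDir_add, unitDir_mul_period (by omega), mul_one]

lemma starVertex_emod (hm : 3 ≤ m) (hper : ∀ j, r (j + m) = r j) (j : ℤ) :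
    starVertex m q r (j % m) = starVertex m q r j := by
  conv_rhs => rw [← Int.emod_add_mul_ediv j m]
  rw [starVertex_period hm hper]

lemma starVertex_succ_emod (hm : 3 ≤ m) (hper : ∀ j, r (j + m) = r j) (j : ℤ) :
    starVertex m q r (j % m + 1) = starVertex m q r (j + 1) := by
  conv_rhs => rw [← Int.emod_add_mul_ediv j m]
  rw [add_right_comm, starVertex_period hm hper]

lemma starVertex_comb (a b : ℝ) (j : ℤ) :
    a * starVertex m q r j + b * starVertex m q r (j + 1) =
      q * unitDir m j * (a * r j + b * r (j + 1) * unitDir m 1) := by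
  rw [starVertex, starVertex, unitDir_add]; ring

lemma starVertex_coords_unique (hm : 3 ≤ m) (hq : q ≠ 0) (hr : ∀ j, 0 < r j) {j : ℤ}
    {a b a' b' : ℝ} (h : a * starVertex m q r j + b * starVertex m q r (j + 1) =
      a' * starVertex m q r j + b' * starVertex m q r (j + 1)) : a = a' ∧ b = b' := by
  rw [starVertex_comb, starVertex_comb] at h
  have h1 := mul_left_cancel₀ (mul_ne_zero hq (unitDir_ne_zero m j)) h
  have him := congrArg Complex.im h1
  have hre := congrArg Complex.re h1
  simp only [add_im, mul_im, ofReal_re, ofReal_im, mul_re, add_re, mul_zero, zero_mul, add_zero,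
    zero_add, sub_zero] at him hre
  have hb : b = b' := by
    have := mul_right_cancel₀ (unitDir_one_im_pos hm).ne' him
    exact mul_right_cancel₀ (hr _).ne' this
  subst hb
  exact ⟨mul_right_cancel₀ (hr j).ne' (by linarith), rfl⟩

/-- The polar form of a point of the `j`-th sector. -/
lemma exists_polar (hm : 3 ≤ m) (hr : ∀ j, 0 < r j) {j : ℤ} {a b : ℝ} (ha : 0 < a) (hb : 0 ≤ b) :
    ∃ ρ x : ℝ, 0 < ρ ∧ 0 ≤ x ∧ x < 1 ∧
      a * starVertex m q r j + b * starVertex m q r (j + 1) =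
        q * (ρ * exp ((2 * Real.pi / m * (j + x) : ℝ) * I)) := by
  set β : ℝ := 2 * Real.pi / m with hβ
  have hm' : (3 : ℝ) ≤ m := by exact_mod_cast hm
  have hβ0 : 0 < β := by have := Real.pi_pos; positivity
  have hβπ : β < Real.pi := by
    rw [hβ, div_lt_iff₀ (by linarith)]; nlinarith [Real.pi_pos]
  set ζ : ℂ := a * r j + b * r (j + 1) * unitDir m 1 with hζ
  have hsin := unitDir_one_im_pos hm
  have hu : unitDir m 1 = exp ((β : ℝ) * I) := by
    rw [unitDir, hβ]; congr 2; push_cast; ring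
  have hβs : 0 < Real.sin β := Real.sin_pos_of_pos_of_lt_pi hβ0 hβπ
  have h1 : 0 ≤ ζ.im := by
    have : ζ.im = b * r (j + 1) * (unitDir m 1).im := by simp [hζ]
    rw [this]; have := hr (j + 1); positivity
  have h2 : (ζ * exp ((-β : ℝ) * I)).im = - (a * r j * Real.sin β) := by
    have : ζ * exp ((-β : ℝ) * I) = ((a * r j : ℝ) : ℂ) * exp ((-β : ℝ) * I) +
        ((b * r (j + 1) : ℝ) : ℂ) := by
      rw [hζ, hu, add_mul, mul_assoc _ (exp _), ← Complex.exp_add]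
      simp
    rw [this, add_im, im_ofReal_mul, Complex.exp_ofReal_mul_I_im, ofReal_im, Real.sin_neg]; ring
  have h3 : 0 < a * r j * Real.sin β := by have := hr j; positivity
  obtain ⟨k1, k2⟩ := arg_mem_of_im hβ0 h1 (by rw [h2]; linarith)
  have hζ0 : ζ ≠ 0 := by
    intro h; rw [h, zero_mul, zero_im] at h2; linarith
  refine ⟨‖ζ‖, ζ.arg / β, norm_pos_iff.2 hζ0, by positivity, (div_lt_one hβ0).2 k2, ?_⟩
  rw [starVertex_comb, ← hζ]
  conv_lhs => rw [← Complex.norm_mul_exp_arg_mul_I ζ]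
  have : (β * (j + ζ.arg / β) : ℝ) = 2 * Real.pi * j / m + ζ.arg := by
    rw [mul_add, mul_div_cancel₀ _ hβ0.ne', hβ]; ring
  rw [this, unitDir, ofReal_add, add_mul, Complex.exp_add]; ring

/-- Every nonzero point lies in exactly one half-open sector, and its coordinates there are
unique. -/
lemma star_unique (hm : 3 ≤ m) (hq : q ≠ 0) (hr : ∀ j, 0 < r j) (hper : ∀ j, r (j + m) = r j)
    {j i : ℤ} {a b a' b' : ℝ} (ha : 0 < a) (hb : 0 ≤ b) (ha' : 0 < a') (hb' : 0 ≤ b')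
    (h : a * starVertex m q r j + b * starVertex m q r (j + 1) =
      a' * starVertex m q r i + b' * starVertex m q r (i + 1)) :
    (∃ k : ℤ, j = i + m * k) ∧ a = a' ∧ b = b' := by
  have key : ∃ k : ℤ, j = i + m * k := by
    obtain ⟨ρ, x, hρ, x0, x1, e1⟩ := exists_polar (q := q) hm hr (j := j) ha hb
    obtain ⟨ρ', y, hρ', y0, y1, e2⟩ := exists_polar (q := q) hm hr (j := i) ha' hb'
    rw [e1, e2] at h
    have h1 := mul_left_cancel₀ hq h
    have hρρ : ρ = ρ' := by
      have := congrArg norm h1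
      rwa [norm_mul, norm_mul, Complex.norm_exp_ofReal_mul_I, Complex.norm_exp_ofReal_mul_I,
        Complex.norm_of_nonneg hρ.le, Complex.norm_of_nonneg hρ'.le, mul_one, mul_one] at this
    subst hρρ
    have h2 := mul_left_cancel₀ (by exact_mod_cast hρ.ne') h1
    obtain ⟨k, hk⟩ := Complex.exp_eq_exp_iff_exists_int.1 h2
    have hm' : (0 : ℝ) < m := by exact_mod_cast (by omega : 0 < m)
    have h3 : 2 * Real.pi / m * (j + x) = 2 * Real.pi / m * (i + y) + k * (2 * Real.pi) := by
      have h5 : (((2 * Real.pi / m * (j + x) : ℝ) : ℂ)) * I =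
          ((2 * Real.pi / m * (i + y) + k * (2 * Real.pi) : ℝ) : ℂ) * I := by
        rw [hk]; push_cast; ring
      exact_mod_cast mul_right_cancel₀ I_ne_zero h5
    have h4 : (j : ℝ) + x = i + y + m * k := by
      have := Real.pi_pos
      field_simp at h3
      linarith
    refine ⟨k, ?_⟩
    have h6 : (j : ℝ) - (i + m * k : ℤ) < 1 := by push_cast; linarith
    have h7 : -1 < (j : ℝ) - (i + m * k : ℤ) := by push_cast; linarith
    have h8 : j - (i + m * k) < 1 := by exact_mod_cast h6
    have h9 : -1 < j - (i + m * k) := by exact_mod_cast h7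
    omega
  refine ⟨key, ?_⟩
  obtain ⟨k, rfl⟩ := key
  rw [add_right_comm, starVertex_period hm hper, starVertex_period hm hper] at h
  exact starVertex_coords_unique hm hq hr h

lemma star_normalize {j : ℤ} {a b : ℝ} (ha : 0 ≤ a) (hb : 0 ≤ b) (hab : 0 < a + b) :
    ∃ (j' : ℤ) (a' b' : ℝ), 0 < a' ∧ 0 ≤ b' ∧ a' + b' = a + b ∧
      a * starVertex m q r j + b * starVertex m q r (j + 1) =
        a' * starVertex m q r j' + b' * starVertex m q r (j' + 1) := by
  rcases ha.eq_or_lt with rfl | ha'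
  · exact ⟨j + 1, b, 0, by linarith, le_rfl, by ring, by simp⟩
  · exact ⟨j, a, b, ha', hb, rfl, rfl⟩

/-- The sum of the sector coordinates of a point does not depend on the sector used to express it,
so it serves as a gauge for the star-shaped polygon. -/
lemma star_gauge_unique (hm : 3 ≤ m) (hq : q ≠ 0) (hr : ∀ j, 0 < r j)
    (hper : ∀ j, r (j + m) = r j) {j i : ℤ} {a b a' b' : ℝ} (ha : 0 ≤ a) (hb : 0 ≤ b)
    (ha' : 0 ≤ a') (hb' : 0 ≤ b')
    (h : a * starVertex m q r j + b * starVertex m q r (j + 1) =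
      a' * starVertex m q r i + b' * starVertex m q r (i + 1)) : a + b = a' + b' := by
  have zero : ∀ {j : ℤ} {a b : ℝ}, a * starVertex m q r j + b * starVertex m q r (j + 1) = 0 →
      a + b = 0 := by
    intro j a b h
    have := starVertex_coords_unique hm hq hr (j := j) (a := a) (b := b) (a' := 0) (b' := 0)
      (by simpa using h)
    rw [this.1, this.2, add_zero]
  rcases (add_nonneg ha hb).eq_or_lt with h0 | h0
  · have ha0 : a = 0 := by linarith
    have hb0 : b = 0 := by linarith
    rw [ha0, hb0] at h ⊢
    rw [zero (j := i) (a := a') (b := b') (by rw [← h]; simp)]; simp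
  rcases (add_nonneg ha' hb').eq_or_lt with h0' | h0'
  · have ha0 : a' = 0 := by linarith
    have hb0 : b' = 0 := by linarith
    rw [ha0, hb0] at h ⊢
    rw [zero (j := j) (a := a) (b := b) (by rw [h]; simp)]; simp
  obtain ⟨j1, a1, b1, p1, p2, p3, p4⟩ := star_normalize (m := m) (q := q) (r := r) (j := j) ha hb h0
  obtain ⟨j2, a2, b2, q1, q2, q3, q4⟩ :=
    star_normalize (m := m) (q := q) (r := r) (j := i) ha' hb' h0'
  obtain ⟨-, h1, h2⟩ := star_unique hm hq hr hper p1 p2 q1 q2 (by rw [← p4, ← q4, h])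
  rw [← p3, ← q3, h1, h2]

/-- The sectors cover the plane. -/
lemma star_cover (hm : 3 ≤ m) (hq : q ≠ 0) (hr : ∀ j, 0 < r j) (z : ℂ) :
    ∃ (j : ℤ) (a b : ℝ), 0 ≤ a ∧ 0 ≤ b ∧
      z = a * starVertex m q r j + b * starVertex m q r (j + 1) := by
  set β : ℝ := 2 * Real.pi / m with hβ
  have hm' : (3 : ℝ) ≤ m := by exact_mod_cast hm
  have hβ0 : 0 < β := by have := Real.pi_pos; positivity
  have hβπ : β < Real.pi := by
    rw [hβ, div_lt_iff₀ (by linarith)]; nlinarith [Real.pi_pos]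
  have hβs : 0 < Real.sin β := Real.sin_pos_of_pos_of_lt_pi hβ0 hβπ
  set ζ := z / q with hζ
  set t := ζ.arg / β with ht
  set x := Int.fract t with hx
  have x0 : 0 ≤ x := Int.fract_nonneg _
  have x1 : x < 1 := Int.fract_lt_one _
  set j := ⌊t⌋ with hj
  have htj : t = j + x := (Int.floor_add_fract t).symm
  have hu : unitDir m 1 = exp ((β : ℝ) * I) := by
    rw [unitDir, hβ]; congr 2; push_cast; ring
  have s1 : 0 ≤ Real.sin ((1 - x) * β) := Real.sin_nonneg_of_nonneg_of_le_pi (by nlinarith)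
    (by nlinarith)
  have s2 : 0 ≤ Real.sin (x * β) := Real.sin_nonneg_of_nonneg_of_le_pi (by nlinarith) (by nlinarith)
  refine ⟨j, ‖ζ‖ * Real.sin ((1 - x) * β) / Real.sin β / r j,
    ‖ζ‖ * Real.sin (x * β) / Real.sin β / r (j + 1), ?_, ?_, ?_⟩
  · have := hr j; positivity
  · have := hr (j + 1); positivity
  · rw [starVertex_comb]
    have hz : z = q * (‖ζ‖ * exp (ζ.arg * I)) := by
      rw [Complex.norm_mul_exp_arg_mul_I, hζ]; field_simp
    have hexp : exp (ζ.arg * I) = unitDir m j * exp ((x * β : ℝ) * I) := by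
      rw [unitDir, ← Complex.exp_add]
      have : ζ.arg = 2 * Real.pi * j / m + x * β := by
        have : ζ.arg = t * β := by rw [ht]; field_simp
        rw [this, htj, hβ]; ring
      rw [this]; push_cast; ring_nf
    have hcomb : (Real.sin β : ℂ) * exp ((x * β : ℝ) * I) =
        Real.sin ((1 - x) * β) + Real.sin (x * β) * exp ((β : ℝ) * I) := by
      have e1 : (1 - x) * β = β - x * β := by ring
      apply Complex.ext
      · simp only [re_ofReal_mul, Complex.exp_ofReal_mul_I_re, add_re, ofReal_re]
        rw [e1, Real.sin_sub]; ring
      · simp only [im_ofReal_mul, Complex.exp_ofReal_mul_I_im, add_im, ofReal_im]; ring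
    rw [hz, hexp, hu]
    have r1 : (r j : ℂ) ≠ 0 := by exact_mod_cast (hr j).ne'
    have r2 : (r (j + 1) : ℂ) ≠ 0 := by exact_mod_cast (hr (j + 1)).ne'
    have r3 : (Real.sin β : ℂ) ≠ 0 := by exact_mod_cast hβs.ne'
    have hgoal : ((‖ζ‖ * Real.sin ((1 - x) * β) / Real.sin β / r j : ℝ) : ℂ) * r j +
        ((‖ζ‖ * Real.sin (x * β) / Real.sin β / r (j + 1) : ℝ) : ℂ) * r (j + 1) *
          exp ((β : ℝ) * I) = ‖ζ‖ * exp ((x * β : ℝ) * I) := by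
      apply mul_left_cancel₀ r3
      rw [show (Real.sin β : ℂ) * (‖ζ‖ * exp ((x * β : ℝ) * I)) =
        ‖ζ‖ * ((Real.sin β : ℂ) * exp ((x * β : ℝ) * I)) by ring, hcomb]
      simp only [ofReal_div, ofReal_mul]
      field_simp
    rw [hgoal]; ring

lemma cr_starVertex_pos (hm : 3 ≤ m) (hq : q ≠ 0) (hr : ∀ j, 0 < r j) (j : ℤ) :
    0 < cr 0 (starVertex m q r j) (starVertex m q r (j + 1)) := by
  have h1 : conj (starVertex m q r j) * starVertex m q r (j + 1) =
      ((normSq q * r j * r (j + 1) : ℝ) : ℂ) * unitDir m 1 := by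
    rw [starVertex, starVertex, unitDir_add]
    simp only [map_mul, conj_ofReal, ofReal_mul, ← mul_conj]
    linear_combination (q * conj q * r j * r (j + 1) * unitDir m 1) * unitDir_mul_conj m j
  rw [cr, sub_zero, sub_zero, h1, im_ofReal_mul]
  have h2 := hr j
  have h3 := hr (j + 1)
  have h4 := normSq_pos.2 hq
  have h5 := unitDir_one_im_pos hm
  positivity

lemma starSet_reindex (hm : 3 ≤ m) (hper : ∀ j, r (j + m) = r j) {C : ℝ → Prop} {z : ℂ}
    (hz : z ∈ starSet m q r C) : ∃ (j : Fin m) (a b : ℝ), 0 ≤ a ∧ 0 ≤ b ∧ C (a + b) ∧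
      z = a * starVertex m q r (j.val : ℤ) + b * starVertex m q r ((j.val : ℤ) + 1) := by
  obtain ⟨j, a, b, ha, hb, hC, rfl⟩ := hz
  have hm0 : (0 : ℤ) < m := by omega
  have h1 := Int.emod_nonneg j hm0.ne'
  have h2 := Int.emod_lt_of_pos j hm0
  refine ⟨⟨(j % m).toNat, by omega⟩, a, b, ha, hb, hC, ?_⟩
  simp only [Int.toNat_of_nonneg h1, starVertex_emod hm hper, starVertex_succ_emod hm hper]

lemma starSet_le_eq (hm : 3 ≤ m) (hper : ∀ j, r (j + m) = r j) :
    starSet m q r (· ≤ 1) =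
      ⋃ j : Fin m, tri 0 (starVertex m q r (j.val : ℤ)) (starVertex m q r ((j.val : ℤ) + 1)) := by
  ext z
  simp only [mem_iUnion, mem_tri]
  constructor
  · intro hz
    obtain ⟨j, a, b, ha, hb, h, rfl⟩ := starSet_reindex hm hper hz
    exact ⟨j, 1 - a - b, a, b, by linarith, ha, hb, by ring, by simp⟩
  · rintro ⟨j, x, a, b, hx, ha, hb, h, rfl⟩
    exact ⟨j, a, b, ha, hb, by linarith, by simp⟩

lemma isCompact_starSet (hm : 3 ≤ m) (hper : ∀ j, r (j + m) = r j) :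
    IsCompact (starSet m q r (· ≤ 1)) := by
  rw [starSet_le_eq hm hper]
  exact isCompact_iUnion fun j => isCompact_tri _ _ _

lemma isClosed_starSet (hm : 3 ≤ m) (hq : q ≠ 0) (hr : ∀ j, 0 < r j)
    (hper : ∀ j, r (j + m) = r j) : IsClosed (starSet m q r (1 ≤ ·)) := by
  set h : ℤ → ℂ := starVertex m q r with hh
  have : starSet m q r (1 ≤ ·) = ⋃ j : Fin m, {z | 0 ≤ cr 0 (h j.val) z ∧
      0 ≤ cr (h (j.val + 1)) 0 z ∧ cr (h j.val) (h (j.val + 1)) z ≤ 0} := by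
    ext z
    simp only [mem_iUnion, mem_ofPred_eq]
    constructor
    · intro hz
      obtain ⟨j, a, b, ha, hb, hab, rfl⟩ := starSet_reindex hm hper hz
      have hΔ := cr_starVertex_pos hm hq hr j.val
      rw [← hh] at hΔ
      refine ⟨j, ?_, ?_, ?_⟩
      · have : cr 0 (h j.val) (a * h j.val + b * h (j.val + 1)) =
            b * cr 0 (h j.val) (h (j.val + 1)) := by simp [cr_def]; ring
        rw [this]; positivity
      · have : cr (h (j.val + 1)) 0 (a * h j.val + b * h (j.val + 1)) =
            a * cr 0 (h j.val) (h (j.val + 1)) := by simp [cr_def]; ring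
        rw [this]; positivity
      · have : cr (h j.val) (h (j.val + 1)) (a * h j.val + b * h (j.val + 1)) =
            (1 - (a + b)) * cr 0 (h j.val) (h (j.val + 1)) := by simp [cr_def]; ring
        rw [this]; nlinarith
    · rintro ⟨j, h1, h2, h3⟩
      have hΔ := cr_starVertex_pos hm hq hr j.val
      rw [← hh] at hΔ
      refine ⟨j.val, cr (h (j.val + 1)) 0 z / cr 0 (h j.val) (h (j.val + 1)),
        cr 0 (h j.val) z / cr 0 (h j.val) (h (j.val + 1)), by positivity, by positivity, ?_, ?_⟩
      · have h4 := cr_add 0 (h j.val) (h (j.val + 1)) z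
        show 1 ≤ _
        rw [← add_div, le_div_iff₀ hΔ]; linarith
      · have hne : ((cr 0 (h j.val) (h (j.val + 1)) : ℝ) : ℂ) ≠ 0 := by exact_mod_cast hΔ.ne'
        rw [← hh]
        push_cast
        field_simp
        apply Complex.ext <;> simp [cr_def] <;> ring
  rw [this]
  refine isClosed_iUnion_of_finite fun j => ?_
  exact (isClosed_le continuous_const (continuous_cr _ _)).inter
    ((isClosed_le continuous_const (continuous_cr _ _)).inter
    (isClosed_le (continuous_cr _ _) continuous_const))

lemma starPolygon_finRotate (hm : 3 ≤ m) (hper : ∀ j, r (j + m) = r j) (i : Fin m) :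
    starPolygon m q r (finRotate m i) = starVertex m q r ((i.val : ℤ) + 1) := by
  have : NeZero m := ⟨by omega⟩
  have h1 : ((finRotate m i).val : ℤ) = ((i.val : ℤ) + 1) % m := by
    rw [finRotate_apply, Fin.val_add, Fin.val_one', Nat.add_mod_mod]; push_cast; rfl
  show starVertex m q r ((finRotate m i).val : ℤ) = _
  rw [h1, starVertex_emod hm hper]

lemma boundary_starPolygon (hm : 3 ≤ m) (hper : ∀ j, r (j + m) = r j) :
    (starPolygon m q r).boundary ℝ = starSet m q r (· = 1) := by
  ext z
  simp only [Polygon.boundary, mem_iUnion, mem_edgeSet, starPolygon_finRotate hm hper]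
  constructor
  · rintro ⟨i, t, h0, h1, rfl⟩
    exact ⟨i.val, 1 - t, t, by linarith, h0, by ring, rfl⟩
  · intro hz
    obtain ⟨j, a, b, ha, hb, h, rfl⟩ := starSet_reindex hm hper hz
    obtain rfl : a = 1 - b := by linarith
    exact ⟨j, b, hb, by linarith, rfl⟩

lemma starSet_diff (hm : 3 ≤ m) (hq : q ≠ 0) (hr : ∀ j, 0 < r j) (hper : ∀ j, r (j + m) = r j) :
    starSet m q r (· ≤ 1) \ starSet m q r (· = 1) = (starSet m q r (1 ≤ ·))ᶜ := by
  ext z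
  constructor
  · rintro ⟨⟨j, a, b, ha, hb, h, rfl⟩, hz⟩ ⟨i, a', b', ha', hb', h', he⟩
    have := star_gauge_unique hm hq hr hper ha hb ha' hb' he
    exact hz ⟨j, a, b, ha, hb, by linarith, rfl⟩
  · intro hz
    obtain ⟨j, a, b, ha, hb, rfl⟩ := star_cover (m := m) (q := q) (r := r) hm hq hr z
    refine ⟨⟨j, a, b, ha, hb, ?_, rfl⟩, ?_⟩
    · by_contra! h
      exact hz ⟨j, a, b, ha, hb, h.le, rfl⟩
    · rintro ⟨i, a', b', ha', hb', h', he⟩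
      exact hz ⟨i, a', b', ha', hb', h'.ge, he⟩

lemma starConvex_starSet : StarConvex ℝ 0 (starSet m q r (· ≤ 1)) := by
  rw [starConvex_zero_iff]
  rintro z ⟨j, a, b, ha, hb, h, rfl⟩ t t0 t1
  refine ⟨j, t * a, t * b, by positivity, by positivity, ?_, ?_⟩
  · have : (0 : ℝ) ≤ a + b := by positivity
    simp only
    nlinarith
  · simp; ring

lemma zero_mem_starSet : (0 : ℂ) ∈ starSet m q r (· ≤ 1) :=
  ⟨0, 0, 0, le_rfl, le_rfl, by norm_num, by simp⟩

section
variable (hm : 3 ≤ m) (hq : q ≠ 0) (hr : ∀ j, 0 < r j) (hper : ∀ j, r (j + m) = r j)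
include hm hq hr hper

/-- The bounded region enclosed by the polygon consists of the points of gauge less than `1`. -/
lemma inside_starPolygon : inside (starPolygon m q r) = (starSet m q r (1 ≤ ·))ᶜ := by
  have hb := boundary_starPolygon (q := q) hm hper
  rw [← starSet_diff hm hq hr hper, ← hb]
  refine inside_eq_of_starConvex _ (isCompact_starSet hm hper) starConvex_starSet zero_mem_starSet
    ?_ ?_
  · rw [hb]
    rintro z ⟨j, a, b, ha, hb, h, rfl⟩
    exact ⟨j, a, b, ha, hb, h.le, rfl⟩
  · rw [hb, starSet_diff hm hq hr hper]
    exact (isClosed_starSet hm hq hr hper).isOpen_compl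

lemma region_starPolygon : region (starPolygon m q r) = starSet m q r (· ≤ 1) := by
  have hb := boundary_starPolygon (q := q) hm hper
  refine region_eq_of_starConvex _ (isCompact_starSet hm hper) starConvex_starSet zero_mem_starSet
    ?_ ?_
  · rw [hb]
    rintro z ⟨j, a, b, ha, hb, h, rfl⟩
    exact ⟨j, a, b, ha, hb, h.le, rfl⟩
  · rw [hb, starSet_diff hm hq hr hper]
    exact (isClosed_starSet hm hq hr hper).isOpen_compl

lemma isSimple_starPolygon : IsSimple (starPolygon m q r) := by
  rintro ⟨i, t⟩ hi ⟨j, s⟩ hj h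
  have ht : t ∈ Ico (0 : ℝ) 1 := hi.2
  have hs : s ∈ Ico (0 : ℝ) 1 := hj.2
  have key : ∀ (i : Fin m) (t : ℝ), (starPolygon m q r).edgePath ℝ i t =
      ((1 - t : ℝ) : ℂ) * starVertex m q r (i.val : ℤ) +
        (t : ℝ) * starVertex m q r ((i.val : ℤ) + 1) := by
    intro i t
    rw [Polygon.edgePath, AffineMap.lineMap_apply, starPolygon_finRotate hm hper]
    simp [starPolygon]; ring
  simp only [key] at h
  obtain ⟨⟨k, hk⟩, -, h2⟩ := star_unique hm hq hr hper (by linarith [ht.2]) ht.1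
    (by linarith [hs.2]) hs.1 h
  have hij : i = j := by
    have h1 : (i.val : ℤ) % m = (j.val : ℤ) % m := by rw [hk, Int.add_mul_emod_self_left]
    have h3 := i.isLt
    have h4 := j.isLt
    rw [Int.emod_eq_of_lt (by omega) (by omega), Int.emod_eq_of_lt (by omega) (by omega)] at h1
    exact Fin.ext (by omega)
  rw [hij, h2]

end

end

/-! ### Angles subtended by segments -/

/-- The signed angle in `(-π, π]` at which the segment from `a` to `b` is seen from `z`. -/
noncomputable def ang (z a b : ℂ) : ℝ := ((b - z) / (a - z)).arg

/-- The sum of the angles at which the three sides of a triangle are seen from `z`. -/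
noncomputable def angTri (z a b c : ℂ) : ℝ := ang z a b + ang z b c + ang z c a

lemma im_div_eq_cr (z a b : ℂ) : ((b - z) / (a - z)).im = cr a b z / normSq (a - z) := by
  simp [div_im, cr_def]; ring

lemma ne_of_cr_ne_zero {a b z : ℂ} (h : cr a b z ≠ 0) : a - z ≠ 0 := by
  intro h0; rw [sub_eq_zero] at h0; subst h0; exact h (cr_self_left _ _)

lemma ang_pos {a b z : ℂ} (h : 0 < cr a b z) : 0 < ang z a b ∧ ang z a b < Real.pi := by
  have h1 : 0 < ((b - z) / (a - z)).im := by
    rw [im_div_eq_cr]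
    exact div_pos h (normSq_pos.2 (ne_of_cr_ne_zero h.ne'))
  have h2 := Complex.arg_nonneg_iff.2 h1.le
  refine ⟨lt_of_le_of_ne h2 fun h0 => ?_, Complex.arg_lt_pi_iff.2 (Or.inr h1.ne')⟩
  have := Complex.arg_eq_zero_iff.1 h0.symm
  rw [this.2] at h1; exact lt_irrefl _ h1

lemma ang_swap {a b z : ℂ} (h : cr a b z ≠ 0) : ang z b a = -ang z a b := by
  have h1 : ((b - z) / (a - z)).im ≠ 0 := by
    rw [im_div_eq_cr]
    exact div_ne_zero h (normSq_pos.2 (ne_of_cr_ne_zero h)).ne'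
  rw [ang, ang, ← inv_div, Complex.arg_inv, if_neg]
  intro h2
  exact h1 (Complex.arg_eq_pi_iff.1 h2).2

lemma ang_neg {a b z : ℂ} (h : cr a b z < 0) : -Real.pi < ang z a b ∧ ang z a b < 0 := by
  have h1 : 0 < cr b a z := by rw [cr_swap]; linarith
  have h2 := ang_pos h1
  rw [ang_swap h.ne] at h2
  constructor <;> linarith

lemma exp_ang {a b z : ℂ} (ha : a - z ≠ 0) (hb : b - z ≠ 0) :
    exp (ang z a b * I) = ((b - z) / ‖b - z‖) / ((a - z) / ‖a - z‖) := by
  have h := Complex.norm_mul_exp_arg_mul_I ((b - z) / (a - z))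
  have h1 : (‖a - z‖ : ℂ) ≠ 0 := by exact_mod_cast norm_ne_zero_iff.2 ha
  have h2 : (‖b - z‖ : ℂ) ≠ 0 := by exact_mod_cast norm_ne_zero_iff.2 hb
  rw [ang]
  set w := exp (((b - z) / (a - z)).arg * I)
  rw [norm_div, ofReal_div, eq_div_iff ha] at h
  field_simp at h ⊢
  linear_combination h

lemma exp_sum_ang {z : ℂ} {y : ℕ → ℂ} (hy : ∀ k, y k - z ≠ 0) (N : ℕ) :
    exp ((∑ k ∈ Finset.range N, ang z (y k) (y (k + 1)) : ℝ) * I) =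
      ((y N - z) / ‖y N - z‖) / ((y 0 - z) / ‖y 0 - z‖) := by
  have h1 : ∀ k, (‖y k - z‖ : ℂ) ≠ 0 := fun k => by exact_mod_cast norm_ne_zero_iff.2 (hy k)
  induction N with
  | zero =>
    simp only [Finset.range_zero, Finset.sum_empty, ofReal_zero, zero_mul, Complex.exp_zero]
    rw [div_self (div_ne_zero (hy 0) (h1 0))]
  | succ N ih =>
    rw [Finset.sum_range_succ, ofReal_add, add_mul, Complex.exp_add, ih, exp_ang (hy _) (hy _)]
    have := h1 0
    have := h1 N
    have := h1 (N + 1)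
    have := hy N
    have := hy 0
    field_simp

lemma exists_int_of_exp_eq_one {x : ℝ} (h : exp (x * I) = 1) : ∃ m : ℤ, x = m * (2 * Real.pi) := by
  obtain ⟨m, hm⟩ := Complex.exp_eq_one_iff.1 h
  refine ⟨m, ?_⟩
  have : (x : ℂ) * I = ((m * (2 * Real.pi) : ℝ) : ℂ) * I := by rw [hm]; push_cast; ring
  exact_mod_cast mul_right_cancel₀ I_ne_zero this

lemma angTri_int {z a b c : ℂ} (ha : a - z ≠ 0) (hb : b - z ≠ 0) (hc : c - z ≠ 0) :
    ∃ m : ℤ, angTri z a b c = m * (2 * Real.pi) := by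
  apply exists_int_of_exp_eq_one
  rw [angTri, ofReal_add, ofReal_add, add_mul, add_mul, Complex.exp_add, Complex.exp_add,
    exp_ang ha hb, exp_ang hb hc, exp_ang hc ha]
  have h1 : (‖a - z‖ : ℂ) ≠ 0 := by exact_mod_cast norm_ne_zero_iff.2 ha
  have h2 : (‖b - z‖ : ℂ) ≠ 0 := by exact_mod_cast norm_ne_zero_iff.2 hb
  have h3 : (‖c - z‖ : ℂ) ≠ 0 := by exact_mod_cast norm_ne_zero_iff.2 hc
  field_simp

/-- The sides of a positively oriented triangle subtend the total angle `2π` at interior points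
and `0` at exterior points: the sum is a multiple of `2π`, and the signs of the three angles
leave only one choice. -/
lemma angTri_eq {z a b c : ℂ} (h : 0 < cr a b c) (h1 : cr a b z ≠ 0) (h2 : cr b c z ≠ 0)
    (h3 : cr c a z ≠ 0) : (z ∈ tri a b c → angTri z a b c = 2 * Real.pi) ∧
      (z ∉ tri a b c → angTri z a b c = 0) := by
  obtain ⟨m, hm⟩ := angTri_int (ne_of_cr_ne_zero h1) (ne_of_cr_ne_zero h2) (ne_of_cr_ne_zero h3)
  have hpi := Real.pi_pos
  have val : ∀ k : ℤ, ((k : ℝ) - 1) * (2 * Real.pi) < angTri z a b c →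
      angTri z a b c < (k + 1) * (2 * Real.pi) → angTri z a b c = k * (2 * Real.pi) := by
    intro k hk1 hk2
    rw [hm] at hk1 hk2 ⊢
    have e1 : ((k : ℝ) - 1) < m := lt_of_mul_lt_mul_right hk1 (by positivity)
    have e2 : (m : ℝ) < k + 1 := lt_of_mul_lt_mul_right hk2 (by positivity)
    have e3 : k - 1 < m := by exact_mod_cast e1
    have e4 : m < k + 1 := by exact_mod_cast e2
    have : m = k := by omega
    rw [this]
  rw [mem_tri_iff h]
  constructor
  · rintro ⟨k1, k2, k3⟩
    have a1 := ang_pos (lt_of_le_of_ne k1 h1.symm)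
    have a2 := ang_pos (lt_of_le_of_ne k2 h2.symm)
    have a3 := ang_pos (lt_of_le_of_ne k3 h3.symm)
    have := val 1 (by simp only [angTri, Int.cast_one]; linarith)
      (by simp only [angTri, Int.cast_one]; linarith)
    simpa using this
  · intro hn
    have hsum := cr_add a b c z
    have := val 0 ?_ ?_
    · simpa using this
    all_goals
      simp only [angTri, Int.cast_zero]
      rcases lt_or_gt_of_ne h1 with k1 | k1 <;> rcases lt_or_gt_of_ne h2 with k2 | k2 <;>
        rcases lt_or_gt_of_ne h3 with k3 | k3 <;>
        first
        | (exfalso; apply hn; refine ⟨?_, ?_, ?_⟩ <;> linarith)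
        | skip
      all_goals
        have a1 := by first | exact ang_pos k1 | exact ang_neg k1
        have a2 := by first | exact ang_pos k2 | exact ang_neg k2
        have a3 := by first | exact ang_pos k3 | exact ang_neg k3
        linarith

/-- Seen from outside a half-plane, the angles subtended by a path in this half-plane
telescope. -/
lemma ang_eq_sub {z a b d : ℂ} (ha : 0 < ((a - z) * conj d).re) (hb : 0 < ((b - z) * conj d).re) :
    ang z a b = ((b - z) * conj d).arg - ((a - z) * conj d).arg := by
  have ha0 : (a - z) * conj d ≠ 0 := by intro h; rw [h] at ha; simp at ha
  have hb0 : (b - z) * conj d ≠ 0 := by intro h; rw [h] at hb; simp at hb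
  have hd0 : conj d ≠ 0 := right_ne_zero_of_mul ha0
  have h1 := abs_lt.1 (Complex.abs_arg_lt_pi_div_two_iff.2 (Or.inl ha))
  have h2 := abs_lt.1 (Complex.abs_arg_lt_pi_div_two_iff.2 (Or.inl hb))
  have hpi := Real.pi_pos
  have h3 : (((a - z) * conj d)⁻¹).arg = -((a - z) * conj d).arg := by
    rw [Complex.arg_inv, if_neg (by linarith)]
  have h4 : (b - z) / (a - z) = ((b - z) * conj d) * ((a - z) * conj d)⁻¹ := by
    have := left_ne_zero_of_mul ha0
    field_simp
  rw [ang, h4, Complex.arg_mul hb0 (inv_ne_zero ha0), h3]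
  · ring
  · rw [h3]; constructor <;> linarith

lemma arg_unitDir_one {n : ℕ} (hn : 3 ≤ n) : (unitDir n 1).arg = 2 * Real.pi / n := by
  have hn' : (3 : ℝ) ≤ n := by exact_mod_cast hn
  have hpi := Real.pi_pos
  have : unitDir n 1 = exp ((2 * Real.pi / n : ℝ) * I) := by
    rw [unitDir]; congr 2; push_cast; ring
  rw [this, Complex.arg_exp_mul_I, toIocMod_eq_self]
  constructor
  · have : 0 < 2 * Real.pi / n := by positivity
    linarith
  · rw [div_le_iff₀ (by linarith)]; nlinarith

/-- The sides of a large regular polygon about `0` subtend the total angle `2π`. -/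
lemma exists_sum_ang_eq {n : ℕ} (hn : 3 ≤ n) (z : ℂ) : ∃ R : ℝ, ∀ Q : ℂ, R < ‖Q‖ →
    ∑ k ∈ Finset.range n, ang z (unitDir n k * Q) (unitDir n (k + 1) * Q) = 2 * Real.pi := by
  have hn' : (3 : ℝ) ≤ n := by exact_mod_cast hn
  have hpi := Real.pi_pos
  have hc : ContinuousAt (fun t : ℂ => ((unitDir n 1 - t) / (1 - t)).arg) 0 := by
    apply ContinuousAt.comp (g := Complex.arg)
    · apply Complex.continuousAt_arg
      simp only [sub_zero, div_one]
      exact Or.inr (unitDir_one_im_pos hn).ne'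
    · exact ContinuousAt.div (by fun_prop) (by fun_prop) (by simp)
  obtain ⟨δ, hδ, hlt⟩ := Metric.continuousAt_iff.1 hc (Real.pi / n) (by positivity)
  simp only [sub_zero, div_one, dist_zero_right, Real.dist_eq, arg_unitDir_one hn] at hlt
  refine ⟨max ‖z‖ (‖z‖ / δ), fun Q hQ => ?_⟩
  have hQ1 : ‖z‖ < ‖Q‖ := (le_max_left _ _).trans_lt hQ
  have hQ2 : ‖z‖ / δ < ‖Q‖ := (le_max_right _ _).trans_lt hQ
  have hQ0 : Q ≠ 0 := by
    rintro rfl; simp at hQ1; exact absurd hQ1 (not_lt.2 (norm_nonneg z))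
  have hne : ∀ k : ℤ, unitDir n k * Q - z ≠ 0 := by
    intro k h
    rw [sub_eq_zero] at h
    rw [← h, norm_mul, norm_unitDir, one_mul] at hQ1
    exact lt_irrefl _ hQ1
  have hterm : ∀ k : ℕ, |ang z (unitDir n k * Q) (unitDir n (k + 1) * Q) - 2 * Real.pi / n| <
      Real.pi / n := by
    intro k
    have hu := unitDir_ne_zero n k
    have h1 : ‖z / (unitDir n k * Q)‖ < δ := by
      rw [norm_div, norm_mul, norm_unitDir, one_mul, div_lt_iff₀ (norm_pos_iff.2 hQ0)]
      rwa [div_lt_iff₀ hδ, mul_comm] at hQ2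
    have h2 := hlt h1
    have h3 : (unitDir n (k + 1) * Q - z) / (unitDir n k * Q - z) =
        (unitDir n 1 - z / (unitDir n k * Q)) / (1 - z / (unitDir n k * Q)) := by
      rw [unitDir_add]
      have h4 := hne k
      have h5 : 1 - z / (unitDir n k * Q) = (unitDir n k * Q - z) / (unitDir n k * Q) := by
        field_simp
      have h6 : unitDir n 1 - z / (unitDir n k * Q) =
        (unitDir n k * unitDir n 1 * Q - z) / (unitDir n k * Q) := by field_simp
      rw [h5, h6]
      field_simp
    rw [ang, h3]
    exact h2
  have hint : ∃ m : ℤ, ∑ k ∈ Finset.range n, ang z (unitDir n k * Q) (unitDir n (k + 1) * Q) =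
      m * (2 * Real.pi) := by
    apply exists_int_of_exp_eq_one
    have := exp_sum_ang (z := z) (y := fun k => unitDir n k * Q) (fun k => hne k) n
    push_cast at this ⊢
    rw [this]
    have h0 : unitDir n (n : ℤ) = unitDir n 0 := by
      have := unitDir_mul_period (n := n) (by omega) 1
      rw [mul_one] at this; rw [this, unitDir_zero]
    rw [h0]
    have h1 := hne 0
    have h2 : (‖unitDir n 0 * Q - z‖ : ℂ) ≠ 0 := by exact_mod_cast norm_ne_zero_iff.2 h1
    exact div_self (div_ne_zero h1 h2)
  obtain ⟨m, hm⟩ := hint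
  have hb : |∑ k ∈ Finset.range n, ang z (unitDir n k * Q) (unitDir n (k + 1) * Q) -
      2 * Real.pi| ≤ Real.pi := by
    have h1 : ∑ k ∈ Finset.range n, ang z (unitDir n k * Q) (unitDir n (k + 1) * Q) -
        2 * Real.pi = ∑ k ∈ Finset.range n,
          (ang z (unitDir n k * Q) (unitDir n (k + 1) * Q) - 2 * Real.pi / n) := by
      rw [Finset.sum_sub_distrib]; simp; field_simp
    rw [h1]
    refine (Finset.abs_sum_le_sum_abs _ _).trans ?_
    refine (Finset.sum_le_sum fun k _ => (hterm k).le).trans ?_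
    simp; field_simp; rfl
  rw [hm] at hb ⊢
  have h1 := abs_le.1 hb
  have h2 : (m : ℝ) < 2 := by nlinarith
  have h3 : 0 < (m : ℝ) := by nlinarith
  have h4 : m < 2 := by exact_mod_cast h2
  have h5 : 0 < m := by exact_mod_cast h3
  have : m = 1 := by omega
  rw [this]; simp

/-! ### The bent rhombic pattern -/

/-- The first leg of a bent edge, relative to the direction of the edge: the bend is to the left
or to the right according to the Boolean (and to the sign of `τ.im`). -/
noncomputable def leg (τ : ℂ) : Bool → ℂ
  | true => τ
  | false => conj τ

/-- The chirality of the pentagonal pair at the rhombus `(k, i, j)`: a checkerboard pattern in each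
sector that also alternates from sector to sector; `e` selects one of the two choices. -/
def chir (e k : ℤ) (i j : ℕ) : Bool := decide (Even (e + k + i + j))

/-- The lattice point `(i, j)` of the sector `k` of the pattern with edge length `2 * τ.re`. -/
noncomputable def pt (n : ℕ) (τ : ℂ) (k : ℤ) (i j : ℕ) : ℂ := latticePoint n (2 * τ.re) k i j

/-- The apex that replaces the edge from `(i, j)` to `(i + 1, j)`. -/
noncomputable def apex₁ (n : ℕ) (τ : ℂ) (e k : ℤ) (i j : ℕ) : ℂ :=
  pt n τ k i j + unitDir n (k - 1) * leg τ (chir e k i j)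

/-- The apex that replaces the edge from `(i, j)` to `(i, j + 1)`. -/
noncomputable def apex₂ (n : ℕ) (τ : ℂ) (e k : ℤ) (i j : ℕ) : ℂ :=
  pt n τ k i j + unitDir n k * leg τ (chir e k i j)

/-- The isometry that places the pentagon in standard position at the rhombus of sector `k` with
base point `X`, in the given chirality. -/
noncomputable def place (n : ℕ) (τ : ℂ) (c : Bool) (k : ℤ) (X : ℂ) : ℂ ≃ᵢ ℂ :=
  match c with
  | true => directIso (unitDir n (k - 1)) (X + unitDir n (k - 1) * τ) (norm_unitDir _ _)
  | false => reverseIso (unitDir n k) (X + unitDir n k * conj τ) (norm_unitDir _ _)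

/-- The half-turn about the midpoint of the edge `DE` of the pentagon in standard position. -/
noncomputable def halfTurn (n : ℕ) (τ : ℂ) : ℂ ≃ᵢ ℂ :=
  directIso (-1) (stdPentagon n τ 3 + stdPentagon n τ 4) (by simp)

/-- The isometry that places one of the two pentagons of the pair at the rhombus `(k, i, j)`. -/
noncomputable def placed (n : ℕ) (τ : ℂ) (e k : ℤ) (i j : ℕ) : Bool → (ℂ ≃ᵢ ℂ)
  | true => place n τ (chir e k i j) k (pt n τ k i j)
  | false => (halfTurn n τ).trans (place n τ (chir e k i j) k (pt n τ k i j))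

/-- All points that matter for the pattern: the origin, lattice points and apices. -/
def patternPoints (n : ℕ) (τ : ℂ) (e : ℤ) : Set ℂ :=
  insert 0 (range (fun x : ℤ × ℕ × ℕ => pt n τ x.1 x.2.1 x.2.2) ∪
    (range (fun x : ℤ × ℕ × ℕ => apex₁ n τ e x.1 x.2.1 x.2.2) ∪
      range (fun x : ℤ × ℕ × ℕ => apex₂ n τ e x.1 x.2.1 x.2.2)))

/-- A point is generic with respect to `V` if it lies on no line through two points of `V`. -/
def IsGeneric (V : Set ℂ) (z : ℂ) : Prop := ∀ a ∈ V, ∀ b ∈ V, a ≠ b → cr a b z ≠ 0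

lemma dense_isGeneric {V : Set ℂ} (hV : V.Countable) : Dense {z | IsGeneric V z} := by
  have h1 : {z | IsGeneric V z} = ⋂ x ∈ {x : ℂ × ℂ | x ∈ V ×ˢ V ∧ x.1 ≠ x.2}, {z | cr x.1 x.2 z ≠ 0} := by
    ext z
    simp only [IsGeneric, mem_ofPred_eq, mem_iInter, mem_prod, Prod.forall]
    constructor
    · rintro h a b ⟨⟨ha, hb⟩, hab⟩; exact h a ha b hb hab
    · intro h a ha b hb hab; exact h a b ⟨⟨ha, hb⟩, hab⟩
  rw [h1]
  refine dense_biInter_of_isOpen ?_ ((hV.prod hV).mono fun x hx => hx.1) ?_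
  · exact fun x _ => isOpen_ne_fun (continuous_cr _ _) continuous_const
  · rintro ⟨a, b⟩ ⟨-, hab⟩ z
    rw [Metric.mem_closure_iff]
    intro ε hε
    by_cases hz : cr a b z = 0
    · have hn : 0 < ‖b - a‖ := norm_pos_iff.2 (sub_ne_zero.2 (Ne.symm hab))
      refine ⟨z + ((ε / 2 / ‖b - a‖ : ℝ) : ℂ) * (I * (b - a)), ?_, ?_⟩
      · have : cr a b (z + ((ε / 2 / ‖b - a‖ : ℝ) : ℂ) * (I * (b - a))) =
            cr a b z + ε / 2 / ‖b - a‖ * normSq (b - a) := by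
          simp only [cr_def, add_re, add_im, re_ofReal_mul, im_ofReal_mul, normSq_apply]
          simp; ring
        show cr a b _ ≠ 0
        rw [this, hz, normSq_eq_norm_sq]; positivity
      · rw [dist_eq_norm]
        have : z - (z + ((ε / 2 / ‖b - a‖ : ℝ) : ℂ) * (I * (b - a))) =
          -(((ε / 2 / ‖b - a‖ : ℝ) : ℂ) * (I * (b - a))) := by ring
        rw [this, norm_neg, norm_mul, norm_mul, norm_I, Complex.norm_of_nonneg (by positivity),
          one_mul, div_mul_cancel₀ _ hn.ne']
        linarith
    · exact ⟨z, hz, by simpa using hε⟩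

lemma countable_patternPoints (n : ℕ) (τ : ℂ) (e : ℤ) : (patternPoints n τ e).Countable :=
  ((countable_range _).union ((countable_range _).union (countable_range _))).insert _

section
variable {n : ℕ} {τ : ℂ} {e : ℤ}

lemma pt_mem (k : ℤ) (i j : ℕ) : pt n τ k i j ∈ patternPoints n τ e :=
  Or.inr (Or.inl ⟨(k, i, j), rfl⟩)

lemma apex₁_mem (k : ℤ) (i j : ℕ) : apex₁ n τ e k i j ∈ patternPoints n τ e :=
  Or.inr (Or.inr (Or.inl ⟨(k, i, j), rfl⟩))

lemma apex₂_mem (k : ℤ) (i j : ℕ) : apex₂ n τ e k i j ∈ patternPoints n τ e :=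
  Or.inr (Or.inr (Or.inr ⟨(k, i, j), rfl⟩))

lemma leg_add_leg (τ : ℂ) (c : Bool) : leg τ c + leg τ (!c) = ((2 * τ.re : ℝ) : ℂ) := by
  rw [← add_conj]; cases c <;> simp [leg, add_comm]

lemma chir_succ_left (e k : ℤ) (i j : ℕ) : chir e k (i + 1) j = !chir e k i j := by
  have : e + k + (i + 1 : ℕ) + j = e + k + i + j + 1 := by push_cast; ring
  simp only [chir, this, Int.even_add_one, decide_not]

lemma chir_succ_right (e k : ℤ) (i j : ℕ) : chir e k i (j + 1) = !chir e k i j := by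
  have : e + k + i + (j + 1 : ℕ) = e + k + i + j + 1 := by push_cast; ring
  simp only [chir, this, Int.even_add_one, decide_not]

lemma pt_succ_left (k : ℤ) (i j : ℕ) :
    pt n τ k (i + 1) j = pt n τ k i j + unitDir n (k - 1) * (2 * τ.re : ℝ) := by
  simp only [pt, latticePoint]; push_cast; ring

lemma pt_succ_right (k : ℤ) (i j : ℕ) :
    pt n τ k i (j + 1) = pt n τ k i j + unitDir n k * (2 * τ.re : ℝ) := by
  simp only [pt, latticePoint]; push_cast; ring

lemma pt_eq_mul (k : ℤ) (i j : ℕ) : pt n τ k i j = unitDir n k * pt n τ 0 i j := by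
  simp only [pt, latticePoint, ngonVertex]
  have h1 : unitDir n (k - 1) = unitDir n k * unitDir n (0 - 1) := by
    rw [← unitDir_add]; congr 1
  rw [h1, unitDir_zero]; ring

/-- The common boundary ray of two consecutive sectors. -/
lemma pt_zero_succ (hn : 3 ≤ n) (k : ℤ) (j : ℕ) : pt n τ k 0 (j + 1) = pt n τ (k + 1) j 0 := by
  have h1 : unitDir n 1 - 1 ≠ 0 := sub_ne_zero.2 (unitDir_one_ne_one hn)
  simp only [pt, latticePoint, ngonVertex, unitDir_add, add_sub_cancel_right]
  push_cast
  field_simp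
  ring

lemma apex₂_zero_succ (hn : 3 ≤ n) (k : ℤ) (j : ℕ) :
    apex₂ n τ e k 0 (j + 1) = apex₁ n τ e (k + 1) j 0 := by
  have : e + k + ((0 : ℕ) : ℤ) + (j + 1 : ℕ) = e + (k + 1) + j + (0 : ℕ) := by push_cast; ring
  rw [apex₂, apex₁, pt_zero_succ hn, add_sub_cancel_right, chir, chir, this]

lemma pt_period (hn : 3 ≤ n) (k m : ℤ) (i j : ℕ) : pt n τ (k + n * m) i j = pt n τ k i j := by
  rw [pt_eq_mul, pt_eq_mul k, unitDir_add, unitDir_mul_period (by omega), mul_one]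

lemma chir_period (hn : Even n) (k m : ℤ) (i j : ℕ) : chir e (k + n * m) i j = chir e k i j := by
  obtain ⟨l, rfl⟩ := hn
  simp [chir, Int.even_add]

lemma apex₁_period (hn : 3 ≤ n) (hev : Even n) (k m : ℤ) (i j : ℕ) :
    apex₁ n τ e (k + n * m) i j = apex₁ n τ e k i j := by
  rw [apex₁, apex₁, pt_period hn, chir_period hev, add_sub_right_comm, unitDir_add,
    unitDir_mul_period (by omega), mul_one]

section
variable (k : ℤ) (X : ℂ)

lemma place_true_apply (z : ℂ) :
    place n τ true k X z = unitDir n (k - 1) * z + (X + unitDir n (k - 1) * τ) := rfl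

lemma place_false_apply (z : ℂ) :
    place n τ false k X z = unitDir n k * conj z + (X + unitDir n k * conj τ) := rfl

lemma halfTurn_apply (z : ℂ) :
    halfTurn n τ z = stdPentagon n τ 3 + stdPentagon n τ 4 - z := by
  simp only [halfTurn, directIso_apply]; ring

end

lemma unitDir_sub_one_mul (n : ℕ) (k : ℤ) : unitDir n (k - 1) * unitDir n 1 = unitDir n k := by
  rw [← unitDir_add]; congr 1; ring

lemma unitDir_mul_conj_one (n : ℕ) (k : ℤ) :
    unitDir n k * conj (unitDir n 1) = unitDir n (k - 1) := by
  rw [conj_unitDir, ← unitDir_add]; rfl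

/-- The vertices of the first pentagon of the pair, in the order `A, B, C, D, E`. -/
lemma placed_true (e k : ℤ) (i j : ℕ) :
    (chir e k i j = true → (∀ x, placed n τ e k i j true (stdPentagon n τ x) =
      (![pt n τ k i j, apex₁ n τ e k i j, pt n τ k (i + 1) j, apex₂ n τ e k (i + 1) j,
        apex₂ n τ e k i j] : Fin 5 → ℂ) x)) ∧
    (chir e k i j = false → (∀ x, placed n τ e k i j true (stdPentagon n τ x) =
      (![pt n τ k i j, apex₂ n τ e k i j, pt n τ k i (j + 1), apex₁ n τ e k i (j + 1),
        apex₁ n τ e k i j] : Fin 5 → ℂ) x)) := by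
  have hL := add_conj τ
  have h1 := unitDir_sub_one_mul n k
  have h2 := unitDir_mul_conj_one n k
  push_cast at hL
  constructor <;> intro hc x
  · simp only [placed, hc, place_true_apply, apex₁, apex₂, chir_succ_left, pt_succ_left, leg,
      Bool.not_true]
    fin_cases x <;> simp
    · linear_combination unitDir n (k - 1) * hL
    · linear_combination unitDir n (k - 1) * hL + conj τ * h1
    · linear_combination τ * h1
  · simp only [placed, hc, place_false_apply, apex₁, apex₂, chir_succ_right, pt_succ_right, leg,
      Bool.not_false]
    fin_cases x <;> simp
    · linear_combination unitDir n k * hL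
    · linear_combination unitDir n k * hL + τ * h2
    · linear_combination conj τ * h2

/-- The vertices of the second pentagon of the pair, in the order `A, B, C, D, E`. -/
lemma placed_false (e k : ℤ) (i j : ℕ) :
    (chir e k i j = true → (∀ x, placed n τ e k i j false (stdPentagon n τ x) =
      (![pt n τ k (i + 1) (j + 1), apex₁ n τ e k i (j + 1), pt n τ k i (j + 1), apex₂ n τ e k i j,
        apex₂ n τ e k (i + 1) j] : Fin 5 → ℂ) x)) ∧
    (chir e k i j = false → (∀ x, placed n τ e k i j false (stdPentagon n τ x) =
      (![pt n τ k (i + 1) (j + 1), apex₂ n τ e k (i + 1) j, pt n τ k (i + 1) j, apex₁ n τ e k i j,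
        apex₁ n τ e k i (j + 1)] : Fin 5 → ℂ) x)) := by
  have hL := add_conj τ
  have h1 := unitDir_sub_one_mul n k
  have h2 := unitDir_mul_conj_one n k
  constructor <;> intro hc x
  · simp only [placed, hc, IsometryEquiv.trans_apply, halfTurn_apply, place_true_apply, apex₁, apex₂,
      chir_succ_left, chir_succ_right, pt_succ_left, pt_succ_right, leg, Bool.not_true]
    push_cast at hL ⊢
    fin_cases x <;> simp
    · linear_combination (unitDir n (k - 1) + unitDir n k) * hL + (τ + conj τ) * h1
    · linear_combination unitDir n k * hL + (τ + conj τ) * h1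
    · linear_combination unitDir n k * hL + (τ + conj τ) * h1
    · linear_combination τ * h1
    · linear_combination unitDir n (k - 1) * hL + conj τ * h1
  · simp only [placed, hc, IsometryEquiv.trans_apply, halfTurn_apply, place_false_apply, apex₁, apex₂,
      chir_succ_left, chir_succ_right, pt_succ_left, pt_succ_right, leg, Bool.not_false]
    push_cast at hL ⊢
    fin_cases x <;> simp
    · linear_combination (unitDir n (k - 1) + unitDir n k) * hL + (τ + conj τ) * h2
    · linear_combination unitDir n (k - 1) * hL + (τ + conj τ) * h2
    · linear_combination unitDir n (k - 1) * hL + (τ + conj τ) * h2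
    · linear_combination conj τ * h2
    · linear_combination unitDir n k * hL + τ * h2

end

/-! ### Counting the tiles that contain a generic point -/

/-- The angles subtended by the three triangles of the fan of a pentagon; `c` is the orientation of
the pentagon. -/
noncomputable def angFan (z : ℂ) (c : Bool) (q : Fin 5 → ℂ) : ℝ :=
  match c with
  | true => angTri z (q 1) (q 2) (q 3) + angTri z (q 1) (q 3) (q 4) + angTri z (q 1) (q 4) (q 0)
  | false => angTri z (q 1) (q 3) (q 2) + angTri z (q 1) (q 4) (q 3) + angTri z (q 1) (q 0) (q 4)

/-- The angle subtended by the bent edge from `(i, j)` to `(i + 1, j)`. -/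
noncomputable def bent₁ (n : ℕ) (τ : ℂ) (e : ℤ) (z : ℂ) (k : ℤ) (i j : ℕ) : ℝ :=
  ang z (pt n τ k i j) (apex₁ n τ e k i j) + ang z (apex₁ n τ e k i j) (pt n τ k (i + 1) j)

/-- The angle subtended by the bent edge from `(i, j)` to `(i, j + 1)`. -/
noncomputable def bent₂ (n : ℕ) (τ : ℂ) (e : ℤ) (z : ℂ) (k : ℤ) (i j : ℕ) : ℝ :=
  ang z (pt n τ k i j) (apex₂ n τ e k i j) + ang z (apex₂ n τ e k i j) (pt n τ k i (j + 1))

/-- The angle subtended by all triangles of the two pentagons at the rhombus `(k, i, j)`. -/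
noncomputable def pairAngle (n : ℕ) (τ : ℂ) (e : ℤ) (z : ℂ) (k : ℤ) (i j : ℕ) : ℝ :=
  angFan z (chir e k i j) (fun x => placed n τ e k i j true (stdPentagon n τ x)) +
    angFan z (chir e k i j) (fun x => placed n τ e k i j false (stdPentagon n τ x))

lemma IsGeneric.ang_swap {V : Set ℂ} {z : ℂ} (hz : IsGeneric V z) {a b : ℂ} (ha : a ∈ V)
    (hb : b ∈ V) : ang z b a = -ang z a b := by
  by_cases h : a = b
  · subst h
    have : ang z a a = 0 := by
      unfold ang
      by_cases h0 : a - z = 0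
      · simp [h0]
      · rw [div_self h0, Complex.arg_one]
    rw [this, neg_zero]
  · exact PentagonTiling.ang_swap (hz a ha b hb h)

section
variable {n : ℕ} {τ : ℂ} {e : ℤ}

lemma angFan_eq {V : Set ℂ} {z : ℂ} (hz : IsGeneric V z) {q : Fin 5 → ℂ} (hq : ∀ x, q x ∈ V)
    (c : Bool) : angFan z c q = (if c then 1 else -1) *
      (ang z (q 0) (q 1) + ang z (q 1) (q 2) + ang z (q 2) (q 3) + ang z (q 3) (q 4) +
        ang z (q 4) (q 0)) := by
  have s := fun x y => hz.ang_swap (hq x) (hq y)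
  cases c
  · simp only [angFan, angTri, s 0 1, s 1 2, s 2 3, s 3 4, s 1 3, s 1 4, s 0 4]
    simp; ring
  · simp only [angFan, angTri, s 1 3, s 1 4]
    simp; ring

/-- The angle subtended by a pair is that of its octagonal boundary. -/
lemma pairAngle_eq {z : ℂ} (hz : IsGeneric (patternPoints n τ e) z) (k : ℤ) (i j : ℕ) :
    pairAngle n τ e z k i j = bent₁ n τ e z k i j + bent₂ n τ e z k (i + 1) j -
      bent₁ n τ e z k i (j + 1) - bent₂ n τ e z k i j := by
  have s : ∀ {a b : ℂ}, a ∈ patternPoints n τ e → b ∈ patternPoints n τ e →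
    ang z b a = -ang z a b := fun ha hb => hz.ang_swap ha hb
  have m0 := fun i j => pt_mem (n := n) (τ := τ) (e := e) k i j
  have m1 := fun i j => apex₁_mem (n := n) (τ := τ) (e := e) k i j
  have m2 := fun i j => apex₂_mem (n := n) (τ := τ) (e := e) k i j
  have hF : ∀ (F : Fin 5 → ℂ) (v0 v1 v2 v3 v4 : ℂ), (∀ x, F x = (![v0, v1, v2, v3, v4] : Fin 5 → ℂ) x) →
      F = ![v0, v1, v2, v3, v4] := fun F v0 v1 v2 v3 v4 h => funext h
  have hV : ∀ v0 v1 v2 v3 v4 : ℂ, v0 ∈ patternPoints n τ e → v1 ∈ patternPoints n τ e →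
      v2 ∈ patternPoints n τ e → v3 ∈ patternPoints n τ e → v4 ∈ patternPoints n τ e →
      ∀ x, (![v0, v1, v2, v3, v4] : Fin 5 → ℂ) x ∈ patternPoints n τ e := by
    intro v0 v1 v2 v3 v4 h0 h1 h2 h3 h4 x
    fin_cases x <;> assumption
  rw [pairAngle]
  cases hc : chir e k i j
  · rw [hF _ _ _ _ _ _ ((placed_true e k i j).2 hc), hF _ _ _ _ _ _ ((placed_false e k i j).2 hc),
      angFan_eq hz (hV _ _ _ _ _ (m0 _ _) (m2 _ _) (m0 _ _) (m1 _ _) (m1 _ _)),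
      angFan_eq hz (hV _ _ _ _ _ (m0 _ _) (m2 _ _) (m0 _ _) (m1 _ _) (m1 _ _))]
    simp [bent₁, bent₂]
    rw [s (m1 i j) (m0 i j), s (m2 (i + 1) j) (m0 (i + 1) (j + 1)), s (m0 (i + 1) j) (m2 (i + 1) j),
      s (m1 i j) (m0 (i + 1) j), s (m1 i (j + 1)) (m1 i j)]
    ring
  · rw [hF _ _ _ _ _ _ ((placed_true e k i j).1 hc), hF _ _ _ _ _ _ ((placed_false e k i j).1 hc),
      angFan_eq hz (hV _ _ _ _ _ (m0 _ _) (m1 _ _) (m0 _ _) (m2 _ _) (m2 _ _)),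
      angFan_eq hz (hV _ _ _ _ _ (m0 _ _) (m1 _ _) (m0 _ _) (m2 _ _) (m2 _ _))]
    simp [bent₁, bent₂]
    rw [s (m0 i j) (m2 i j), s (m1 i (j + 1)) (m0 (i + 1) (j + 1)), s (m0 i (j + 1)) (m1 i (j + 1)),
      s (m2 i j) (m0 i (j + 1)), s (m2 (i + 1) j) (m2 i j)]
    ring

/-- Telescoping over a finite part of a sector leaves the boundary of this part. -/
lemma sum_pairAngle_sector {z : ℂ} (hz : IsGeneric (patternPoints n τ e) z) (k : ℤ) (N : ℕ) :
    ∑ i ∈ Finset.range N, ∑ j ∈ Finset.range N, pairAngle n τ e z k i j =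
      ∑ i ∈ Finset.range N, bent₁ n τ e z k i 0 - ∑ i ∈ Finset.range N, bent₁ n τ e z k i N +
      ∑ j ∈ Finset.range N, bent₂ n τ e z k N j - ∑ j ∈ Finset.range N, bent₂ n τ e z k 0 j := by
  have h1 : ∀ i, ∑ j ∈ Finset.range N, (bent₁ n τ e z k i j - bent₁ n τ e z k i (j + 1)) =
      bent₁ n τ e z k i 0 - bent₁ n τ e z k i N := fun i => Finset.sum_range_sub' _ _
  have h2 : ∀ j, ∑ i ∈ Finset.range N, (bent₂ n τ e z k (i + 1) j - bent₂ n τ e z k i j) =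
      bent₂ n τ e z k N j - bent₂ n τ e z k 0 j := fun j =>
    Finset.sum_range_sub (fun i => bent₂ n τ e z k i j) _
  have h3 : ∀ i j, pairAngle n τ e z k i j =
      (bent₁ n τ e z k i j - bent₁ n τ e z k i (j + 1)) +
        (bent₂ n τ e z k (i + 1) j - bent₂ n τ e z k i j) := by
    intro i j; rw [pairAngle_eq hz]; ring
  simp only [h3, Finset.sum_add_distrib, h1]
  rw [Finset.sum_comm (f := fun i j => bent₂ n τ e z k (i + 1) j - bent₂ n τ e z k i j)]
  simp only [h2, Finset.sum_sub_distrib]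
  ring

/-- The bisector of the directions of the sector `k`. -/
lemma re_mul_bisector (hn : 3 ≤ n) (k : ℤ) :
    (unitDir n (k - 1) * conj (unitDir (2 * n) (2 * k - 1))).re = Real.cos (Real.pi / n) ∧
      (unitDir n k * conj (unitDir (2 * n) (2 * k - 1))).re = Real.cos (Real.pi / n) := by
  have hn0 : (n : ℝ) ≠ 0 := by positivity
  have h2 : ∀ l : ℤ, unitDir n l = unitDir (2 * n) (2 * l) := by
    intro l; rw [unitDir, unitDir]; congr 2; push_cast; field_simp
  rw [h2, h2, conj_unitDir, ← unitDir_add, ← unitDir_add, unitDir_re, unitDir_re]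
  constructor
  · rw [show 2 * (k - 1) + -(2 * k - 1) = -1 by ring, ← Real.cos_neg]
    congr 1; push_cast; field_simp
  · rw [show 2 * k + -(2 * k - 1) = 1 by ring]
    congr 1; push_cast; field_simp

lemma cos_pi_div_pos (hn : 3 ≤ n) : 0 < Real.cos (Real.pi / n) := by
  have hn' : (3 : ℝ) ≤ n := by exact_mod_cast hn
  apply Real.cos_pos_of_mem_Ioo
  constructor
  · have : 0 < Real.pi / n := by have := Real.pi_pos; positivity
    linarith [Real.pi_pos]
  · rw [div_lt_div_iff_of_pos_left Real.pi_pos (by linarith) (by norm_num)]; linarith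

lemma norm_leg (τ : ℂ) (c : Bool) : ‖leg τ c‖ = ‖τ‖ := by cases c <;> simp [leg]

lemma re_pt_bisector (hn : 3 ≤ n) (k : ℤ) (i j : ℕ) :
    (pt n τ k i j * conj (unitDir (2 * n) (2 * k - 1))).re =
      (pt n τ k 0 0 * conj (unitDir (2 * n) (2 * k - 1))).re +
        2 * τ.re * (i + j) * Real.cos (Real.pi / n) := by
  obtain ⟨h1, h2⟩ := re_mul_bisector hn k
  have : pt n τ k i j * conj (unitDir (2 * n) (2 * k - 1)) =
      pt n τ k 0 0 * conj (unitDir (2 * n) (2 * k - 1)) +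
        (((2 * τ.re * i : ℝ) : ℂ) * (unitDir n (k - 1) * conj (unitDir (2 * n) (2 * k - 1))) +
          ((2 * τ.re * j : ℝ) : ℂ) * (unitDir n k * conj (unitDir (2 * n) (2 * k - 1)))) := by
    simp only [pt, latticePoint]; push_cast; ring
  rw [this, add_re, add_re, re_ofReal_mul, re_ofReal_mul, h1, h2]; ring

/-- Points that are close to far lattice points of a sector are far away in the direction of the
bisector of this sector. -/
lemma re_far (hn : 3 ≤ n) (hτ : 0 < τ.re) {z w : ℂ} {k : ℤ} {i j : ℕ} {N : ℕ}
    (hN : ‖pt n τ 0 0 0‖ + ‖τ‖ + ‖z‖ < 2 * τ.re * N * Real.cos (Real.pi / n)) (hij : N ≤ i + j)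
    (hw : ‖w‖ ≤ ‖τ‖) :
    0 < ((pt n τ k i j + w - z) * conj (unitDir (2 * n) (2 * k - 1))).re := by
  set d := conj (unitDir (2 * n) (2 * k - 1)) with hd
  have hd1 : ‖d‖ = 1 := by rw [hd, RCLike.norm_conj, norm_unitDir]
  have hb : ∀ y : ℂ, -‖y‖ ≤ (y * d).re := by
    intro y
    have := (abs_le.1 (Complex.abs_re_le_norm (y * d))).1
    rwa [norm_mul, hd1, mul_one] at this
  have e1 : (pt n τ k i j + w - z) * d = pt n τ k i j * d + w * d + (-z) * d := by ring
  rw [e1, add_re, add_re, hd, re_pt_bisector hn, ← hd]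
  have h1 := hb (pt n τ k 0 0)
  rw [pt_eq_mul, norm_mul, norm_unitDir, one_mul, ← pt_eq_mul] at h1
  have h2 := hb w
  have h3 := hb (-z)
  rw [norm_neg] at h3
  have hc := cos_pi_div_pos hn
  have h4 : (N : ℝ) ≤ i + j := by exact_mod_cast hij
  have h5 : 2 * τ.re * N * Real.cos (Real.pi / n) ≤ 2 * τ.re * (i + j) * Real.cos (Real.pi / n) := by
    gcongr
  linarith

/-- The far part of the boundary of a truncated sector subtends the same angle as the segment
between its ends. -/
lemma far_chain (hn : 3 ≤ n) (hτ : 0 < τ.re) {z : ℂ} (k : ℤ) {N : ℕ}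
    (hN : ‖pt n τ 0 0 0‖ + ‖τ‖ + ‖z‖ < 2 * τ.re * N * Real.cos (Real.pi / n)) :
    ∑ j ∈ Finset.range N, bent₂ n τ e z k N j - ∑ i ∈ Finset.range N, bent₁ n τ e z k i N +
      bent₂ n τ e z k 0 N = ang z (pt n τ k N 0) (pt n τ (k + 1) N 0) := by
  set d := unitDir (2 * n) (2 * k - 1) with hd
  set f : ℂ → ℝ := fun y => ((y - z) * conj d).arg with hf
  have hpt : ∀ i j : ℕ, N ≤ i + j → 0 < ((pt n τ k i j - z) * conj d).re := by
    intro i j hij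
    simpa using re_far (w := 0) (k := k) hn hτ hN hij (by simp)
  have ha1 : ∀ i j : ℕ, N ≤ i + j → 0 < ((apex₁ n τ e k i j - z) * conj d).re := fun i j hij =>
    re_far hn hτ hN hij (by rw [norm_mul, norm_unitDir, norm_leg, one_mul])
  have ha2 : ∀ i j : ℕ, N ≤ i + j → 0 < ((apex₂ n τ e k i j - z) * conj d).re := fun i j hij =>
    re_far hn hτ hN hij (by rw [norm_mul, norm_unitDir, norm_leg, one_mul])
  have hb1 : ∀ i j : ℕ, N ≤ i + j →
      bent₁ n τ e z k i j = f (pt n τ k (i + 1) j) - f (pt n τ k i j) := by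
    intro i j hij
    rw [bent₁, ang_eq_sub (hpt i j hij) (ha1 i j hij),
      ang_eq_sub (ha1 i j hij) (hpt (i + 1) j (by omega))]
    ring
  have hb2 : ∀ i j : ℕ, N ≤ i + j →
      bent₂ n τ e z k i j = f (pt n τ k i (j + 1)) - f (pt n τ k i j) := by
    intro i j hij
    rw [bent₂, ang_eq_sub (hpt i j hij) (ha2 i j hij),
      ang_eq_sub (ha2 i j hij) (hpt i (j + 1) (by omega))]
    ring
  have h1 : ∑ j ∈ Finset.range N, bent₂ n τ e z k N j = f (pt n τ k N N) - f (pt n τ k N 0) := by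
    rw [Finset.sum_congr rfl fun j _ => hb2 N j (by omega)]
    exact Finset.sum_range_sub (fun j => f (pt n τ k N j)) N
  have h2 : ∑ i ∈ Finset.range N, bent₁ n τ e z k i N = f (pt n τ k N N) - f (pt n τ k 0 N) := by
    rw [Finset.sum_congr rfl fun i _ => hb1 i N (by omega)]
    exact Finset.sum_range_sub (fun i => f (pt n τ k i N)) N
  rw [h1, h2, hb2 0 N (by omega), ← pt_zero_succ hn,
    ang_eq_sub (hpt N 0 (by omega)) (hpt 0 (N + 1) (by omega))]
  ring

/-- Seen from a generic point, all triangles of a large part of the pattern subtend, together with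
the hole, the total angle `2π`. -/
lemma exists_total_angle (hn : 3 ≤ n) (hev : Even n) (hτ : 0 < τ.re) {z : ℂ}
    (hz : IsGeneric (patternPoints n τ e) z) : ∃ N₀ : ℕ, ∀ N ≥ N₀,
      ∑ k ∈ Finset.range n, ∑ i ∈ Finset.range N, ∑ j ∈ Finset.range N,
        pairAngle n τ e z k i j + ∑ k ∈ Finset.range n, bent₂ n τ e z k 0 0 = 2 * Real.pi := by
  obtain ⟨R, hR⟩ := exists_sum_ang_eq hn z
  have hc := cos_pi_div_pos hn
  obtain ⟨N₀, hN₀⟩ := exists_nat_gt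
    ((‖pt n τ 0 0 0‖ + ‖τ‖ + ‖z‖ + |R|) / (2 * τ.re * Real.cos (Real.pi / n)))
  rw [div_lt_iff₀ (by positivity)] at hN₀
  refine ⟨N₀, fun N hN => ?_⟩
  have hNN : ‖pt n τ 0 0 0‖ + ‖τ‖ + ‖z‖ + |R| < 2 * τ.re * N * Real.cos (Real.pi / n) := by
    have h1 : (N₀ : ℝ) ≤ N := by exact_mod_cast hN
    have h2 : (N₀ : ℝ) * (2 * τ.re * Real.cos (Real.pi / n)) ≤
        N * (2 * τ.re * Real.cos (Real.pi / n)) := by gcongr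
    linarith
  have hN1 : ‖pt n τ 0 0 0‖ + ‖τ‖ + ‖z‖ < 2 * τ.re * N * Real.cos (Real.pi / n) := by
    linarith [abs_nonneg R]
  have hfar := fun k : ℤ => far_chain (e := e) (z := z) hn hτ k hN1
  -- the outer polygon is a large regular polygon
  have hQ : R < ‖pt n τ 0 N 0‖ := by
    have h1 := re_pt_bisector (τ := τ) hn 0 N 0
    have h2 := (abs_le.1 (Complex.abs_re_le_norm
      (pt n τ 0 N 0 * conj (unitDir (2 * n) (2 * 0 - 1))))).2
    have h3 := (abs_le.1 (Complex.abs_re_le_norm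
      (pt n τ 0 0 0 * conj (unitDir (2 * n) (2 * 0 - 1))))).1
    rw [norm_mul, RCLike.norm_conj, norm_unitDir, mul_one] at h2 h3
    simp only [Nat.cast_zero, add_zero] at h1
    generalize conj (unitDir (2 * n) (2 * 0 - 1)) = d at h1 h2 h3
    have := le_abs_self R
    have := norm_nonneg τ
    have := norm_nonneg z
    linarith
  have hsum := hR _ hQ
  have hcyc : ∑ k ∈ Finset.range n, ∑ i ∈ Finset.range N, bent₁ n τ e z (k : ℤ) i 0 =
      ∑ k ∈ Finset.range n, ∑ i ∈ Finset.range N, bent₂ n τ e z (k : ℤ) 0 (i + 1) := by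
    have h1 : ∀ (k : ℤ) (i : ℕ), bent₂ n τ e z k 0 (i + 1) = bent₁ n τ e z (k + 1) i 0 := by
      intro k i
      rw [bent₁, bent₂, apex₂_zero_succ hn, pt_zero_succ hn, pt_zero_succ hn]
    simp only [h1]
    have h2 := Finset.sum_range_succ' (fun k : ℕ => ∑ i ∈ Finset.range N, bent₁ n τ e z (k : ℤ) i 0) n
    have h3 := Finset.sum_range_succ (fun k : ℕ => ∑ i ∈ Finset.range N, bent₁ n τ e z (k : ℤ) i 0) n
    have h4 : ∑ i ∈ Finset.range N, bent₁ n τ e z (n : ℤ) i 0 =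
        ∑ i ∈ Finset.range N, bent₁ n τ e z ((0 : ℕ) : ℤ) i 0 := by
      refine Finset.sum_congr rfl fun i _ => ?_
      have a1 := fun i j => pt_period (τ := τ) hn 0 1 i j
      have a2 := apex₁_period (τ := τ) (e := e) hn hev 0 1 i 0
      simp only [zero_add, mul_one] at a1 a2
      simp only [bent₁, a1, a2, Nat.cast_zero]
    rw [h3, h4] at h2
    push_cast at h2 ⊢
    linarith
  have hstep : ∀ k : ℕ, ∑ i ∈ Finset.range N, ∑ j ∈ Finset.range N, pairAngle n τ e z k i j =
      ang z (unitDir n k * pt n τ 0 N 0) (unitDir n (k + 1) * pt n τ 0 N 0) +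
      ∑ i ∈ Finset.range N, bent₁ n τ e z k i 0 -
      ∑ i ∈ Finset.range N, bent₂ n τ e z (k : ℤ) 0 (i + 1) - bent₂ n τ e z k 0 0 := by
    intro k
    have h1 := hfar k
    have h2 := Finset.sum_range_succ' (fun j => bent₂ n τ e z k 0 j) N
    have h3 := Finset.sum_range_succ (fun j => bent₂ n τ e z k 0 j) N
    rw [sum_pairAngle_sector hz, ← pt_eq_mul, ← pt_eq_mul]
    linarith
  simp only [hstep, Finset.sum_sub_distrib, Finset.sum_add_distrib, hsum]
  linarith

end

/-! ### The hole -/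

/-- The distances of the vertices of the hole from the origin: corners of the regular `n`-gon at
even positions, apices of its bent edges at odd positions. -/
noncomputable def holeRadius (n : ℕ) (τ : ℂ) (e j : ℤ) : ℝ :=
  if Even j then τ.re / Real.sin (Real.pi / n)
  else τ.re * Real.cos (Real.pi / n) / Real.sin (Real.pi / n) -
    (if chir e (j / 2) 0 0 then τ.im else -τ.im)

/-- The direction of the vertex number `0` of the hole. -/
noncomputable def holeDir (n : ℕ) : ℂ := -I * unitDir (2 * n) (-1)

/-- The vertex number `j` of the hole. -/
noncomputable def holeVertex (n : ℕ) (τ : ℂ) (e : ℤ) : ℤ → ℂ :=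
  starVertex (2 * n) (holeDir n) (holeRadius n τ e)

section
variable {n : ℕ} {τ : ℂ} {e : ℤ}

lemma holeDir_ne_zero : holeDir n ≠ 0 :=
  mul_ne_zero (neg_ne_zero.2 I_ne_zero) (unitDir_ne_zero _ _)

lemma unitDir_two_mul (hn : 3 ≤ n) (l : ℤ) : unitDir (2 * n) (2 * l) = unitDir n l := by
  have hn0 : (n : ℝ) ≠ 0 := by positivity
  rw [unitDir, unitDir]; congr 2; push_cast; field_simp

lemma sin_pi_div_pos (hn : 3 ≤ n) : 0 < Real.sin (Real.pi / n) := by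
  have hn' : (3 : ℝ) ≤ n := by exact_mod_cast hn
  have hpi := Real.pi_pos
  apply Real.sin_pos_of_pos_of_lt_pi
  · positivity
  · rw [div_lt_iff₀ (by linarith)]; nlinarith

lemma unitDir_two_neg_one (hn : 3 ≤ n) :
    unitDir (2 * n) (-1) = Real.cos (Real.pi / n) - Real.sin (Real.pi / n) * I := by
  have hn0 : (n : ℝ) ≠ 0 := by positivity
  have : (2 * Real.pi * ((-1 : ℤ) : ℝ) / ((2 * n : ℕ) : ℝ)) = -(Real.pi / n) := by
    push_cast; field_simp
  apply Complex.ext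
  · rw [unitDir_re, this, Real.cos_neg]
    simp [-ofReal_cos, -ofReal_sin]
  · rw [unitDir_im, this, Real.sin_neg]
    simp [-ofReal_cos, -ofReal_sin]

/-- The vertices of the hole with even index are the vertices of the regular `n`-gon. -/
lemma holeVertex_even (hn : 3 ≤ n) (k : ℤ) : holeVertex n τ e (2 * k) = pt n τ k 0 0 := by
  have hs := sin_pi_div_pos hn
  have hω := sub_ne_zero.2 (unitDir_one_ne_one hn)
  have hs' : ((Real.sin (Real.pi / n) : ℝ) : ℂ) ≠ 0 := by exact_mod_cast hs.ne'
  have h1 : unitDir n 1 - 1 = 2 * I * Real.sin (Real.pi / n) * unitDir (2 * n) 1 := by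
    have h2 := unitDir_two_neg_one hn
    have h3 : unitDir (2 * n) 1 = Real.cos (Real.pi / n) + Real.sin (Real.pi / n) * I := by
      have := congrArg conj h2
      rw [conj_unitDir] at this
      simpa [-ofReal_cos, -ofReal_sin] using this
    have h4 : unitDir (2 * n) 1 * unitDir (2 * n) (-1) = 1 := by
      rw [← unitDir_add]; simp [unitDir_zero]
    have h5 : unitDir n 1 = unitDir (2 * n) 1 * unitDir (2 * n) 1 := by
      rw [← unitDir_two_mul hn, ← unitDir_add]; rfl
    rw [h5]
    linear_combination h4 + unitDir (2 * n) 1 * h3 - unitDir (2 * n) 1 * h2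
  have h4 : unitDir (2 * n) (-1) * unitDir (2 * n) 1 = 1 := by
    rw [← unitDir_add]; simp [unitDir_zero]
  have hu := unitDir_ne_zero (2 * n) 1
  have e1 : pt n τ k 0 0 = ((2 * τ.re : ℝ) : ℂ) * unitDir n k / (unitDir n 1 - 1) := by
    simp [pt, latticePoint, ngonVertex]
  have e2 : holeRadius n τ e (2 * k) = τ.re / Real.sin (Real.pi / n) := by simp [holeRadius]
  rw [e1, holeVertex, starVertex, unitDir_two_mul hn, e2, holeDir, eq_div_iff hω, h1]
  push_cast [-ofReal_cos, -ofReal_sin]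
  field_simp
  linear_combination (-τ.re * I ^ 2 * unitDir n k) * h4 - (τ.re * unitDir n k) * I_sq

/-- The vertices of the hole with odd index are the apices of the bent edges of the `n`-gon. -/
lemma holeVertex_odd (hn : 3 ≤ n) (k : ℤ) : holeVertex n τ e (2 * k + 1) = apex₂ n τ e k 0 0 := by
  have hs := sin_pi_div_pos hn
  have hs' : ((Real.sin (Real.pi / n) : ℝ) : ℂ) ≠ 0 := by exact_mod_cast hs.ne'
  have h0 : unitDir (2 * n) (2 * k + 1) * unitDir (2 * n) (-1) = unitDir n k := by
    rw [← unitDir_add, ← unitDir_two_mul hn]; congr 1; ring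
  have hdiv : (2 * k + 1) / 2 = k := by omega
  have e1 : holeRadius n τ e (2 * k + 1) = τ.re * Real.cos (Real.pi / n) / Real.sin (Real.pi / n) -
      (if chir e k 0 0 then τ.im else -τ.im) := by
    rw [holeRadius, if_neg (by simp), hdiv]
  have e2 : leg τ (chir e k 0 0) = τ.re + (if chir e k 0 0 then τ.im else -τ.im : ℝ) * I := by
    cases chir e k 0 0
    · simp [leg]; apply Complex.ext <;> simp
    · simp [leg]
  rw [apex₂, ← holeVertex_even (e := e) hn, holeVertex, starVertex, starVertex, e1, e2, holeDir]
  have e3 : holeRadius n τ e (2 * k) = τ.re / Real.sin (Real.pi / n) := by simp [holeRadius]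
  rw [e3, unitDir_two_mul hn]
  have h2 := unitDir_two_neg_one hn
  set s := (if chir e k 0 0 then τ.im else -τ.im : ℝ)
  rw [show -I * unitDir (2 * n) (-1) * (((τ.re * Real.cos (Real.pi / n) / Real.sin (Real.pi / n) - s
    : ℝ) : ℂ) * unitDir (2 * n) (2 * k + 1)) =
    -I * ((τ.re * Real.cos (Real.pi / n) / Real.sin (Real.pi / n) - s : ℝ) : ℂ) *
      (unitDir (2 * n) (2 * k + 1) * unitDir (2 * n) (-1)) by ring, h0, h2]
  rw [ofReal_sub, ofReal_div, ofReal_div, ofReal_mul]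
  field_simp
  linear_combination (-(Real.sin (Real.pi / n)) * τ.re * unitDir n k) * I_sq

lemma holeRadius_period (hev : Even n) (j : ℤ) :
    holeRadius n τ e (j + (2 * n : ℕ)) = holeRadius n τ e j := by
  have h1 : Even (j + (2 * n : ℕ)) ↔ Even j := by
    push_cast; simp [Int.even_add]
  have h2 : (j + (2 * n : ℕ)) / 2 = j / 2 + n * 1 := by push_cast; omega
  simp only [holeRadius, h1, h2, chir_period hev]

lemma sin_le_cos_pi_div (hn : 4 ≤ n) : Real.sin (Real.pi / n) ≤ Real.cos (Real.pi / n) := by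
  have hn' : (4 : ℝ) ≤ n := by exact_mod_cast hn
  have hpi := Real.pi_pos
  have h0 : 0 < Real.pi / n := by positivity
  have h1 : Real.pi / n ≤ Real.pi / 4 := by gcongr
  calc Real.sin (Real.pi / n) ≤ Real.sin (Real.pi / 4) :=
        Real.sin_le_sin_of_le_of_le_pi_div_two (by linarith) (by linarith) h1
    _ = Real.cos (Real.pi / 4) := by rw [Real.sin_pi_div_four, Real.cos_pi_div_four]
    _ ≤ _ := Real.cos_le_cos_of_nonneg_of_le_pi (by linarith) (by linarith) h1

lemma abs_im_lt_re (h1 : 0 < τ.re) (h2 : 0 < (τ ^ 2).re) : |τ.im| < τ.re := by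
  have : (τ ^ 2).re = τ.re ^ 2 - τ.im ^ 2 := by simp [sq]
  exact abs_lt_of_sq_lt_sq (by linarith) h1.le

lemma re_le_apothem (hn : 4 ≤ n) (h1 : 0 < τ.re) :
    τ.re ≤ τ.re * Real.cos (Real.pi / n) / Real.sin (Real.pi / n) := by
  rw [le_div_iff₀ (sin_pi_div_pos (by omega))]
  exact mul_le_mul_of_nonneg_left (sin_le_cos_pi_div hn) h1.le

lemma holeRadius_pos (hn : 4 ≤ n) (h1 : 0 < τ.re) (h2 : 0 < (τ ^ 2).re) (j : ℤ) :
    0 < holeRadius n τ e j := by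
  have hs := sin_pi_div_pos (n := n) (by omega)
  rw [holeRadius]
  split_ifs with h h'
  · positivity
  · have := re_le_apothem hn h1
    have := (abs_lt.1 (abs_im_lt_re h1 h2)).2
    linarith
  · have := re_le_apothem hn h1
    have := (abs_lt.1 (abs_im_lt_re h1 h2)).1
    linarith

lemma holeVertex_mem (hn : 3 ≤ n) (j : ℤ) : holeVertex n τ e j ∈ patternPoints n τ e := by
  rcases Int.even_or_odd' j with ⟨k, rfl | rfl⟩
  · rw [holeVertex_even hn]; exact pt_mem _ _ _
  · rw [holeVertex_odd hn]; exact apex₂_mem _ _ _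

/-- The closed region bounded by the hole. -/
def holeRegion (n : ℕ) (τ : ℂ) (e : ℤ) : Set ℂ :=
  starSet (2 * n) (holeDir n) (holeRadius n τ e) (· ≤ 1)

/-- The complement of the open region enclosed by the hole. -/
def holeExterior (n : ℕ) (τ : ℂ) (e : ℤ) : Set ℂ :=
  starSet (2 * n) (holeDir n) (holeRadius n τ e) (1 ≤ ·)

lemma sum_range_two_mul (f : ℕ → ℝ) (N : ℕ) :
    ∑ j ∈ Finset.range (2 * N), f j = ∑ k ∈ Finset.range N, (f (2 * k) + f (2 * k + 1)) := by
  induction N with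
  | zero => simp
  | succ N ih => rw [mul_add, mul_one, Finset.sum_range_succ, Finset.sum_range_succ, ih,
      Finset.sum_range_succ]; ring

/-- The legs from the centre to the vertices of the hole cancel in the sum over the sectors, which
leaves the angle of the bent edges of the `n`-gon. -/
lemma sum_hole_angle (hn : 3 ≤ n) (hev : Even n) {z : ℂ}
    (hz : IsGeneric (patternPoints n τ e) z) :
    ∑ j ∈ Finset.range (2 * n), angTri z 0 (holeVertex n τ e j) (holeVertex n τ e (j + 1)) =
      ∑ k ∈ Finset.range n, bent₂ n τ e z k 0 0 := by
  have h0 : (0 : ℂ) ∈ patternPoints n τ e := Or.inl rfl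
  have h1 : ∀ j : ℕ, angTri z 0 (holeVertex n τ e j) (holeVertex n τ e (j + 1)) =
      (ang z 0 (holeVertex n τ e j) - ang z 0 (holeVertex n τ e ((j + 1 : ℕ) : ℤ))) +
        ang z (holeVertex n τ e j) (holeVertex n τ e (j + 1)) := by
    intro j
    rw [angTri, hz.ang_swap h0 (holeVertex_mem hn _)]
    push_cast; ring
  have h2 : holeVertex n τ e ((2 * n : ℕ) : ℤ) = holeVertex n τ e ((0 : ℕ) : ℤ) := by
    have := starVertex_period (m := 2 * n) (q := holeDir n) (by omega)
      (holeRadius_period (τ := τ) (e := e) hev) 0 1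
    simpa [holeVertex] using this
  simp only [h1]
  rw [Finset.sum_add_distrib, Finset.sum_range_sub' (fun j : ℕ => ang z 0 (holeVertex n τ e j)), h2,
    sub_self, zero_add, sum_range_two_mul]
  refine Finset.sum_congr rfl fun k _ => ?_
  have e1 : ((2 * k + 1 : ℕ) : ℤ) + 1 = 2 * ((k : ℤ) + 1) := by push_cast; ring
  rw [e1]
  push_cast
  rw [holeVertex_even hn, holeVertex_odd hn, holeVertex_even hn, bent₂, pt_zero_succ hn]

/-! ### The tiles of the standard conversion -/

/-- The indices of the pentagons: a rhombus and one of its two halves. -/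
abbrev TileIndex (n : ℕ) : Type := RhombusIndex n × Bool

/-- The isometry that carries the pentagon in standard position to the pentagon with index `x`. -/
noncomputable def tileIso (n : ℕ) (τ : ℂ) (e : ℤ) (x : TileIndex n) : ℂ ≃ᵢ ℂ :=
  placed n τ e (x.1.1.val : ℤ) x.1.2.1 x.1.2.2 x.2

/-- The pentagon with index `x`. -/
noncomputable def tile (n : ℕ) (τ : ℂ) (e : ℤ) (x : TileIndex n) : Set ℂ :=
  tileIso n τ e x '' fan (stdPentagon n τ)

/-- The orientation of the pentagon with index `x`. -/
def tileChir {n : ℕ} (e : ℤ) (x : TileIndex n) : Bool :=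
  chir e (x.1.1.val : ℤ) x.1.2.1 x.1.2.2

lemma cr_directIso (a b : ℂ) (ha : ‖a‖ = 1) (x y w : ℂ) :
    cr (directIso a b ha x) (directIso a b ha y) (directIso a b ha w) = cr x y w := by
  have h : a * conj a = 1 := by rw [mul_conj, normSq_eq_norm_sq, ha]; simp
  simp only [cr, directIso_apply]
  congr 1
  rw [show a * y + b - (a * x + b) = a * (y - x) by ring,
    show a * w + b - (a * x + b) = a * (w - x) by ring, map_mul]
  linear_combination (conj (y - x) * (w - x)) * h

lemma cr_reverseIso (a b : ℂ) (ha : ‖a‖ = 1) (x y w : ℂ) :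
    cr (reverseIso a b ha x) (reverseIso a b ha y) (reverseIso a b ha w) = -cr x y w := by
  have : ∀ z, reverseIso a b ha z = directIso a b ha (conj z) := fun z => rfl
  rw [this, this, this, cr_directIso]
  simp [cr_def]; ring

lemma cr_place (c : Bool) (k : ℤ) (X x y w : ℂ) :
    cr (place n τ c k X x) (place n τ c k X y) (place n τ c k X w) =
      (if c then 1 else -1) * cr x y w := by
  cases c
  · simp only [place]; rw [cr_reverseIso]; simp
  · simp only [place]; rw [cr_directIso]; simp

lemma cr_placed (e k : ℤ) (i j : ℕ) (c : Bool) (x y w : ℂ) :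
    cr (placed n τ e k i j c x) (placed n τ e k i j c y) (placed n τ e k i j c w) =
      (if chir e k i j then 1 else -1) * cr x y w := by
  cases c
  · simp only [placed, IsometryEquiv.trans_apply, cr_place]
    rw [halfTurn, cr_directIso]
  · simp only [placed, cr_place]

lemma tile_eq (e : ℤ) (x : TileIndex n) : tile n τ e x =
    tri (tileIso n τ e x (stdPentagon n τ 1)) (tileIso n τ e x (stdPentagon n τ 2))
      (tileIso n τ e x (stdPentagon n τ 3)) ∪
    tri (tileIso n τ e x (stdPentagon n τ 1)) (tileIso n τ e x (stdPentagon n τ 3))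
      (tileIso n τ e x (stdPentagon n τ 4)) ∪
    tri (tileIso n τ e x (stdPentagon n τ 1)) (tileIso n τ e x (stdPentagon n τ 4))
      (tileIso n τ e x (stdPentagon n τ 0)) := by
  rw [tile, fan, image_union, image_union, image_tri, image_tri, image_tri]

lemma tileIso_mem (e : ℤ) (x : TileIndex n) (v : Fin 5) :
    tileIso n τ e x (stdPentagon n τ v) ∈ patternPoints n τ e := by
  obtain ⟨⟨k, i, j⟩, c⟩ := x
  simp only [tileIso]
  cases c <;> cases hc : chir e k i j
  · rw [(placed_false e k i j).2 hc]
    fin_cases v <;> first | exact pt_mem _ _ _ | exact apex₁_mem _ _ _ | exact apex₂_mem _ _ _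
  · rw [(placed_false e k i j).1 hc]
    fin_cases v <;> first | exact pt_mem _ _ _ | exact apex₁_mem _ _ _ | exact apex₂_mem _ _ _
  · rw [(placed_true e k i j).2 hc]
    fin_cases v <;> first | exact pt_mem _ _ _ | exact apex₁_mem _ _ _ | exact apex₂_mem _ _ _
  · rw [(placed_true e k i j).1 hc]
    fin_cases v <;> first | exact pt_mem _ _ _ | exact apex₁_mem _ _ _ | exact apex₂_mem _ _ _

lemma ne_of_cr_pos {a b c : ℂ} (h : 0 < cr a b c) : a ≠ b ∧ b ≠ c ∧ c ≠ a := by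
  refine ⟨?_, ?_, ?_⟩ <;> rintro rfl
  · simp [cr_def] at h
  · rw [cr_self_right] at h; exact lt_irrefl _ h
  · rw [cr_self_left] at h; exact lt_irrefl _ h

lemma IsGeneric.angTri_eq {V : Set ℂ} {z : ℂ} (hz : IsGeneric V z) {a b c : ℂ} (ha : a ∈ V)
    (hb : b ∈ V) (hc : c ∈ V) (h : 0 < cr a b c) :
    (z ∈ tri a b c → angTri z a b c = 2 * Real.pi) ∧ (z ∉ tri a b c → angTri z a b c = 0) := by
  obtain ⟨h1, h2, h3⟩ := ne_of_cr_pos h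
  exact PentagonTiling.angTri_eq h (hz a ha b hb h1) (hz b hb c hc h2) (hz c hc a ha h3)

lemma IsGeneric.angTri_nonneg {V : Set ℂ} {z : ℂ} (hz : IsGeneric V z) {a b c : ℂ} (ha : a ∈ V)
    (hb : b ∈ V) (hc : c ∈ V) (h : 0 < cr a b c) : 0 ≤ angTri z a b c := by
  by_cases h1 : z ∈ tri a b c
  · rw [(hz.angTri_eq ha hb hc h).1 h1]; have := Real.pi_pos; positivity
  · rw [(hz.angTri_eq ha hb hc h).2 h1]

lemma tile_subset_closure_interior (hn : 3 ≤ n) (h2 : 0 < (τ ^ 2).re) (x : TileIndex n) :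
    tile n τ e x ⊆ closure (interior (tile n τ e x)) := by
  obtain ⟨f1, f2, f3⟩ := isFan_stdPentagon hn h2
  have key : fan (stdPentagon n τ) ⊆ closure (interior (fan (stdPentagon n τ))) := by
    rintro z ((hz | hz) | hz)
    · exact closure_mono (interior_mono (subset_union_left.trans subset_union_left))
        (tri_subset_closure_interior f1 hz)
    · exact closure_mono (interior_mono (subset_union_right.trans subset_union_left))
        (tri_subset_closure_interior f2 hz)
    · exact closure_mono (interior_mono subset_union_right) (tri_subset_closure_interior f3 hz)
  have := image_mono (f := tileIso n τ e x) key
  rw [tile]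
  refine this.trans ?_
  have h3 := (tileIso n τ e x).toHomeomorph.image_closure (interior (fan (stdPentagon n τ)))
  have h4 := (tileIso n τ e x).toHomeomorph.image_interior (fan (stdPentagon n τ))
  simp only [IsometryEquiv.coe_toHomeomorph] at h3 h4
  rw [h3, h4]

lemma exists_generic_of_open {U : Set ℂ} (hU : IsOpen U) (hne : U.Nonempty) :
    ∃ z ∈ U, IsGeneric (patternPoints n τ e) z :=
  (dense_isGeneric (countable_patternPoints n τ e)).inter_open_nonempty U hU hne

/-- The angle subtended by the fan of the pentagon with index `x`. -/
noncomputable def tileAngle (n : ℕ) (τ : ℂ) (e : ℤ) (z : ℂ) (x : TileIndex n) : ℝ :=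
  angFan z (tileChir e x) (fun v => tileIso n τ e x (stdPentagon n τ v))

/-- A tile counts with `2π` for the generic points that it contains and with `0` for the others.
-/
lemma tileAngle_spec (hn : 3 ≤ n) (h2 : 0 < (τ ^ 2).re) {z : ℂ}
    (hz : IsGeneric (patternPoints n τ e) z) (x : TileIndex n) :
    0 ≤ tileAngle n τ e z x ∧ (z ∈ tile n τ e x → 2 * Real.pi ≤ tileAngle n τ e z x) ∧
      (z ∉ tile n τ e x → tileAngle n τ e z x = 0) := by
  obtain ⟨f1, f2, f3⟩ := isFan_stdPentagon hn h2
  have hcr := fun a b c => cr_placed (n := n) (τ := τ) e x.1.1.val x.1.2.1 x.1.2.2 x.2 a b c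
  have hm := fun v => tileIso_mem (τ := τ) e x v
  rw [tile_eq]
  unfold tileAngle
  set F := tileIso n τ e x with hF
  cases hc : tileChir e x
  · replace hcr : ∀ a b c, cr (F a) (F b) (F c) = -cr a b c := by
      intro a b c
      rw [hF, tileIso, hcr, show chir e x.1.1.val x.1.2.1 x.1.2.2 = false from hc]; simp
    have s : ∀ a b c, 0 < cr a b c → 0 < cr (F a) (F c) (F b) := by
      intro a b c h
      have : cr a c b = -cr a b c := by simp only [cr_def]; ring
      rw [hcr]; linarith
    have a1 := hz.angTri_eq (hm 1) (hm 3) (hm 2) (s _ _ _ f1)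
    have a2 := hz.angTri_eq (hm 1) (hm 4) (hm 3) (s _ _ _ f2)
    have a3 := hz.angTri_eq (hm 1) (hm 0) (hm 4) (s _ _ _ f3)
    have b1 := hz.angTri_nonneg (hm 1) (hm 3) (hm 2) (s _ _ _ f1)
    have b2 := hz.angTri_nonneg (hm 1) (hm 4) (hm 3) (s _ _ _ f2)
    have b3 := hz.angTri_nonneg (hm 1) (hm 0) (hm 4) (s _ _ _ f3)
    simp only [angFan]
    refine ⟨by linarith, ?_, ?_⟩
    · rintro ((h | h) | h)
      · rw [← tri_swap] at h; linarith [a1.1 h]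
      · rw [← tri_swap] at h; linarith [a2.1 h]
      · rw [← tri_swap] at h; linarith [a3.1 h]
    · intro h
      simp only [mem_union, not_or] at h
      rw [a1.2 (by rw [tri_swap]; exact h.1.1), a2.2 (by rw [tri_swap]; exact h.1.2),
        a3.2 (by rw [tri_swap]; exact h.2)]; simp
  · replace hcr : ∀ a b c, cr (F a) (F b) (F c) = cr a b c := by
      intro a b c
      rw [hF, tileIso, hcr, show chir e x.1.1.val x.1.2.1 x.1.2.2 = true from hc]; simp
    rw [← hcr] at f1 f2 f3
    have a1 := hz.angTri_eq (hm 1) (hm 2) (hm 3) f1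
    have a2 := hz.angTri_eq (hm 1) (hm 3) (hm 4) f2
    have a3 := hz.angTri_eq (hm 1) (hm 4) (hm 0) f3
    have b1 := hz.angTri_nonneg (hm 1) (hm 2) (hm 3) f1
    have b2 := hz.angTri_nonneg (hm 1) (hm 3) (hm 4) f2
    have b3 := hz.angTri_nonneg (hm 1) (hm 4) (hm 0) f3
    simp only [angFan]
    refine ⟨by linarith, ?_, ?_⟩
    · rintro ((h | h) | h)
      · linarith [a1.1 h]
      · linarith [a2.1 h]
      · linarith [a3.1 h]
    · intro h
      simp only [mem_union, not_or] at h
      rw [a1.2 h.1.1, a2.2 h.1.2, a3.2 h.2]; simp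

/-- The indices of a finite part of the pattern. -/
def indexBox (n N : ℕ) : Finset (TileIndex n) :=
  (Finset.univ ×ˢ (Finset.range N ×ˢ Finset.range N)) ×ˢ Finset.univ

lemma sum_indexBox (z : ℂ) (N : ℕ) : ∑ x ∈ indexBox n N, tileAngle n τ e z x =
    ∑ k ∈ Finset.range n, ∑ i ∈ Finset.range N, ∑ j ∈ Finset.range N, pairAngle n τ e z k i j := by
  rw [indexBox, Finset.sum_product, Finset.sum_product, Finset.sum_range]
  refine Finset.sum_congr rfl fun k _ => ?_
  rw [Finset.sum_product]
  refine Finset.sum_congr rfl fun i _ => Finset.sum_congr rfl fun j _ => ?_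
  rw [Fintype.sum_bool]
  rfl

/-- All tiles with indices below a large bound, together with the hole, have total angle `2π` at a
generic point. -/
lemma exists_total (hn : 3 ≤ n) (hev : Even n) (h1 : 0 < τ.re) {z : ℂ}
    (hz : IsGeneric (patternPoints n τ e) z) : ∃ N₀ : ℕ, ∀ N ≥ N₀,
      ∑ x ∈ indexBox n N, tileAngle n τ e z x + ∑ j ∈ Finset.range (2 * n),
        angTri z 0 (holeVertex n τ e j) (holeVertex n τ e (j + 1)) = 2 * Real.pi := by
  obtain ⟨N₀, h⟩ := exists_total_angle hn hev h1 hz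
  exact ⟨N₀, fun N hN => by rw [sum_hole_angle hn hev hz, sum_indexBox, h N hN]⟩

lemma mem_indexBox (x : TileIndex n) {N : ℕ} (h : x.1.2.1 + x.1.2.2 < N) : x ∈ indexBox n N := by
  simp only [indexBox, Finset.mem_product, Finset.mem_univ, Finset.mem_range, true_and, and_true]
  omega

lemma compl_holeRegion_subset (hn : 4 ≤ n) (h1 : 0 < τ.re) (h2 : 0 < (τ ^ 2).re) :
    (holeRegion n τ e)ᶜ ⊆ holeExterior n τ e := by
  intro z hz
  obtain ⟨j, a, b, ha, hb, h⟩ := star_cover (m := 2 * n) (by omega) (holeDir_ne_zero (n := n))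
    (holeRadius_pos (e := e) hn h1 h2) z
  refine ⟨j, a, b, ha, hb, ?_, h⟩
  by_contra hab
  exact hz ⟨j, a, b, ha, hb, (not_le.1 hab).le, h⟩

lemma locallyFinite_tile (hn : 3 ≤ n) (h1 : 0 < τ.re) : LocallyFinite (tile n τ e) := by
  -- every tile stays within a fixed distance `D` of the base point of its rhombus
  obtain ⟨D, hD⟩ : ∃ D, ∀ x : TileIndex n, ∀ y ∈ tile n τ e x,
      dist y (pt n τ x.1.1.val x.1.2.1 x.1.2.2) ≤ D := by
    have hb := ((isCompact_fan (stdPentagon n τ)).union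
      ((isCompact_fan (stdPentagon n τ)).image (halfTurn n τ).continuous)).isBounded
    obtain ⟨D, hD⟩ := hb.subset_closedBall (-τ)
    refine ⟨D, ?_⟩
    have hX : ∀ (c : Bool) (k : ℤ) (X : ℂ), place n τ c k X (-τ) = X := by
      intro c k X
      cases c
      · rw [place_false_apply]; simp
      · rw [place_true_apply]; simp
    rintro ⟨⟨k, i, j⟩, c⟩ _ ⟨y, hy, rfl⟩
    have h3 : ∀ w, dist (place n τ (chir e k i j) k (pt n τ k i j) w) (pt n τ k i j) =
        dist w (-τ) := by
      intro w
      have := (place n τ (chir e k i j) k (pt n τ k i j)).dist_eq w (-τ)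
      rwa [hX] at this
    cases c
    · simp only [tileIso, placed, IsometryEquiv.trans_apply, h3]
      exact hD (Or.inr (mem_image_of_mem _ hy))
    · simp only [tileIso, placed, h3]
      exact hD (Or.inl hy)
  intro z
  refine ⟨Metric.ball z 1, Metric.ball_mem_nhds z one_pos, ?_⟩
  have hc := cos_pi_div_pos (n := n) hn
  obtain ⟨M, hM⟩ := exists_nat_gt
    ((‖pt n τ 0 0 0‖ + D + ‖z‖ + 1) / (2 * τ.re * Real.cos (Real.pi / n)))
  rw [div_lt_iff₀ (by positivity)] at hM
  refine (Finset.finite_toSet (indexBox n M)).subset ?_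
  rintro x ⟨y, hy, hyz⟩
  refine mem_indexBox x ?_
  have e1 := hD x y hy
  have e2 : dist y z < 1 := hyz
  have e3 : ‖pt n τ x.1.1.val x.1.2.1 x.1.2.2‖ ≤ D + 1 + ‖z‖ := by
    calc ‖pt n τ x.1.1.val x.1.2.1 x.1.2.2‖ = dist (pt n τ x.1.1.val x.1.2.1 x.1.2.2) 0 := by simp
      _ ≤ dist (pt n τ x.1.1.val x.1.2.1 x.1.2.2) y + dist y z + dist z 0 := dist_triangle4 _ _ _ _
      _ ≤ _ := by rw [dist_comm _ y, dist_zero_right]; linarith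
  have e4 := re_pt_bisector (n := n) (τ := τ) hn x.1.1.val x.1.2.1 x.1.2.2
  have e5 := (abs_le.1 (Complex.abs_re_le_norm (pt n τ x.1.1.val x.1.2.1 x.1.2.2 *
    conj (unitDir (2 * n) (2 * x.1.1.val - 1))))).2
  have e6 := (abs_le.1 (Complex.abs_re_le_norm (pt n τ x.1.1.val 0 0 *
    conj (unitDir (2 * n) (2 * x.1.1.val - 1))))).1
  rw [norm_mul, RCLike.norm_conj, norm_unitDir, mul_one] at e5 e6
  rw [pt_eq_mul _ 0 0, norm_mul, norm_unitDir, one_mul, ← pt_eq_mul] at e6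
  have e7 : ((x.1.2.1 : ℝ) + x.1.2.2) * (2 * τ.re * Real.cos (Real.pi / n)) <
      M * (2 * τ.re * Real.cos (Real.pi / n)) := by linarith
  have e8 := lt_of_mul_lt_mul_right e7 (by positivity)
  exact_mod_cast e8

section
variable (hn : 4 ≤ n) (hev : Even n) (h1 : 0 < τ.re) (h2 : 0 < (τ ^ 2).re)
include hn hev h1 h2

/-- The hole counts with `2π` for the generic points that it contains and with `0` for the others.
-/
lemma hole_angle_spec {z : ℂ} (hz : IsGeneric (patternPoints n τ e) z) :
    0 ≤ ∑ j ∈ Finset.range (2 * n),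
        angTri z 0 (holeVertex n τ e j) (holeVertex n τ e (j + 1)) ∧
    (z ∈ holeRegion n τ e → 2 * Real.pi ≤ ∑ j ∈ Finset.range (2 * n),
        angTri z 0 (holeVertex n τ e j) (holeVertex n τ e (j + 1))) ∧
    (z ∉ holeRegion n τ e → ∑ j ∈ Finset.range (2 * n),
        angTri z 0 (holeVertex n τ e j) (holeVertex n τ e (j + 1)) = 0) := by
  have hpos := fun j => cr_starVertex_pos (m := 2 * n) (by omega) (holeDir_ne_zero (n := n))
    (holeRadius_pos (e := e) hn h1 h2) j
  have h0 : (0 : ℂ) ∈ patternPoints n τ e := Or.inl rfl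
  have hm := fun j => holeVertex_mem (τ := τ) (e := e) (n := n) (by omega) j
  have hnn : ∀ j : ℕ, 0 ≤ angTri z 0 (holeVertex n τ e j) (holeVertex n τ e (j + 1)) := fun j =>
    hz.angTri_nonneg h0 (hm _) (hm _) (hpos _)
  have hreg : holeRegion n τ e = ⋃ j : Fin (2 * n), tri 0 (holeVertex n τ e (j.val : ℤ))
      (holeVertex n τ e ((j.val : ℤ) + 1)) :=
    starSet_le_eq (by omega) (holeRadius_period hev)
  refine ⟨Finset.sum_nonneg fun j _ => hnn j, fun h => ?_, fun h => ?_⟩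
  · rw [hreg, mem_iUnion] at h
    obtain ⟨j, hj⟩ := h
    rw [← (hz.angTri_eq h0 (hm _) (hm _) (hpos _)).1 hj]
    exact Finset.single_le_sum (fun j _ => hnn j) (Finset.mem_range.2 j.isLt)
  · rw [hreg, mem_iUnion, not_exists] at h
    refine Finset.sum_eq_zero fun j hj => ?_
    exact (hz.angTri_eq h0 (hm _) (hm _) (hpos _)).2 (h ⟨j, Finset.mem_range.1 hj⟩)

/-- No generic point lies in two tiles. -/
lemma not_mem_two_tiles {z : ℂ} (hz : IsGeneric (patternPoints n τ e) z) {x y : TileIndex n}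
    (hxy : x ≠ y) (hx : z ∈ tile n τ e x) (hy : z ∈ tile n τ e y) : False := by
  obtain ⟨N₀, h⟩ := exists_total (by omega) hev h1 hz
  set N := N₀ + (x.1.2.1 + x.1.2.2) + (y.1.2.1 + y.1.2.2) + 1 with hN
  have h3 := h N (by omega)
  have hs := fun x => tileAngle_spec (n := n) (by omega) h2 hz x
  have h4 : ∑ w ∈ {x, y}, tileAngle n τ e z w ≤ ∑ w ∈ indexBox n N, tileAngle n τ e z w := by
    refine Finset.sum_le_sum_of_subset_of_nonneg ?_ fun w _ _ => (hs w).1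
    intro w hw
    rw [Finset.mem_insert, Finset.mem_singleton] at hw
    rcases hw with rfl | rfl
    · exact mem_indexBox _ (by omega)
    · exact mem_indexBox _ (by omega)
  rw [Finset.sum_pair hxy] at h4
  have := (hs x).2.1 hx
  have := (hs y).2.1 hy
  have := (hole_angle_spec hn hev h1 h2 hz).1
  have := Real.pi_pos
  linarith

/-- No generic point lies in a tile and in the hole. -/
lemma not_mem_tile_hole {z : ℂ} (hz : IsGeneric (patternPoints n τ e) z) {x : TileIndex n}
    (hx : z ∈ tile n τ e x) (hh : z ∈ holeRegion n τ e) : False := by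
  obtain ⟨N₀, h⟩ := exists_total (by omega) hev h1 hz
  set N := N₀ + (x.1.2.1 + x.1.2.2) + 1 with hN
  have h3 := h N (by omega)
  have hs := fun x => tileAngle_spec (n := n) (by omega) h2 hz x
  have h4 := Finset.single_le_sum (f := fun w => tileAngle n τ e z w) (fun w _ => (hs w).1)
    (mem_indexBox x (N := N) (by omega))
  have := (hs x).2.1 hx
  have := (hole_angle_spec hn hev h1 h2 hz).2.1 hh
  have := Real.pi_pos
  linarith

/-- Every generic point outside the hole lies in a tile. -/
lemma exists_tile_of_generic {z : ℂ} (hz : IsGeneric (patternPoints n τ e) z)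
    (hh : z ∉ holeRegion n τ e) : ∃ x, z ∈ tile n τ e x := by
  by_contra! hno
  obtain ⟨N₀, h⟩ := exists_total (by omega) hev h1 hz
  have h3 := h N₀ le_rfl
  have hs := fun x => tileAngle_spec (n := n) (by omega) h2 hz x
  rw [(hole_angle_spec hn hev h1 h2 hz).2.2 hh,
    Finset.sum_eq_zero fun x _ => (hs x).2.2 (hno x)] at h3
  have := Real.pi_pos
  linarith

lemma disjoint_interior_tile {x y : TileIndex n} (hxy : x ≠ y) :
    Disjoint (interior (tile n τ e x)) (interior (tile n τ e y)) := by
  rw [Set.disjoint_iff_inter_eq_empty, ← Set.not_nonempty_iff_eq_empty]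
  intro hne
  obtain ⟨z, hz, hg⟩ := exists_generic_of_open (n := n) (τ := τ) (e := e)
    (isOpen_interior.inter isOpen_interior) hne
  exact not_mem_two_tiles hn hev h1 h2 hg hxy (interior_subset hz.1) (interior_subset hz.2)

lemma holeExterior_compl_subset : (holeExterior n τ e)ᶜ ⊆ holeRegion n τ e := by
  have := starSet_diff (m := 2 * n) (by omega) (holeDir_ne_zero (n := n))
    (holeRadius_pos (e := e) hn h1 h2) (holeRadius_period hev)
  rw [holeExterior, ← this]
  exact sdiff_subset

lemma isClosed_holeExterior : IsClosed (holeExterior n τ e) :=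
  isClosed_starSet (by omega) holeDir_ne_zero (holeRadius_pos hn h1 h2) (holeRadius_period hev)

/-- Generic points are dense, and no generic point lies both in a tile and in the hole; since
tiles are closures of their interiors, this extends to all points. -/
lemma tile_subset_holeExterior (x : TileIndex n) : tile n τ e x ⊆ holeExterior n τ e := by
  intro z hz
  by_contra hzU
  have hU := (isClosed_holeExterior (e := e) hn hev h1 h2).isOpen_compl
  have hcl := tile_subset_closure_interior (e := e) (by omega) h2 x hz
  have hne := mem_closure_iff.1 hcl _ hU hzU
  obtain ⟨w, hw, hg⟩ := exists_generic_of_open (n := n) (τ := τ) (e := e) (hU.inter isOpen_interior) hne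
  exact not_mem_tile_hole hn hev h1 h2 hg (interior_subset hw.2)
    (holeExterior_compl_subset hn hev h1 h2 hw.1)

lemma closure_compl_holeRegion : closure (holeRegion n τ e)ᶜ = holeExterior n τ e := by
  refine Subset.antisymm (closure_minimal (compl_holeRegion_subset hn h1 h2)
    (isClosed_holeExterior hn hev h1 h2)) ?_
  -- points of gauge at least `1` are limits of points of gauge greater than `1`
  rintro z ⟨j, a, b, ha, hb, hab, hz⟩
  rw [Metric.mem_closure_iff]
  intro ε hε
  have hz0 : 0 < ‖z‖ + 1 := by positivity
  set t : ℝ := ε / (2 * (‖z‖ + 1)) with ht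
  have ht0 : 0 < t := by positivity
  refine ⟨(1 + t : ℝ) * z, ?_, ?_⟩
  · rintro ⟨i, a', b', ha', hb', hab', he⟩
    have := star_gauge_unique (m := 2 * n) (by omega) (holeDir_ne_zero (n := n))
      (holeRadius_pos (e := e) hn h1 h2) (holeRadius_period hev) (j := j) (i := i)
      (a := (1 + t) * a) (b := (1 + t) * b) (by positivity) (by positivity) ha' hb'
      (by rw [← he, hz]; push_cast; ring)
    nlinarith
  · rw [dist_eq_norm]
    have : z - ((1 + t : ℝ) : ℂ) * z = -((t : ℂ) * z) := by push_cast; ring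
    rw [this, norm_neg, norm_mul, Complex.norm_of_nonneg ht0.le, ht, div_mul_eq_mul_div,
      div_lt_iff₀ (by positivity)]
    nlinarith [norm_nonneg z]

lemma iUnion_tile : ⋃ x, tile n τ e x = holeExterior n τ e := by
  apply Subset.antisymm
  · exact iUnion_subset fun x => tile_subset_holeExterior hn hev h1 h2 x
  · have hclosed : IsClosed (⋃ x, tile n τ e x) :=
      (locallyFinite_tile (by omega) h1).isClosed_iUnion fun x =>
        ((isCompact_fan _).image (tileIso n τ e x).continuous).isClosed
    have hO : IsOpen (holeRegion n τ e)ᶜ :=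
      (isCompact_starSet (by omega) (holeRadius_period hev)).isClosed.isOpen_compl
    rw [← closure_compl_holeRegion hn hev h1 h2]
    refine closure_minimal (fun z hz => ?_) hclosed
    rw [← hclosed.closure_eq, mem_closure_iff]
    intro o ho hzo
    obtain ⟨w, hw, hg⟩ := exists_generic_of_open (n := n) (τ := τ) (e := e) (ho.inter hO)
      ⟨z, hzo, hz⟩
    exact ⟨w, hw.1, mem_iUnion.2 (exists_tile_of_generic hn hev h1 h2 hg hw.2)⟩

end

end

/-! ### The standard conversion and the shape of its hole -/

/-- The conversion that places a pentagon in standard position, and its partner, at every rhombus;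
the chirality follows a checkerboard pattern. -/
noncomputable def stdConversion (n : ℕ) (τ : ℂ) (e : ℤ) (r : RhombusIndex n) : ℂ ≃ᵢ ℂ :=
  placed n τ e (r.1.val : ℤ) r.2.1 r.2.2 true

section
variable {n : ℕ} {τ : ℂ} {e : ℤ}

lemma partner_stdPentagon (i : Fin 5) :
    partner (stdPentagon n τ) i = halfTurn n τ (stdPentagon n τ i) := by
  rw [halfTurn_apply]; rfl

lemma dist_stdPentagon_zero_two (h1 : 0 < τ.re) :
    dist (stdPentagon n τ 0) (stdPentagon n τ 2) = 2 * τ.re := by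
  rw [stdPentagon_zero, stdPentagon_two, dist_eq_norm,
    show -τ - conj τ = -(τ + conj τ) by ring, norm_neg, add_conj,
    Complex.norm_of_nonneg (by positivity)]

lemma dist_stdPentagon_zero_one : dist (stdPentagon n τ 0) (stdPentagon n τ 1) = ‖τ‖ := by
  rw [stdPentagon_zero, stdPentagon_one, dist_zero_right, norm_neg]

lemma region_stdPentagon (hn : 3 ≤ n) (h2 : 0 < (τ ^ 2).re) :
    region (stdPentagon n τ) = fan (stdPentagon n τ) := by
  rw [region_eq_image_fan (isFan_stdPentagon hn h2) (IsometryEquiv.refl ℂ) fun i => rfl]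
  exact image_id _

lemma region_partner_stdPentagon (hn : 3 ≤ n) (h2 : 0 < (τ ^ 2).re) :
    region (partner (stdPentagon n τ)) = halfTurn n τ '' fan (stdPentagon n τ) :=
  region_eq_image_fan (isFan_stdPentagon hn h2) _ partner_stdPentagon

lemma isConversion_stdConversion (h1 : 0 < τ.re) :
    IsConversion n (stdPentagon n τ) (stdConversion n τ e) := by
  rintro ⟨k, i, j⟩
  rw [dist_stdPentagon_zero_two h1, partner_stdPentagon, partner_stdPentagon]
  have hF : ∀ z, stdConversion n τ e (k, i, j) (halfTurn n τ z) = placed n τ e k i j false z :=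
    fun z => rfl
  have hT : ∀ z, stdConversion n τ e (k, i, j) z = placed n τ e k i j true z := fun z => rfl
  rw [image_insert_eq, image_insert_eq, image_insert_eq, image_singleton, hF, hF, hT, hT]
  show _ = ({pt n τ k i j, pt n τ k (i + 1) j, pt n τ k (i + 1) (j + 1), pt n τ k i (j + 1)} :
    Set ℂ)
  cases hc : chir e k i j
  · rw [(placed_false e k i j).2 hc, (placed_false e k i j).2 hc, (placed_true e k i j).2 hc,
      (placed_true e k i j).2 hc]
    ext z
    simp only [mem_insert_iff, mem_singleton_iff]
    simp
    tauto
  · rw [(placed_false e k i j).1 hc, (placed_false e k i j).1 hc, (placed_true e k i j).1 hc,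
      (placed_true e k i j).1 hc]
    rfl

lemma tiles_stdConversion (hn : 3 ≤ n) (h2 : 0 < (τ ^ 2).re) :
    tiles (stdPentagon n τ) (stdConversion n τ e) = range (tile n τ e) := by
  rw [tiles, region_stdPentagon hn h2, region_partner_stdPentagon hn h2]
  have key : ∀ r : RhombusIndex n,
      stdConversion n τ e r '' fan (stdPentagon n τ) = tile n τ e (r, true) ∧
      stdConversion n τ e r '' (halfTurn n τ '' fan (stdPentagon n τ)) = tile n τ e (r, false) := by
    intro r
    refine ⟨rfl, ?_⟩
    rw [← image_comp]; rfl
  ext T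
  constructor
  · rintro ⟨r, h | h⟩
    · exact ⟨(r, true), by rw [h, (key r).1]⟩
    · exact ⟨(r, false), by rw [h, (key r).2]⟩
  · rintro ⟨⟨r, c⟩, rfl⟩
    refine ⟨r, ?_⟩
    rw [(key r).1, (key r).2]
    cases c
    · exact Or.inr rfl
    · exact Or.inl rfl

/-- The hole as a polygon. -/
noncomputable def holePolygon (n : ℕ) (τ : ℂ) (e : ℤ) : Polygon ℂ (2 * n) :=
  starPolygon (2 * n) (holeDir n) (holeRadius n τ e)

lemma chir_succ_sector (k : ℤ) : chir e (k + 1) 0 0 = !chir e k 0 0 := by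
  have : e + (k + 1) + ((0 : ℕ) : ℤ) + ((0 : ℕ) : ℤ) = e + k + ((0 : ℕ) : ℤ) + ((0 : ℕ) : ℤ) + 1 := by
    push_cast; ring
  simp only [chir, this, Int.even_add_one, decide_not]

lemma holeVertex_even' (hn : 3 ≤ n) (k : ℤ) :
    holeVertex n τ e (2 * k + 2) = pt n τ k 0 0 + unitDir n k * (2 * τ.re : ℝ) := by
  rw [show 2 * k + 2 = 2 * (k + 1) by ring, holeVertex_even hn, ← pt_zero_succ hn, pt_succ_right]

/-- The distance of the apices of the bent edges from the centre: alternately less and more than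
the apothem of the regular `n`-gon. -/
lemma holeRadius_odd (he : chir e 0 0 0 = decide (0 < τ.im)) (k : ℤ) :
    holeRadius n τ e (2 * k + 1) = τ.re * Real.cos (Real.pi / n) / Real.sin (Real.pi / n) -
      (if Even k then |τ.im| else -|τ.im|) := by
  have hdiv : (2 * k + 1) / 2 = k := by omega
  have hpar : chir e k 0 0 = if Even k then chir e 0 0 0 else !chir e 0 0 0 := by
    simp only [chir]
    split_ifs with h
    · simp [Int.even_add, h]
    · simp [Int.even_add, h, -Int.not_even_iff_odd]
  rw [holeRadius, if_neg (by simp), hdiv, hpar, he]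
  congr 1
  by_cases h : Even k <;> by_cases h' : 0 < τ.im
  · simp [h, h', abs_of_pos]
  · simp [h, h', abs_of_nonpos (not_lt.1 h')]
  · simp [h, h', abs_of_pos]
  · simp [h, h', abs_of_nonpos (not_lt.1 h')]

lemma holeRadius_two_mul (k : ℤ) : holeRadius n τ e (2 * k) = τ.re / Real.sin (Real.pi / n) := by
  simp [holeRadius]

/-- The unit vector from the centre towards the midpoint of the edge `k` of the `n`-gon. -/
noncomputable def edgeDir (n : ℕ) (k : ℤ) : ℂ := holeDir n * unitDir (2 * n) (2 * k + 1)

lemma norm_edgeDir (k : ℤ) : ‖edgeDir n k‖ = 1 := by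
  simp [edgeDir, holeDir, norm_unitDir]

lemma holeVertex_odd_eq (k : ℤ) :
    holeVertex n τ e (2 * k + 1) = holeRadius n τ e (2 * k + 1) * edgeDir n k := by
  rw [holeVertex, starVertex, edgeDir]; ring

lemma re_unitDir_two_one (hn : 3 ≤ n) : (unitDir (2 * n) 1).re = Real.cos (Real.pi / n) := by
  have hn0 : (n : ℝ) ≠ 0 := by positivity
  rw [unitDir_re]; congr 1; push_cast; field_simp

lemma pt_add_pt (hn : 3 ≤ n) (k : ℤ) : pt n τ k 0 0 + pt n τ (k + 1) 0 0 =
    (2 * (τ.re * Real.cos (Real.pi / n) / Real.sin (Real.pi / n)) : ℝ) * edgeDir n k := by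
  rw [← holeVertex_even (e := 0) hn, ← holeVertex_even (e := 0) hn, holeVertex, starVertex,
    starVertex, holeRadius_two_mul, holeRadius_two_mul, edgeDir]
  have h1 : unitDir (2 * n) (2 * (k + 1)) = unitDir (2 * n) (2 * k + 1) * unitDir (2 * n) 1 := by
    rw [← unitDir_add]; congr 1; ring
  have h2 : unitDir (2 * n) (2 * k) = unitDir (2 * n) (2 * k + 1) * conj (unitDir (2 * n) 1) := by
    rw [conj_unitDir, ← unitDir_add]; congr 1; ring
  have h3 := add_conj (unitDir (2 * n) 1)
  rw [re_unitDir_two_one hn] at h3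
  rw [h1, h2]
  push_cast [-ofReal_cos, -ofReal_sin] at h3 ⊢
  linear_combination holeDir n * (τ.re / Real.sin (Real.pi / n)) * unitDir (2 * n) (2 * k + 1) * h3

lemma affineIndependent_of_cr_ne_zero {a b c : ℂ} (h : cr a b c ≠ 0) :
    AffineIndependent ℝ ![a, b, c] := by
  rw [affineIndependent_iff_not_collinear_set]
  intro hcol
  obtain ⟨v, hv⟩ := (collinear_iff_of_mem (p₀ := a) (by simp)).1 hcol
  obtain ⟨s, hs⟩ := hv b (by simp)
  obtain ⟨t, ht⟩ := hv c (by simp)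
  apply h
  rw [hs, ht, cr]
  simp; ring

lemma holePolygon_apply (i : Fin (2 * n)) : holePolygon n τ e i = holeVertex n τ e (i.val : ℤ) :=
  rfl

section
variable [NeZero n] (hn : 4 ≤ n) (hev : Even n)
include hn hev

lemma holePolygon_succ (i : Fin (2 * n)) :
    holePolygon n τ e (i + 1) = holeVertex n τ e ((i.val : ℤ) + 1) := by
  rw [← finRotate_apply]
  exact starPolygon_finRotate (by omega) (holeRadius_period hev) i

lemma holePolygon_succ_succ (i : Fin (2 * n)) :
    holePolygon n τ e (i + 2) = holeVertex n τ e ((i.val : ℤ) + 2) := by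
  have h : i + 2 = i + 1 + 1 := by
    rw [add_assoc]
    congr 1
    exact Fin.ext (Nat.add_mod 1 1 (2 * n))
  rw [h, holePolygon_succ hn hev]
  have h1 : ((i + 1 : Fin (2 * n)).val : ℤ) = ((i.val : ℤ) + 1) % (2 * n : ℕ) := by
    rw [Fin.val_add, Fin.val_one', Nat.add_mod_mod, Int.natCast_mod, Nat.cast_add, Nat.cast_one]
  rw [h1, holeVertex, starVertex_succ_emod (by omega) (holeRadius_period hev)]
  congr 1

lemma nondegenerate_holePolygon (h1 : 0 < τ.re) (h3 : τ.im ≠ 0) :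
    (holePolygon n τ e).HasNondegenerateVertices ℝ := by
  intro i
  apply affineIndependent_of_cr_ne_zero
  rw [holePolygon_succ hn hev, holePolygon_succ_succ hn hev, holePolygon_apply]
  have hn3 : 3 ≤ n := by omega
  rcases Int.even_or_odd' (i.val : ℤ) with ⟨k, hk | hk⟩ <;> rw [hk]
  · rw [holeVertex_even hn3, holeVertex_odd hn3, holeVertex_even' hn3, apex₂, cr]
    have hu := unitDir_mul_conj n k
    have : (conj (pt n τ k 0 0 + unitDir n k * leg τ (chir e k 0 0) - pt n τ k 0 0) *
        (pt n τ k 0 0 + unitDir n k * (2 * τ.re : ℝ) - pt n τ k 0 0)) =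
        conj (leg τ (chir e k 0 0)) * (2 * τ.re : ℝ) := by
      rw [add_sub_cancel_left, add_sub_cancel_left, map_mul]
      linear_combination (conj (leg τ (chir e k 0 0)) * (2 * τ.re : ℝ)) * hu
    rw [this]
    cases chir e k 0 0 <;> simp [leg, h1.ne', h3]
  · rw [show 2 * k + 1 + 1 = 2 * k + 2 by ring, show 2 * k + 1 + 2 = 2 * (k + 1) + 1 by ring,
      holeVertex_odd hn3, holeVertex_even' hn3, holeVertex_odd hn3, apex₂, apex₂,
      chir_succ_sector, ← pt_zero_succ hn3, pt_succ_right, cr]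
    set c := chir e k 0 0
    have hu := unitDir_mul_conj n k
    have hL := leg_add_leg τ c
    have e1 : pt n τ k 0 0 + unitDir n k * (2 * τ.re : ℝ) - (pt n τ k 0 0 + unitDir n k * leg τ c) =
        unitDir n k * leg τ (!c) := by rw [← hL]; ring
    have e2 : pt n τ k 0 0 + unitDir n k * (2 * τ.re : ℝ) + unitDir n (k + 1) * leg τ (!c) -
        (pt n τ k 0 0 + unitDir n k * leg τ c) = unitDir n k * leg τ (!c) * (1 + unitDir n 1) := by
      rw [← hL, unitDir_add]; ring
    rw [e1, e2]
    have e3 : conj (unitDir n k * leg τ (!c)) * (unitDir n k * leg τ (!c) * (1 + unitDir n 1)) =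
        (normSq τ : ℝ) * (1 + unitDir n 1) := by
      have : leg τ (!c) * conj (leg τ (!c)) = normSq τ := by
        cases c <;> simp [leg, mul_conj, mul_comm (conj τ)]
      rw [map_mul]
      linear_combination (leg τ (!c) * conj (leg τ (!c)) * (1 + unitDir n 1)) * hu +
        (1 + unitDir n 1) * this
    rw [e3, im_ofReal_mul]
    have hτ : τ ≠ 0 := by rintro rfl; simp at h1
    refine mul_ne_zero (by simpa using hτ) ?_
    simpa using (unitDir_one_im_pos hn3).ne'

lemma dist_holePolygon (i : Fin (2 * n)) :
    dist (holePolygon n τ e i) (holePolygon n τ e (i + 1)) = ‖τ‖ := by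
  rw [holePolygon_succ hn hev, holePolygon_apply]
  have hn3 : 3 ≤ n := by omega
  rcases Int.even_or_odd' (i.val : ℤ) with ⟨k, hk | hk⟩ <;> rw [hk]
  · rw [holeVertex_even hn3, holeVertex_odd hn3, apex₂, dist_eq_norm, sub_add_cancel_left, norm_neg,
      norm_mul, norm_unitDir, one_mul, norm_leg]
  · rw [show 2 * k + 1 + 1 = 2 * k + 2 by ring, holeVertex_odd hn3, holeVertex_even' hn3, apex₂,
      ← leg_add_leg τ (chir e k 0 0), dist_eq_norm,
      show ∀ a b c d : ℂ, a + b * c - (a + b * (c + d)) = -(b * d) by intros; ring, norm_neg,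
      norm_mul, norm_unitDir, one_mul, norm_leg]

end

section
variable (hn : 4 ≤ n) (hev : Even n) (h1 : 0 < τ.re) (h2 : 0 < (τ ^ 2).re)
include hn hev h1 h2

lemma inside_holePolygon : inside (holePolygon n τ e) = (holeExterior n τ e)ᶜ :=
  inside_starPolygon (by omega) holeDir_ne_zero (holeRadius_pos hn h1 h2) (holeRadius_period hev)

lemma region_holePolygon : region (holePolygon n τ e) = holeRegion n τ e :=
  region_starPolygon (by omega) holeDir_ne_zero (holeRadius_pos hn h1 h2) (holeRadius_period hev)

lemma isTilingWithHole_stdConversion :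
    IsTilingWithHole (tiles (stdPentagon n τ) (stdConversion n τ e)) (holePolygon n τ e) := by
  rw [IsTilingWithHole, tiles_stdConversion (by omega) h2, inside_holePolygon hn hev h1 h2,
    compl_compl, ← iUnion_tile hn hev h1 h2, sUnion_range]
  refine ⟨?_, rfl⟩
  rintro _ ⟨x, rfl⟩ _ ⟨y, rfl⟩ hne
  exact disjoint_interior_tile hn hev h1 h2 fun h => hne (by rw [h])

lemma gauge_le_one {z : ℂ} (hz : z ∈ holeRegion n τ e) {j : ℤ} {a b : ℝ} (ha : 0 ≤ a) (hb : 0 ≤ b)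
    (h : z = a * holeVertex n τ e j + b * holeVertex n τ e (j + 1)) : a + b ≤ 1 := by
  obtain ⟨i, a', b', ha', hb', hab', he⟩ := hz
  rw [star_gauge_unique (m := 2 * n) (by omega) (holeDir_ne_zero (n := n))
    (holeRadius_pos (e := e) hn h1 h2) (holeRadius_period hev) ha hb ha' hb' (h.symm.trans he)]
  exact hab'

lemma not_convex_holeRegion (h3 : τ.im ≠ 0) (he : chir e 0 0 0 = decide (0 < τ.im)) :
    ¬ Convex ℝ (holeRegion n τ e) := by
  intro hconv
  have hv : ∀ j, holeVertex n τ e j ∈ holeRegion n τ e := fun j =>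
    ⟨j, 1, 0, zero_le_one, le_rfl, by norm_num, by simp [holeVertex]⟩
  -- the midpoint of an edge of the `n`-gon whose apex is bent inwards
  have hm := hconv (hv (2 * 0)) (hv (2 * (0 + 1))) (by norm_num : (0 : ℝ) ≤ 1 / 2)
    (by norm_num : (0 : ℝ) ≤ 1 / 2) (by norm_num)
  rw [holeVertex_even (by omega), holeVertex_even (by omega), ← smul_add, pt_add_pt (by omega)] at hm
  have hr := holeRadius_pos (e := e) hn h1 h2 (2 * 0 + 1)
  have hr' := holeRadius_odd (n := n) he 0
  set A := τ.re * Real.cos (Real.pi / n) / Real.sin (Real.pi / n)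
  rw [if_pos (by simp)] at hr'
  have hA : 0 < A := by have := re_le_apothem hn h1; linarith
  have habs : 0 < |τ.im| := abs_pos.2 h3
  have := gauge_le_one hn hev h1 h2 hm (j := 2 * 0 + 1) (a := A / holeRadius n τ e (2 * 0 + 1))
    (b := 0) (by positivity) le_rfl (by
      rw [holeVertex_odd_eq]
      have : (holeRadius n τ e (2 * 0 + 1) : ℂ) ≠ 0 := by exact_mod_cast hr.ne'
      rw [real_smul, ofReal_div A, ← mul_assoc (_ / _), div_mul_cancel₀ _ this]
      push_cast
      ring)
  rw [add_zero, div_le_one hr] at this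
  linarith

lemma isEquilateralConcave_holePolygon [NeZero n] (h3 : τ.im ≠ 0)
    (he : chir e 0 0 0 = decide (0 < τ.im)) : IsEquilateralConcave ‖τ‖ (holePolygon n τ e) := by
  refine ⟨isSimple_starPolygon (by omega) holeDir_ne_zero (holeRadius_pos hn h1 h2)
    (holeRadius_period hev), nondegenerate_holePolygon hn hev h1 h3, dist_holePolygon hn hev, ?_⟩
  rw [region_holePolygon hn hev h1 h2]
  exact not_convex_holeRegion hn hev h1 h2 h3 he

end

lemma cos_odd_mul_le (hn : 3 ≤ n) (l : ℤ) :
    Real.cos ((2 * l + 1) * (Real.pi / n)) ≤ Real.cos (Real.pi / n) := by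
  have hn0 : (0 : ℝ) < n := by positivity
  have hn0' : (0 : ℤ) < n := by positivity
  have hpi := Real.pi_pos
  -- it suffices to treat the representative of `l` modulo `n`
  have key : ∀ l : ℤ, 0 ≤ l → l < n →
      Real.cos ((2 * l + 1) * (Real.pi / n)) ≤ Real.cos (Real.pi / n) := by
    intro l h0 h1
    have h0' : (0 : ℝ) ≤ l := by exact_mod_cast h0
    have h1' : (l : ℝ) + 1 ≤ n := by exact_mod_cast h1
    have hx : (n : ℝ) * (Real.pi / n) = Real.pi := by field_simp
    have hx0 : 0 < Real.pi / n := by positivity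
    set x := Real.pi / n
    by_cases h : (2 * l + 1) * x ≤ Real.pi
    · exact Real.cos_le_cos_of_nonneg_of_le_pi hx0.le h (by nlinarith)
    · rw [← Real.cos_two_pi_sub]
      exact Real.cos_le_cos_of_nonneg_of_le_pi hx0.le (by linarith) (by nlinarith)
  have h1 := key (l % n) (Int.emod_nonneg _ hn0'.ne') (Int.emod_lt_of_pos _ hn0')
  have h2 : (l : ℝ) = ((l % n : ℤ) : ℝ) + n * ((l / n : ℤ) : ℝ) := by
    exact_mod_cast (Int.emod_add_mul_ediv l n).symm
  have h3 : (2 * (l : ℝ) + 1) * (Real.pi / n) =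
      (2 * ((l % n : ℤ) : ℝ) + 1) * (Real.pi / n) + ((l / n : ℤ) : ℝ) * (2 * Real.pi) := by
    rw [h2]; field_simp; ring
  rw [h3, Real.cos_add_int_mul_two_pi]
  exact h1

/-- The `n`-gon lies on one side of each of its edges. -/
lemma re_conj_edgeDir_mul_le (hn : 3 ≤ n) (h1 : 0 < τ.re) (k i : ℤ) :
    (conj (edgeDir n k) * pt n τ i 0 0).re ≤
      τ.re * Real.cos (Real.pi / n) / Real.sin (Real.pi / n) := by
  have hs := sin_pi_div_pos hn
  rw [← holeVertex_even (e := 0) hn, holeVertex, starVertex, holeRadius_two_mul, edgeDir]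
  have e1 : conj (holeDir n * unitDir (2 * n) (2 * k + 1)) * (holeDir n *
      (((τ.re / Real.sin (Real.pi / n) : ℝ) : ℂ) * unitDir (2 * n) (2 * i))) =
      ((τ.re / Real.sin (Real.pi / n) : ℝ) : ℂ) * unitDir (2 * n) (2 * (i - k - 1) + 1) := by
    have h3 : holeDir n * conj (holeDir n) = 1 := by
      rw [mul_conj, normSq_eq_norm_sq]; simp [holeDir, norm_unitDir]
    have h4 : unitDir (2 * n) (2 * (i - k - 1) + 1) =
        unitDir (2 * n) (2 * i) * conj (unitDir (2 * n) (2 * k + 1)) := by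
      rw [conj_unitDir, ← unitDir_add]; congr 1; ring
    rw [h4, map_mul]
    linear_combination (((τ.re / Real.sin (Real.pi / n) : ℝ) : ℂ) * unitDir (2 * n) (2 * i) *
      conj (unitDir (2 * n) (2 * k + 1))) * h3
  rw [e1, re_ofReal_mul, unitDir_re, mul_div_right_comm τ.re]
  refine mul_le_mul_of_nonneg_left ?_ (div_pos h1 hs).le
  refine le_trans (le_of_eq ?_) (cos_odd_mul_le hn (i - k - 1))
  congr 1
  have hn0 : (n : ℝ) ≠ 0 := by positivity
  push_cast; field_simp

lemma unitDir_half {m : ℕ} (hm : m ≠ 0) : unitDir (2 * m) m = -1 := by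
  have : (m : ℝ) ≠ 0 := by positivity
  rw [unitDir, show (2 * Real.pi * ((m : ℤ) : ℝ) / ((2 * m : ℕ) : ℝ)) = Real.pi by
    push_cast; field_simp, Complex.exp_pi_mul_I]

lemma cr_pt_pos (hn : 3 ≤ n) (h1 : 0 < τ.re) (k : ℤ) :
    0 < cr 0 (pt n τ k 0 0) (pt n τ (k + 1) 0 0) := by
  have e : pt n τ (k + 1) 0 0 = unitDir n 1 * pt n τ k 0 0 := by
    rw [pt_eq_mul, pt_eq_mul k, unitDir_add]; ring
  have hp : pt n τ k 0 0 ≠ 0 := by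
    simp only [pt, latticePoint, ngonVertex]
    have := unitDir_ne_zero n k
    have := sub_ne_zero.2 (unitDir_one_ne_one hn)
    have : (τ.re : ℂ) ≠ 0 := by exact_mod_cast h1.ne'
    simp [*]
  have e2 : conj (pt n τ k 0 0) * (unitDir n 1 * pt n τ k 0 0) =
      (normSq (pt n τ k 0 0) : ℝ) * unitDir n 1 := by
    rw [← mul_conj]; ring
  rw [e, cr, sub_zero, sub_zero, e2, im_ofReal_mul]
  exact mul_pos (normSq_pos.2 hp) (unitDir_one_im_pos hn)

lemma isAlternating_holePolygon (hn : 4 ≤ n) (hev : Even n) (h1 : 0 < τ.re) (h2 : 0 < (τ ^ 2).re)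
    (h3 : τ.im ≠ 0) (he : chir e 0 0 0 = decide (0 < τ.im)) :
    IsAlternating n (2 * τ.re) (holePolygon n τ e) := by
  have hn3 : 3 ≤ n := by omega
  have hpt : ∀ k : ℤ, ngonVertex n (2 * τ.re) k = pt n τ k 0 0 := by
    intro k; simp [pt, latticePoint]
  simp only [IsAlternating, hpt]
  intro k
  have hr := holeRadius_pos (e := e) hn h1 h2 (2 * (k.val : ℤ) + 1)
  have hr' := holeRadius_odd (n := n) he (k.val : ℤ)
  have hodd : holePolygon n τ e ⟨2 * k.val + 1, by omega⟩ =
      holeRadius n τ e (2 * (k.val : ℤ) + 1) * edgeDir n (k.val : ℤ) := by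
    rw [holePolygon_apply, ← holeVertex_odd_eq]; push_cast; rfl
  have hmid := pt_add_pt (τ := τ) hn3 (k.val : ℤ)
  have hD := re_conj_edgeDir_mul_le (τ := τ) hn3 h1 (k.val : ℤ)
  have hA : 0 < τ.re * Real.cos (Real.pi / n) / Real.sin (Real.pi / n) := by
    have := re_le_apothem hn h1; linarith
  set A := τ.re * Real.cos (Real.pi / n) / Real.sin (Real.pi / n)
  set r := holeRadius n τ e (2 * (k.val : ℤ) + 1)
  have habs : 0 < |τ.im| := abs_pos.2 h3
  refine ⟨?_, fun hk => ?_, fun hk => ?_⟩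
  · rw [holePolygon_apply, ← holeVertex_even (e := e) hn3]; push_cast; rfl
  · rw [if_pos (by simpa using hk)] at hr'
    have hsub : tri 0 (pt n τ k.val 0 0) (pt n τ (k.val + 1) 0 0) ⊆
        convexHull ℝ (range fun i : ℤ => pt n τ i 0 0) := by
      refine convexHull_min ?_ (convex_convexHull _ _)
      have hr : ∀ i : ℤ, pt n τ i 0 0 ∈ convexHull ℝ (range fun i : ℤ => pt n τ i 0 0) :=
        fun i => subset_convexHull _ _ ⟨i, rfl⟩
      rintro z hz
      rcases hz with rfl | rfl | rfl
      · -- the centre is the midpoint of two opposite vertices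
        obtain ⟨m, hm⟩ := hev
        have e1 : pt n τ m 0 0 = -pt n τ 0 0 0 := by
          have h4 := unitDir_half (m := m) (by omega)
          rw [two_mul, ← hm] at h4
          rw [pt_eq_mul, h4]; ring
        have := (convex_convexHull ℝ (range fun i : ℤ => pt n τ i 0 0)) (hr m) (hr 0)
          (by norm_num : (0 : ℝ) ≤ 1 / 2) (by norm_num : (0 : ℝ) ≤ 1 / 2) (by norm_num)
        rw [e1, ← smul_add] at this
        simpa using this
      · exact hr _
      · exact hr _
    refine interior_mono hsub ?_
    refine mem_interior_tri_of_coords (cr_pt_pos hn3 h1 k.val) (x := 1 - r / A) (y := r / (2 * A))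
      (w := r / (2 * A)) ?_ (by positivity) (by positivity) (by field_simp; ring) ?_
    · rw [sub_pos, div_lt_one hA]; linarith
    · have : (A : ℂ) ≠ 0 := by exact_mod_cast hA.ne'
      rw [hodd, mul_zero, zero_add, ← mul_add, hmid]
      push_cast
      field_simp
  · rw [if_neg (by simpa using hk)] at hr'
    intro hmem
    have hsub : convexHull ℝ (range fun i : ℤ => pt n τ i 0 0) ⊆
        {z | (conj (edgeDir n k.val) * z).re ≤ A} := by
      refine convexHull_min ?_ ?_
      · rintro _ ⟨i, rfl⟩; exact hD i
      · refine convex_halfSpace_le ⟨fun x y => by rw [mul_add, add_re], fun c x => ?_⟩ A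
        simp only [real_smul, mul_left_comm, re_ofReal_mul, smul_eq_mul]
    have h4 := hsub hmem
    have h5 : edgeDir n (k.val : ℤ) * conj (edgeDir n (k.val : ℤ)) = 1 := by
      rw [mul_conj, normSq_eq_norm_sq, norm_edgeDir]; simp
    rw [hodd, mem_ofPred_eq, show conj (edgeDir n (k.val : ℤ)) * (r * edgeDir n (k.val : ℤ)) =
      r * (edgeDir n (k.val : ℤ) * conj (edgeDir n (k.val : ℤ))) by ring, h5, mul_one,
      ofReal_re] at h4
    linarith

end

/-! ### Overlapping cones -/

/-- Points near the apex `v` in directions strictly between those of `x` and `y` are interior points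
of the triangle. -/
lemma eventually_mem_interior_tri {v x y w : ℂ} (h : 0 < cr v x y) (hx : 0 < cr v x (v + w))
    (hy : 0 < cr v (v + w) y) : ∀ᶠ ε : ℝ in nhdsWithin 0 (Ioi 0), v + ε * w ∈ interior (tri v x y) := by
  have hcont : Continuous fun ε : ℝ => cr x y (v + ε * w) :=
    (continuous_cr x y).comp (by fun_prop)
  have h0 : 0 < cr x y (v + (0 : ℝ) * w) := by
    rw [ofReal_zero, zero_mul, add_zero, cr_rotate]; exact h
  have h1 : ∀ᶠ ε : ℝ in nhdsWithin 0 (Ioi 0), 0 < cr x y (v + ε * w) :=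
    (hcont.continuousAt.eventually (lt_mem_nhds h0)).filter_mono nhdsWithin_le_nhds
  filter_upwards [h1, self_mem_nhdsWithin] with ε hε hpos
  have hpos' : (0 : ℝ) < ε := hpos
  refine mem_interior_tri ?_ ?_ ?_
  · have : cr v x (v + ε * w) = ε * cr v x (v + w) := by simp [cr_def]; ring
    rw [this]; positivity
  · exact hε
  · have : cr y v (v + ε * w) = ε * cr v (v + w) y := by simp [cr_def]; ring
    rw [this]; positivity

lemma interior_inter_nonempty_of_cones {T T' : Set ℂ} {v x y x' y' w : ℂ} (hT : tri v x y ⊆ T)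
    (hT' : tri v x' y' ⊆ T') (h : 0 < cr v x y) (h' : 0 < cr v x' y') (hx : 0 < cr v x (v + w))
    (hy : 0 < cr v (v + w) y) (hx' : 0 < cr v x' (v + w)) (hy' : 0 < cr v (v + w) y') :
    (interior T ∩ interior T').Nonempty := by
  obtain ⟨ε, h1, h2⟩ := ((eventually_mem_interior_tri h hx hy).and
    (eventually_mem_interior_tri h' hx' hy')).exists
  exact ⟨_, interior_mono hT h1, interior_mono hT' h2⟩

/-- Two triangles on the same side of a common edge overlap. -/
lemma interior_inter_nonempty_of_common_edge {T T' : Set ℂ} {v x y y' : ℂ} (hT : tri v x y ⊆ T)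
    (hT' : tri v x y' ⊆ T') (h : 0 < cr v x y) (h' : 0 < cr v x y') :
    (interior T ∩ interior T').Nonempty := by
  have key : ∀ y, 0 < cr v x y →
      ∀ᶠ ε : ℝ in nhdsWithin 0 (Ioi 0), 0 < cr v (v + (x - v) * (1 + ε * I)) y := by
    intro y hy
    have hcont : Continuous fun ε : ℝ => cr v (v + (x - v) * (1 + ε * I)) y := by
      unfold cr; fun_prop
    have h0 : 0 < cr v (v + (x - v) * (1 + (0 : ℝ) * I)) y := by simpa using hy
    exact (hcont.continuousAt.eventually (lt_mem_nhds h0)).filter_mono nhdsWithin_le_nhds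
  obtain ⟨ε, ⟨h1, h2⟩, h3⟩ := (((key y h).and (key y' h')).and self_mem_nhdsWithin).exists
  have h3' : (0 : ℝ) < ε := h3
  have hne : v ≠ x := (ne_of_cr_pos h).1
  have h4 : 0 < cr v x (v + (x - v) * (1 + ε * I)) := by
    have : cr v x (v + (x - v) * (1 + ε * I)) = ε * normSq (x - v) := by
      simp [cr_def, normSq_apply]; ring
    rw [this]
    exact mul_pos h3' (normSq_pos.2 (sub_ne_zero.2 hne.symm))
  exact interior_inter_nonempty_of_cones hT hT' h h' h4 h1 h4 h2

/-! ### Symmetries of the hole and of the tiling -/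

section
variable {n : ℕ} {τ : ℂ} {e : ℤ}

lemma holeVertex_add_four_mul (hn : 3 ≤ n) (i l : ℤ) :
    holeVertex n τ e (i + 4 * l) = unitDir n (2 * l) * holeVertex n τ e i := by
  have h1 : unitDir (2 * n) (i + 4 * l) = unitDir (2 * n) i * unitDir n (2 * l) := by
    rw [unitDir_add, show 4 * l = 2 * (2 * l) by ring, unitDir_two_mul hn]
  have h2 : holeRadius n τ e (i + 4 * l) = holeRadius n τ e i := by
    have e1 : (i + 4 * l) / 2 = i / 2 + 2 * l := by omega
    simp only [holeRadius, e1, chir]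
    simp [Int.even_add, show Even (4 * l) from ⟨2 * l, by ring⟩]
  rw [holeVertex, starVertex, starVertex, h1, h2]; ring

lemma neg_conj_holeVertex (i : ℤ) : -conj (holeVertex n τ e i) = holeVertex n τ e (2 - i) := by
  have h2 : holeRadius n τ e (2 - i) = holeRadius n τ e i := by
    rcases Int.even_or_odd' i with ⟨k, rfl | rfl⟩
    · rw [show 2 - 2 * k = 2 * (1 - k) by ring, holeRadius_two_mul, holeRadius_two_mul]
    · have e1 : (2 - (2 * k + 1)) / 2 = -k := by omega
      have e2 : (2 * k + 1) / 2 = k := by omega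
      have e3 : ¬ Even (2 - (2 * k + 1)) := by rw [Int.not_even_iff_odd]; exact ⟨-k, by ring⟩
      simp only [holeRadius, e1, e2, chir, if_neg e3]
      simp [Int.even_add]
  simp only [holeVertex, starVertex, holeDir, h2, map_mul, map_neg, conj_I, conj_ofReal, conj_unitDir]
  have : unitDir (2 * n) (2 - i) = unitDir (2 * n) (- -1) * unitDir (2 * n) (-i) * unitDir (2 * n) 1 := by
    rw [← unitDir_add, ← unitDir_add]; congr 1; ring
  have h3 : unitDir (2 * n) (-1) * unitDir (2 * n) 1 = 1 := by
    rw [← unitDir_add]; exact unitDir_zero _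
  rw [this]
  linear_combination (-I * unitDir (2 * n) (- -1) * holeRadius n τ e i * unitDir (2 * n) (-i)) * (-h3)

lemma rotation_mem_starSet (hn : 3 ≤ n) {C : ℝ → Prop} {z : ℂ}
    (hz : z ∈ starSet (2 * n) (holeDir n) (holeRadius n τ e) C) (l : ℤ) :
    unitDir n (2 * l) * z ∈ starSet (2 * n) (holeDir n) (holeRadius n τ e) C := by
  obtain ⟨j, a, b, ha, hb, hC, rfl⟩ := hz
  refine ⟨j + 4 * l, a, b, ha, hb, hC, ?_⟩
  have h1 := holeVertex_add_four_mul (τ := τ) (e := e) hn j l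
  have h2 := holeVertex_add_four_mul (τ := τ) (e := e) hn (j + 1) l
  rw [add_right_comm] at h2
  simp only [holeVertex] at h1 h2
  rw [h1, h2]; ring

lemma reflection_mem_starSet {C : ℝ → Prop} {z : ℂ}
    (hz : z ∈ starSet (2 * n) (holeDir n) (holeRadius n τ e) C) :
    -conj z ∈ starSet (2 * n) (holeDir n) (holeRadius n τ e) C := by
  obtain ⟨j, a, b, ha, hb, hC, rfl⟩ := hz
  refine ⟨1 - j, b, a, hb, ha, by rwa [add_comm], ?_⟩
  have h1 := neg_conj_holeVertex (n := n) (τ := τ) (e := e) j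
  have h2 := neg_conj_holeVertex (n := n) (τ := τ) (e := e) (j + 1)
  rw [show 2 - (j + 1) = 1 - j by ring] at h2
  rw [show 1 - j + 1 = 2 - j by ring]
  simp only [holeVertex] at h1 h2
  rw [← h1, ← h2]
  simp

lemma unitDir_two_ne_one (hn : 3 ≤ n) : unitDir n 2 ≠ 1 := by
  intro h
  have h1 := unitDir_one_im_pos hn
  rw [show (2 : ℤ) = 1 + 1 by rfl, unitDir_add] at h
  rcases mul_self_eq_one_iff.1 h with h | h <;> rw [h] at h1 <;> simp at h1

lemma half_mul_period (hev : Even n) (hn : 3 ≤ n) (j : ℤ) : unitDir (n / 2) j = unitDir n (2 * j) := by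
  obtain ⟨m, rfl⟩ := hev
  rw [← two_mul, Nat.mul_div_cancel_left m two_pos]
  have : (m : ℝ) ≠ 0 := by have : m ≠ 0 := by omega
                           exact_mod_cast this
  rw [unitDir, unitDir]; congr 2; push_cast; field_simp

section
variable (hn : 4 ≤ n) (h1 : 0 < τ.re) (h2 : 0 < (τ ^ 2).re) (h3 : τ.im ≠ 0)
  (he : chir e 0 0 0 = decide (0 < τ.im))
include hn h1 h2 h3 he

/-- The points of the exterior of the hole that are nearest to the centre are the inner apices. -/
lemma norm_le_of_mem_holeExterior {z : ℂ} (hz : z ∈ holeExterior n τ e) :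
    holeRadius n τ e 1 ≤ ‖z‖ ∧
      (‖z‖ = holeRadius n τ e 1 → ∃ l : ℤ, z = holeVertex n τ e (1 + 4 * l)) := by
  have hn3 : 3 ≤ n := by omega
  have hs := sin_pi_div_pos hn3
  have habs : 0 < |τ.im| := abs_pos.2 h3
  have hρ := holeRadius_pos (e := e) hn h1 h2 1
  have hr := fun k => holeRadius_odd (n := n) he k
  have hr0 := hr 0
  rw [if_pos (by simp), mul_zero, zero_add] at hr0
  set A := τ.re * Real.cos (Real.pi / n) / Real.sin (Real.pi / n) with hA
  set ρ := holeRadius n τ e 1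
  have hD : ∀ k : ℤ, edgeDir n k * conj (edgeDir n k) = 1 := by
    intro k; rw [mul_conj, normSq_eq_norm_sq, norm_edgeDir]; simp
  have hu := re_unitDir_two_one hn3
  have hQ : ∀ k : ℤ, (conj (edgeDir n k) * holeVertex n τ e (2 * k)).re = A ∧
      (conj (edgeDir n k) * holeVertex n τ e (2 * k + 1 + 1)).re = A := by
    intro k
    have hd : holeDir n * conj (holeDir n) = 1 := by
      rw [mul_conj, normSq_eq_norm_sq]; simp [holeDir, norm_unitDir]
    have hg : ∀ i : ℤ, (conj (edgeDir n k) * holeVertex n τ e (2 * i)) =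
        ((τ.re / Real.sin (Real.pi / n) : ℝ) : ℂ) * unitDir (2 * n) (2 * i - (2 * k + 1)) := by
      intro i
      have : unitDir (2 * n) (2 * i - (2 * k + 1)) =
          conj (unitDir (2 * n) (2 * k + 1)) * unitDir (2 * n) (2 * i) := by
        rw [conj_unitDir, ← unitDir_add]; congr 1; ring
      rw [this, edgeDir, holeVertex, starVertex, holeRadius_two_mul, map_mul]
      linear_combination (conj (unitDir (2 * n) (2 * k + 1)) *
        ((τ.re / Real.sin (Real.pi / n) : ℝ) : ℂ) * unitDir (2 * n) (2 * i)) * hd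
    constructor
    · rw [hg, show 2 * k - (2 * k + 1) = -1 by ring, ← conj_unitDir, re_ofReal_mul, conj_re, hu, hA]
      ring
    · rw [show 2 * k + 1 + 1 = 2 * (k + 1) by ring, hg,
        show 2 * (k + 1) - (2 * k + 1) = 1 by ring, re_ofReal_mul, hu, hA]
      ring
  have hM : ∀ k : ℤ, (conj (edgeDir n k) * holeVertex n τ e (2 * k + 1)).re =
      holeRadius n τ e (2 * k + 1) := by
    intro k
    rw [holeVertex_odd_eq, show ∀ a b c : ℂ, a * (b * c) = b * (c * a) by intros; ring, hD, mul_one,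
      ofReal_re]
  have key : ∀ (k : ℤ) (a b : ℝ), 0 ≤ a → 0 ≤ b → 1 ≤ a + b → ∀ Q : ℂ,
      (conj (edgeDir n k) * Q).re = A → ∀ z, z = a * Q + b * holeVertex n τ e (2 * k + 1) →
      ρ ≤ ‖z‖ ∧ (‖z‖ = ρ → ∃ l : ℤ, z = holeVertex n τ e (1 + 4 * l)) := by
    intro k a b ha hb hab Q hQ z hz
    have e1 : (conj (edgeDir n k) * z).re = a * A + b * holeRadius n τ e (2 * k + 1) := by
      rw [← hM k, ← hQ, hz, ← re_ofReal_mul, ← re_ofReal_mul, ← add_re]; congr 1; ring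
    have e2 : (conj (edgeDir n k) * z).re ≤ ‖z‖ := by
      have := Complex.re_le_norm (conj (edgeDir n k) * z)
      rwa [norm_mul, RCLike.norm_conj, norm_edgeDir, one_mul] at this
    have hrk := hr k
    have hrk' : ρ ≤ holeRadius n τ e (2 * k + 1) := by
      rw [hrk, hr0]; split_ifs <;> linarith
    have e3 : 0 ≤ a * (A - ρ) := mul_nonneg ha (by linarith)
    have e4 : 0 ≤ b * (holeRadius n τ e (2 * k + 1) - ρ) := mul_nonneg hb (by linarith)
    have e5 : 0 ≤ (a + b - 1) * ρ := mul_nonneg (by linarith) hρ.le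
    have e6 : (a * A + b * holeRadius n τ e (2 * k + 1)) =
        a * (A - ρ) + b * (holeRadius n τ e (2 * k + 1) - ρ) + (a + b - 1) * ρ + ρ := by ring
    refine ⟨by linarith, fun heq => ?_⟩
    have f1 : a * (A - ρ) = 0 := by linarith
    have f2 : b * (holeRadius n τ e (2 * k + 1) - ρ) = 0 := by linarith
    have f3 : (a + b - 1) * ρ = 0 := by linarith
    have g1 : a = 0 := by
      rcases mul_eq_zero.1 f1 with h | h
      · exact h
      · linarith
    have g3 : b = 1 := by
      rcases mul_eq_zero.1 f3 with h | h <;> linarith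
    rw [g3, one_mul, hrk, hr0] at f2
    have hk : Even k := by
      by_contra hk
      rw [if_neg hk] at f2
      linarith
    obtain ⟨l, rfl⟩ := hk
    refine ⟨l, ?_⟩
    rw [hz, g1, g3, show 2 * (l + l) + 1 = 1 + 4 * l by ring]; simp
  obtain ⟨j, a, b, ha, hb, hab, hz⟩ := hz
  rcases Int.even_or_odd' j with ⟨k, rfl | rfl⟩
  · exact key k a b ha hb hab _ (hQ k).1 z hz
  · exact key k b a hb ha (by linarith) _ (hQ k).2 z (by rw [hz, add_comm]; rfl)

/-- An isometry that preserves the exterior of the hole is one of the rotations or reflections of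
the alternating polygon. -/
lemma isometry_cases_of_image_holeExterior (hev : Even n) (f : ℂ ≃ᵢ ℂ)
    (hf : f '' holeExterior n τ e = holeExterior n τ e) :
    (∃ l : ℤ, ∀ z, f z = unitDir n (2 * l) * z) ∨
      (∃ l : ℤ, ∀ z, f z = -unitDir n (2 * l) * conj z) := by
  have hn3 : 3 ≤ n := by omega
  have hf' : f '' (holeExterior n τ e)ᶜ = (holeExterior n τ e)ᶜ := by
    rw [image_compl_eq f.bijective, hf]
  have hrot : ∀ l : ℤ, ∀ z ∈ (holeExterior n τ e)ᶜ, unitDir n (2 * l) * z ∈ (holeExterior n τ e)ᶜ := by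
    intro l z hz hz'
    apply hz
    have := rotation_mem_starSet hn3 hz' (-l)
    rwa [← mul_assoc, ← unitDir_add, show 2 * -l + 2 * l = 0 by ring, unitDir_zero, one_mul] at this
  have hr1 := holeRadius_pos (e := e) hn h1 h2 1
  have h0 : f 0 = 0 := by
    refine map_zero_of_rotation_invariant (U := (holeExterior n τ e)ᶜ) (q := unitDir n 2) ?_ ?_
      (unitDir_two_ne_one hn3) (norm_unitDir _ _) ?_ ?_ f hf'
    · exact (isCompact_starSet (by omega) (holeRadius_period hev)).isBounded.subset
        (holeExterior_compl_subset hn hev h1 h2)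
    · refine ⟨0, fun h => ?_⟩
      have := (norm_le_of_mem_holeExterior hn h1 h2 h3 he h).1
      rw [norm_zero] at this
      linarith
    · have := hrot 1
      rwa [mul_one] at this
    · have := hrot (-1)
      rwa [mul_neg, mul_one, ← conj_unitDir] at this
  have hM : holeVertex n τ e 1 ∈ holeExterior n τ e :=
    ⟨1, 1, 0, zero_le_one, le_rfl, by norm_num, by simp [holeVertex]⟩
  have hfM : f (holeVertex n τ e 1) ∈ holeExterior n τ e := hf ▸ mem_image_of_mem f hM
  have hnM : ‖holeVertex n τ e 1‖ = holeRadius n τ e 1 := by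
    have := holeVertex_odd_eq (n := n) (τ := τ) (e := e) 0
    rw [mul_zero, zero_add] at this
    rw [this, norm_mul, norm_edgeDir, mul_one, Complex.norm_of_nonneg hr1.le]
  have hM0 : holeVertex n τ e 1 ≠ 0 := by
    rw [← norm_pos_iff, hnM]; exact hr1
  have hnfM : ‖f (holeVertex n τ e 1)‖ = holeRadius n τ e 1 := by
    rw [← hnM, ← dist_zero_right, ← dist_zero_right]
    nth_rewrite 1 [← h0]
    exact f.dist_eq _ _
  obtain ⟨l, hl⟩ := (norm_le_of_mem_holeExterior hn h1 h2 h3 he hfM).2 hnfM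
  rw [holeVertex_add_four_mul hn3] at hl
  obtain ⟨a, b, -, hab | hab⟩ := isometry_cases f
  · have hb : b = 0 := by simpa [h0] using (hab 0).symm
    rw [hab, hb, add_zero] at hl
    refine Or.inl ⟨l, fun z => ?_⟩
    rw [hab, hb, mul_right_cancel₀ hM0 hl, add_zero]
  · have hb : b = 0 := by simpa [h0] using (hab 0).symm
    have h4 := neg_conj_holeVertex (n := n) (τ := τ) (e := e) 1
    rw [show (2 : ℤ) - 1 = 1 by rfl] at h4
    rw [hab, hb, add_zero, ← neg_neg (conj _), h4] at hl
    refine Or.inr ⟨l, fun z => ?_⟩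
    have h5 : -a = unitDir n (2 * l) := mul_right_cancel₀ hM0 (by rw [← hl]; ring)
    rw [hab, hb, ← h5, add_zero, neg_neg]

lemma isDihedral_holePolygon (hev : Even n) :
    IsDihedral (n / 2) (setSymmetries (region (holePolygon n τ e))) := by
  have hn3 : 3 ≤ n := by omega
  refine ⟨-1, by simp, ?_⟩
  rw [region_holePolygon hn hev h1 h2]
  have hinv : ∀ l : ℤ, unitDir n (2 * l) * unitDir n (2 * -l) = 1 := by
    intro l; rw [← unitDir_add, show 2 * l + 2 * -l = 0 by ring, unitDir_zero]
  ext f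
  simp only [setSymmetries, mem_ofPred_eq, mem_union, rotations, half_mul_period hev hn3]
  constructor
  · intro hf
    have hf' : f '' holeExterior n τ e = holeExterior n τ e := by
      have := f.toHomeomorph.image_closure (holeRegion n τ e)ᶜ
      rw [IsometryEquiv.coe_toHomeomorph, image_compl_eq f.bijective, hf,
        closure_compl_holeRegion hn hev h1 h2] at this
      exact this
    rcases isometry_cases_of_image_holeExterior hn h1 h2 h3 he hev f hf' with h | ⟨l, hl⟩
    · exact Or.inl h
    · exact Or.inr ⟨l, fun z => by rw [hl]; ring⟩
  · rintro (⟨l, hl⟩ | ⟨l, hl⟩)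
    · apply Subset.antisymm
      · rintro _ ⟨z, hz, rfl⟩
        rw [hl]; exact rotation_mem_starSet hn3 hz l
      · intro z hz
        exact ⟨unitDir n (2 * -l) * z, rotation_mem_starSet hn3 hz (-l), by
          rw [hl, ← mul_assoc, hinv, one_mul]⟩
    · have hmem : ∀ z ∈ holeRegion n τ e, f z ∈ holeRegion n τ e := by
        intro z hz
        have := rotation_mem_starSet hn3 (reflection_mem_starSet hz) l
        rw [hl, show -1 * unitDir n (2 * l) * conj z = unitDir n (2 * l) * -conj z by ring]
        exact this
      have hff : ∀ z, f (f z) = z := by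
        intro z
        have := unitDir_mul_conj n (2 * l)
        rw [hl, hl]; simp only [map_mul, map_neg, map_one, conj_conj]
        linear_combination z * this
      apply Subset.antisymm
      · rintro _ ⟨z, hz, rfl⟩; exact hmem z hz
      · intro z hz; exact ⟨f z, hmem z hz, hff z⟩

end

/-- A rotation by an even number of sectors preserves the chiralities and therefore permutes the
tiles. -/
lemma placed_rotate (e k : ℤ) (i j : ℕ) (c : Bool) (l : ℤ) (z : ℂ) :
    unitDir n (2 * l) * placed n τ e k i j c z = placed n τ e (k + 2 * l) i j c z := by
  have hc : chir e (k + 2 * l) i j = chir e k i j := by simp [chir, Int.even_add]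
  have hp : pt n τ (k + 2 * l) i j = unitDir n (2 * l) * pt n τ k i j := by
    rw [pt_eq_mul, pt_eq_mul k, unitDir_add]; ring
  have key : ∀ (d : Bool) (w : ℂ), unitDir n (2 * l) * place n τ d k (pt n τ k i j) w =
      place n τ d (k + 2 * l) (pt n τ (k + 2 * l) i j) w := by
    intro d w
    rw [hp]
    cases d
    · rw [place_false_apply, place_false_apply, unitDir_add]; ring
    · rw [place_true_apply, place_true_apply, add_sub_right_comm, unitDir_add _ (k - 1)]; ring
  cases c
  · simp only [placed, IsometryEquiv.trans_apply, hc, key]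
  · simp only [placed, hc, key]

lemma placed_emod (hn : 3 ≤ n) (hev : Even n) (e k : ℤ) (i j : ℕ) (c : Bool) (z : ℂ) :
    placed n τ e (k % n) i j c z = placed n τ e k i j c z := by
  obtain ⟨m, hm⟩ : ∃ m, k = k % n + n * m := ⟨k / n, (Int.emod_add_mul_ediv k n).symm⟩
  obtain ⟨d, hd⟩ := hev
  have h2 : (n : ℤ) * m = 2 * (d * m) := by rw [hd]; push_cast; ring
  conv_rhs => rw [hm, h2, ← placed_rotate, ← h2, unitDir_mul_period (by omega), one_mul]

lemma image_tile_of_rotation (hn : 3 ≤ n) (hev : Even n) {f : ℂ ≃ᵢ ℂ} {l : ℤ}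
    (hf : ∀ z, f z = unitDir n (2 * l) * z) (x : TileIndex n) :
    ∃ y, f '' tile n τ e x = tile n τ e y := by
  obtain ⟨⟨k, i, j⟩, c⟩ := x
  have hn0 : (0 : ℤ) < n := by omega
  have h0 := Int.emod_nonneg (k.val + 2 * l) hn0.ne'
  have h1 := Int.emod_lt_of_pos (k.val + 2 * l) hn0
  refine ⟨((⟨((k.val + 2 * l) % n).toNat, by omega⟩, i, j), c), ?_⟩
  rw [tile, tile, ← image_comp]
  refine image_congr' fun z => ?_
  simp only [Function.comp, hf, tileIso, placed_rotate]
  rw [Int.toNat_of_nonneg h0, placed_emod hn hev]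

lemma rotation_mem_tilingSymmetries (hn : 3 ≤ n) (hev : Even n) {f : ℂ ≃ᵢ ℂ} {l : ℤ}
    (hf : ∀ z, f z = unitDir n (2 * l) * z) : f ∈ tilingSymmetries (range (tile n τ e)) := by
  have hinv : unitDir n (2 * l) * unitDir n (2 * -l) = 1 := by
    rw [← unitDir_add, show 2 * l + 2 * -l = 0 by ring, unitDir_zero]
  have hsymm : ∀ z, f.symm z = unitDir n (2 * -l) * z := by
    intro z
    rw [IsometryEquiv.symm_apply_eq, hf, ← mul_assoc, hinv, one_mul]
  apply Subset.antisymm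
  · rintro _ ⟨_, ⟨x, rfl⟩, rfl⟩
    obtain ⟨y, hy⟩ := image_tile_of_rotation (τ := τ) (e := e) hn hev hf x
    exact ⟨y, hy.symm⟩
  · rintro _ ⟨x, rfl⟩
    obtain ⟨y, hy⟩ := image_tile_of_rotation (τ := τ) (e := e) hn hev hsymm x
    refine ⟨tile n τ e y, ⟨y, rfl⟩, ?_⟩
    show f '' tile n τ e y = _
    rw [← hy, ← image_comp]
    simp

lemma image_holeExterior_of_mem (hn : 4 ≤ n) (hev : Even n) (h1 : 0 < τ.re) (h2 : 0 < (τ ^ 2).re)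
    {f : ℂ ≃ᵢ ℂ} (hf : f ∈ tilingSymmetries (range (tile n τ e))) :
    f '' holeExterior n τ e = holeExterior n τ e := by
  rw [← iUnion_tile hn hev h1 h2, ← sUnion_range, image_sUnion]
  exact congrArg sUnion hf

/-- If the reflection in the axis of an inner bent edge permuted the tiles, then it would carry the
first pentagon of the rhombus at this edge to the second one, since both the image and the second
pentagon lie on the same side of a common edge. Composed with the half-turn that exchanges the two
pentagons it would be a glide reflection that preserves a bounded set. -/
lemma re_unitDir_one_eq_zero_of_reflection (hn : 4 ≤ n) (hev : Even n) (h1 : 0 < τ.re)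
    (h2 : 0 < (τ ^ 2).re) {k : Fin n} (hk : chir e k.val 0 0 = true) {t : ℂ ≃ᵢ ℂ}
    (ht : ∀ z, t z = -unitDir n (2 * k.val) * conj z)
    (hmem : t ∈ tilingSymmetries (range (tile n τ e))) : (unitDir n 1).re = 0 := by
  have hn3 : 3 ≤ n := by omega
  set x : TileIndex n := ((k, 0, 0), true) with hx
  set y : TileIndex n := ((k, 0, 0), false) with hy
  set q := stdPentagon n τ with hq
  obtain ⟨f1, f2, f3⟩ := isFan_stdPentagon hn3 h2
  have hω := sub_ne_zero.2 (unitDir_one_ne_one hn3)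
  have hu := unitDir_mul_conj n k.val
  have hu1 := unitDir_mul_conj n 1
  obtain ⟨v, hv⟩ : ∃ v, v * (unitDir n 1 - 1) = 1 := ⟨(unitDir n 1 - 1)⁻¹, inv_mul_cancel₀ hω⟩
  have hv' : conj v = -1 - v := by
    have h := congrArg conj hv
    simp only [map_mul, map_sub, map_one] at h
    refine mul_right_cancel₀ (right_ne_zero_of_mul_eq_one h) (h.trans ?_)
    linear_combination v * hu1 - conj (unitDir n 1) * hv
  have hpt : pt n τ k.val 0 0 = (2 * τ.re : ℝ) * unitDir n k.val * v := by
    simp only [pt, latticePoint, ngonVertex]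
    rw [div_eq_mul_inv, eq_inv_of_mul_eq_one_left hv]
    simp
  have hU2 : unitDir n (2 * k.val) = unitDir n k.val * unitDir n k.val := by
    rw [two_mul, unitDir_add]
  have ht1 : t (pt n τ k.val 0 0) = pt n τ k.val 0 1 := by
    rw [ht, pt_succ_right, hpt, hU2]
    simp only [map_mul, conj_ofReal, hv']
    linear_combination ((2 * τ.re : ℝ) * unitDir n k.val * (1 + v)) * hu
  have ht2 : t (apex₂ n τ e k.val 0 0) = apex₂ n τ e k.val 0 0 := by
    have hL := add_conj τ
    rw [ht] at ht1 ⊢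
    rw [apex₂, hk, leg, map_add, map_mul, mul_add, ht1, pt_succ_right, ← hL, hU2]
    linear_combination (-unitDir n k.val * conj τ) * hu
  -- the image of the first pentagon of the rhombus is the second one
  have himg : t '' tile n τ e x = tile n τ e y := by
    obtain ⟨w, hw⟩ : ∃ w, t '' tile n τ e x = tile n τ e w := by
      have h : t '' tile n τ e x ∈ range (tile n τ e) := hmem ▸ mem_image_of_mem _ ⟨x, rfl⟩
      obtain ⟨w, hw⟩ := h
      exact ⟨w, hw.symm⟩
    by_contra hne
    have hwy : w ≠ y := fun h => hne (by rw [hw, h])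
    have hdis := disjoint_interior_tile (e := e) hn hev h1 h2 hwy
    rw [← hw, disjoint_iff_inter_eq_empty, ← not_nonempty_iff_eq_empty] at hdis
    apply hdis
    have vx := fun v => (placed_true (n := n) (τ := τ) e k.val 0 0).1 hk v
    have vy := fun v => (placed_false (n := n) (τ := τ) e k.val 0 0).1 hk v
    have s1 : tri (tileIso n τ e y (q 1)) (tileIso n τ e y (q 2)) (tileIso n τ e y (q 3)) ⊆
        tile n τ e y := by
      rw [tile_eq]; exact subset_union_left.trans subset_union_left
    have s2 : tri (t (tileIso n τ e x (q 1))) (t (tileIso n τ e x (q 4)))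
        (t (tileIso n τ e x (q 0))) ⊆ t '' tile n τ e x := by
      rw [← image_tri, tile_eq]; exact image_mono subset_union_right
    have c1 : 0 < cr (tileIso n τ e y (q 1)) (tileIso n τ e y (q 2)) (tileIso n τ e y (q 3)) := by
      have := cr_placed (n := n) (τ := τ) e k.val 0 0 false (q 1) (q 2) (q 3)
      rw [hk, if_pos rfl, one_mul] at this
      rw [tileIso]; exact this.trans_gt f1
    have c2 : cr (t (tileIso n τ e x (q 1))) (t (tileIso n τ e x (q 4)))
        (t (tileIso n τ e x (q 0))) < 0 := by
      have := cr_placed (n := n) (τ := τ) e k.val 0 0 true (q 1) (q 4) (q 0)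
      rw [hk, if_pos rfl, one_mul] at this
      have ht' : ∀ z, t z = reverseIso (-unitDir n (2 * k.val)) 0 (by simp [norm_unitDir]) z := by
        intro z; rw [ht]; simp
      rw [ht', ht', ht', cr_reverseIso, tileIso]
      exact neg_neg_of_pos (this.trans_gt f3)
    have p1 : tileIso n τ e y (q 2) = pt n τ k.val 0 1 := vy 2
    have p2 : tileIso n τ e y (q 3) = apex₂ n τ e k.val 0 0 := vy 3
    have p3 : tileIso n τ e x (q 0) = pt n τ k.val 0 0 := vx 0
    have p4 : tileIso n τ e x (q 4) = apex₂ n τ e k.val 0 0 := vx 4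
    rw [p1, p2] at s1 c1
    rw [p3, p4, ht1, ht2] at s2 c2
    rw [← tri_rotate] at s1
    rw [← tri_swap, ← tri_rotate] at s2
    rw [← cr_rotate] at c1
    refine interior_inter_nonempty_of_common_edge s2 s1 ?_ c1
    have : ∀ a b c : ℂ, cr c b a = -cr a b c := by intros; simp only [cr_def]; ring
    rw [this]; linarith
  -- the glide reflection
  set c := pt n τ k.val 0 0 + pt n τ k.val 1 1 with hc
  have hhalf : ∀ z, tileIso n τ e y z = c - tileIso n τ e x z := by
    intro z
    simp only [tileIso, hx, hy, placed, hk, IsometryEquiv.trans_apply, place_true_apply,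
      halfTurn_apply]
    have hL := add_conj τ
    have h5 := unitDir_sub_one_mul n k.val
    have e1 : pt n τ k.val 1 1 = pt n τ k.val 0 0 + unitDir n (k.val - 1) * (2 * τ.re : ℝ) +
        unitDir n k.val * (2 * τ.re : ℝ) := by
      rw [pt_succ_right, pt_succ_left]
    rw [hc, e1, ← hL]
    simp
    linear_combination (conj τ + τ) * h5
  have hg : ∀ z ∈ tile n τ e x, c - t z ∈ tile n τ e x := by
    intro z hz
    have h4 : t z ∈ tile n τ e y := himg ▸ mem_image_of_mem t hz
    obtain ⟨w, hw, hw'⟩ := h4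
    refine ⟨w, hw, ?_⟩
    rw [← hw', hhalf]; ring
  have htr : c + unitDir n (2 * k.val) * conj c = 0 := by
    refine eq_zero_of_translation (U := tile n τ e x)
      ((isCompact_fan _).image (tileIso n τ e x).continuous).isBounded
      ⟨_, mem_image_of_mem _ (Or.inl (Or.inl (left_mem_tri _ _ _)))⟩ fun z hz => ?_
    have := hg _ (hg z hz)
    rw [ht, ht] at this
    convert this using 1
    have hu2 := unitDir_mul_conj n (2 * k.val)
    simp only [map_sub, map_mul, map_neg, conj_conj]
    linear_combination (-z) * hu2
  -- the translation part of the square of the glide reflection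
  have e1 : pt n τ k.val 1 1 = pt n τ k.val 0 0 +
      unitDir n k.val * conj (unitDir n 1) * (2 * τ.re : ℝ) +
      unitDir n k.val * (2 * τ.re : ℝ) := by
    rw [pt_succ_right, pt_succ_left, unitDir_mul_conj_one]
  rw [hc, e1, hpt, hU2] at htr
  simp only [map_mul, map_add, conj_ofReal, conj_conj, hv'] at htr
  have h6 : ((2 * τ.re : ℝ) : ℂ) * unitDir n k.val * (unitDir n 1 + conj (unitDir n 1)) = 0 := by
    rw [← htr]
    linear_combination (-((2 * τ.re : ℝ) : ℂ) * unitDir n k.val * (unitDir n 1 - 1 - 2 * v)) * hu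
  rw [add_conj, mul_eq_zero, ofReal_eq_zero] at h6
  rcases h6 with h6 | h6
  · have : ((2 * τ.re : ℝ) : ℂ) ≠ 0 := by exact_mod_cast (mul_pos two_pos h1).ne'
    exact absurd h6 (mul_ne_zero this (unitDir_ne_zero _ _))
  · linarith

lemma unitDir_one_re_pos (hn : 5 ≤ n) : 0 < (unitDir n 1).re := by
  have hn' : (5 : ℝ) ≤ n := by exact_mod_cast hn
  have hpi := Real.pi_pos
  rw [unitDir_re]
  apply Real.cos_pos_of_mem_Ioo
  constructor
  · have : 0 < 2 * Real.pi * ((1 : ℤ) : ℝ) / n := by push_cast; positivity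
    linarith
  · rw [div_lt_iff₀ (by linarith)]; push_cast; nlinarith

section
variable (hn : 4 ≤ n) (hev : Even n) (h1 : 0 < τ.re) (h2 : 0 < (τ ^ 2).re) (h3 : τ.im ≠ 0)
  (he : chir e 0 0 0 = decide (0 < τ.im))
include hn hev h1 h2 h3 he

lemma tilingSymmetries_inter_orientationPreserving :
    tilingSymmetries (range (tile n τ e)) ∩ orientationPreserving = rotations (n / 2) := by
  have hn3 : 3 ≤ n := by omega
  ext f
  simp only [rotations, half_mul_period hev hn3]
  constructor
  · rintro ⟨hf, a, b, hab⟩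
    rcases isometry_cases_of_image_holeExterior hn h1 h2 h3 he hev f
      (image_holeExterior_of_mem hn hev h1 h2 hf) with h | ⟨l, hl⟩
    · exact h
    · exfalso
      have e0 := (hab 0).symm.trans (hl 0)
      have e1 := (hab 1).symm.trans (hl 1)
      have e2 := (hab I).symm.trans (hl I)
      simp only [mul_zero, map_zero, zero_add, map_one, mul_one, conj_I] at e0 e1 e2
      refine unitDir_ne_zero n (2 * l) ?_
      have h4 : 2 * (unitDir n (2 * l) * I) = 0 := by linear_combination -e2 + I * e1 + (1 - I) * e0
      simpa using h4
  · rintro ⟨l, hl⟩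
    exact ⟨rotation_mem_tilingSymmetries hn3 hev hl, unitDir n (2 * l), 0, fun z => by
      rw [hl, add_zero]⟩

lemma tilingSymmetries_eq (hn4 : n ≠ 4) :
    tilingSymmetries (range (tile n τ e)) = rotations (n / 2) := by
  have hn3 : 3 ≤ n := by omega
  ext f
  simp only [rotations, half_mul_period hev hn3]
  constructor
  · intro hf
    rcases isometry_cases_of_image_holeExterior hn h1 h2 h3 he hev f
      (image_holeExterior_of_mem hn hev h1 h2 hf) with h | ⟨l, hl⟩
    · exact h
    · exfalso
      obtain ⟨k, hk⟩ : ∃ k : Fin n, chir e k.val 0 0 = true := by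
        have h4 := chir_succ_sector (e := e) 0
        by_cases h : chir e 0 0 0 = true
        · exact ⟨⟨0, by omega⟩, h⟩
        · refine ⟨⟨1, by omega⟩, ?_⟩
          rw [Bool.not_eq_true] at h
          rw [h] at h4
          exact h4
      -- a rotation moves the axis of the reflection to the chosen edge
      have hr : ∀ z, directIso (unitDir n (2 * (k.val - l))) 0 (norm_unitDir _ _) z =
          unitDir n (2 * (k.val - l)) * z := by intro z; simp
      have hrm := rotation_mem_tilingSymmetries (τ := τ) (e := e) hn3 hev hr
      refine (unitDir_one_re_pos (n := n) (by obtain ⟨m, rfl⟩ := hev; omega)).ne'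
        (re_unitDir_one_eq_zero_of_reflection hn hev h1 h2 hk
          (t := f.trans (directIso (unitDir n (2 * (k.val - l))) 0 (norm_unitDir _ _))) ?_ ?_)
      · intro z
        rw [IsometryEquiv.trans_apply, hr, hl, ← mul_assoc, mul_neg, ← unitDir_add]
        congr 3; ring
      · have h5 : ∀ T : Set ℂ, f.trans (directIso (unitDir n (2 * (k.val - l))) 0
            (norm_unitDir _ _)) '' T = directIso (unitDir n (2 * (k.val - l))) 0
            (norm_unitDir _ _) '' (f '' T) := fun T => by rw [← image_comp]; rfl
        show _ '' _ = _
        simp only [h5]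
        rw [← image_image (fun T => directIso (unitDir n (2 * (k.val - l))) 0
          (norm_unitDir _ _) '' T) (fun T => f '' T)]
        rw [show (fun T => f '' T) '' range (tile n τ e) = range (tile n τ e) from hf]
        exact hrm
  · rintro ⟨l, hl⟩
    exact rotation_mem_tilingSymmetries hn3 hev hl

end

end

/-! ### Corners of tiles that do not overlap -/

section
variable {n : ℕ} {τ : ℂ}

/-- The directions of the sides at a corner are determined by the set, in the sense that no side of
one of two corners with the same apex of the same set lies strictly outside the other corner. -/
lemma Corner.cr_nonneg {T : Set ℂ} {v x y x' y' z : ℂ} (c : Corner T v x y) (c' : Corner T v x' y')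
    (h' : 0 < cr v x' y') (hz : z ∈ tri v x y) : 0 ≤ cr v x' z ∧ 0 ≤ cr v z y' := by
  obtain ⟨hsub, -⟩ := c
  obtain ⟨-, ε, hε, hc'⟩ := c'
  set t : ℝ := ε / (ε + dist z v) with ht
  have hd := dist_nonneg (x := z) (y := v)
  have ht0 : 0 < t := by positivity
  have ht1 : t ≤ 1 := by rw [ht, div_le_one (by positivity)]; linarith
  have hw : v + t * (z - v) ∈ tri v x y := by
    have := (convex_convexHull ℝ {v, x, y}).add_smul_sub_mem (left_mem_tri v x y) hz ⟨ht0.le, ht1⟩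
    rw [real_smul] at this
    exact this
  have hwd : dist (v + t * (z - v)) v < ε := by
    rw [dist_eq_norm, add_sub_cancel_left, norm_mul, Complex.norm_of_nonneg ht0.le, ← dist_eq_norm,
      ht, div_mul_eq_mul_div, div_lt_iff₀ (by positivity)]
    nlinarith
  obtain ⟨h1, -, h3⟩ := (mem_tri_iff h').1 (hc' _ (hsub hw) hwd)
  have e1 : cr v x' (v + t * (z - v)) = t * cr v x' z := by simp [cr_def]; ring
  have e2 : cr y' v (v + t * (z - v)) = t * cr v z y' := by simp [cr_def]; ring
  rw [e1] at h1
  rw [e2] at h3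
  exact ⟨nonneg_of_mul_nonneg_right h1 ht0, nonneg_of_mul_nonneg_right h3 ht0⟩

/-- If the first side `x'` of a corner of `T'` points into a corner of `T` with the same apex, then
`T` and `T'` are distinct and overlap. -/
lemma not_nonOverlapping_of_first_side {𝒯 : Set (Set ℂ)} (h𝒯 : NonOverlapping 𝒯) {T T' : Set ℂ}
    (hT : T ∈ 𝒯) (hT' : T' ∈ 𝒯) {v x y x' y' : ℂ} (c : Corner T v x y) (c' : Corner T' v x' y')
    (h : 0 < cr v x y) (h' : 0 < cr v x' y') (h1 : 0 < cr v x x') (h2 : 0 < cr v x' y) : False := by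
  have hne : T ≠ T' := by
    rintro rfl
    have := (c.cr_nonneg c' h' (mid_mem_tri v x y)).1
    have e : cr v x' x = -cr v x x' := by simp only [cr_def]; ring
    linarith
  refine disjoint_iff_inter_eq_empty.1 (h𝒯 hT hT' hne) |> not_nonempty_iff_eq_empty.2 <| ?_
  have key : ∀ {f : ℂ → ℝ}, Continuous f → 0 < f x' →
      ∀ᶠ ε : ℝ in nhdsWithin 0 (Ioi 0), 0 < f (v + (x' - v) * (1 + ε * I)) := by
    intro f hf h0
    have hcont : Continuous fun ε : ℝ => f (v + (x' - v) * (1 + ε * I)) := hf.comp (by fun_prop)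
    have h0' : 0 < f (v + (x' - v) * (1 + (0 : ℝ) * I)) := by simpa using h0
    exact (hcont.continuousAt.eventually (lt_mem_nhds h0')).filter_mono nhdsWithin_le_nhds
  have hswap : ∀ y, Continuous fun z => cr v z y := by intro y; unfold cr; fun_prop
  obtain ⟨ε, ⟨⟨e1, e2⟩, e3⟩, e4⟩ := (((key (continuous_cr v x) h1).and (key (hswap y) h2)).and
    (key (hswap y') h')).and self_mem_nhdsWithin |>.exists
  have e4' : (0 : ℝ) < ε := e4
  refine interior_inter_nonempty_of_cones c.1 c'.1 h h' e1 e2 ?_ e3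
  have : cr v x' (v + (x' - v) * (1 + ε * I)) = ε * normSq (x' - v) := by
    simp [cr_def, normSq_apply]; ring
  rw [this]
  exact mul_pos e4' (normSq_pos.2 (sub_ne_zero.2 (ne_of_cr_pos h').1.symm))

/-- If the second side `y` of a corner of `T` points into a corner of `T'` with the same apex, then
`T` and `T'` are distinct and overlap. -/
lemma not_nonOverlapping_of_second_side {𝒯 : Set (Set ℂ)} (h𝒯 : NonOverlapping 𝒯) {T T' : Set ℂ}
    (hT : T ∈ 𝒯) (hT' : T' ∈ 𝒯) {v x y x' y' : ℂ} (c : Corner T v x y) (c' : Corner T' v x' y')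
    (h : 0 < cr v x y) (h' : 0 < cr v x' y') (h1 : 0 < cr v x' y) (h2 : 0 < cr v y y') : False := by
  have hne : T ≠ T' := by
    rintro rfl
    have := (c'.cr_nonneg c h (right_mem_tri v x' y')).2
    have e : cr v y' y = -cr v y y' := by simp only [cr_def]; ring
    linarith
  refine disjoint_iff_inter_eq_empty.1 (h𝒯 hT hT' hne) |> not_nonempty_iff_eq_empty.2 <| ?_
  have key : ∀ {f : ℂ → ℝ}, Continuous f → 0 < f y →
      ∀ᶠ ε : ℝ in nhdsWithin 0 (Ioi 0), 0 < f (v + (y - v) * (1 - ε * I)) := by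
    intro f hf h0
    have hcont : Continuous fun ε : ℝ => f (v + (y - v) * (1 - ε * I)) := hf.comp (by fun_prop)
    have h0' : 0 < f (v + (y - v) * (1 - (0 : ℝ) * I)) := by simpa using h0
    exact (hcont.continuousAt.eventually (lt_mem_nhds h0')).filter_mono nhdsWithin_le_nhds
  have hswap : ∀ y, Continuous fun z => cr v z y := by intro y; unfold cr; fun_prop
  obtain ⟨ε, ⟨⟨e1, e2⟩, e3⟩, e4⟩ := (((key (continuous_cr v x') h1).and (key (hswap y') h2)).and
    (key (continuous_cr v x) h)).and self_mem_nhdsWithin |>.exists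
  have e4' : (0 : ℝ) < ε := e4
  refine interior_inter_nonempty_of_cones c.1 c'.1 h h' e3 ?_ e1 e2
  have : cr v (v + (y - v) * (1 - ε * I)) y = ε * normSq (y - v) := by
    simp [cr_def, normSq_apply]; ring
  rw [this]
  exact mul_pos e4' (normSq_pos.2 (sub_ne_zero.2 (ne_of_cr_pos h).2.2))

lemma leg_not_im (c : Bool) : (leg τ (!c)).im = -(leg τ c).im := by
  cases c <;> simp [leg]

/-- Consecutive corners at a common apex, rotated by the arguments of `leg τ c₁` and `leg τ c₂`,
cannot be rotated towards each other. -/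
lemma leg_im_pos_of_adjacent {𝒯 : Set (Set ℂ)} (h𝒯 : NonOverlapping 𝒯) {T₁ T₂ : Set ℂ}
    (hT₁ : T₁ ∈ 𝒯) (hT₂ : T₂ ∈ 𝒯) (h1 : 0 < τ.re) (h2 : 0 < (τ ^ 2).re) {v p m q : ℂ} {c₁ c₂ : Bool}
    (k₁ : Corner T₁ v (v + p * leg τ c₁) (v + m * leg τ c₁))
    (k₂ : Corner T₂ v (v + m * leg τ c₂) (v + q * leg τ c₂))
    (hpm : 0 < (conj p * m).im) (hmq : 0 < (conj m * q).im)
    (hre : (conj p * m).re ≤ 0 ∨ (conj m * q).re ≤ 0) (hc : 0 < (leg τ c₁).im) :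
    0 < (leg τ c₂).im := by
  by_contra hc₂
  have hcc : c₂ = !c₁ := by
    by_contra h
    have : c₂ = c₁ := by cases c₁ <;> cases c₂ <;> simp_all
    exact hc₂ (this ▸ hc)
  obtain ⟨σ, hσ, hσ'⟩ : ∃ σ, leg τ c₁ = σ ∧ leg τ c₂ = conj σ :=
    ⟨_, rfl, by rw [hcc]; cases c₁ <;> simp [leg]⟩
  have hσre : 0 < σ.re := by rw [← hσ]; cases c₁ <;> simpa [leg] using h1
  have hσsq : 0 < σ.re ^ 2 - σ.im ^ 2 := by
    have : (τ ^ 2).re = τ.re ^ 2 - τ.im ^ 2 := by simp [sq]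
    rw [this] at h2
    rw [← hσ]; cases c₁ <;> simpa [leg] using h2
  rw [hσ] at k₁ hc
  rw [hσ'] at k₂
  have hm : 0 < m.re ^ 2 + m.im ^ 2 := by
    by_contra hm
    have e1 : m.re = 0 := by nlinarith [sq_nonneg m.re, sq_nonneg m.im]
    have e2 : m.im = 0 := by nlinarith [sq_nonneg m.re, sq_nonneg m.im]
    have : m = 0 := Complex.ext e1 e2
    simp [this] at hpm
  have hn : 0 < σ.re ^ 2 + σ.im ^ 2 := by positivity
  have hprod : 0 < 2 * σ.re * σ.im := by positivity
  have e1 : 0 < cr v (v + p * σ) (v + m * σ) := by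
    have : cr v (v + p * σ) (v + m * σ) = (conj p * m).im * (σ.re ^ 2 + σ.im ^ 2) := by
      simp [cr_def]; ring
    rw [this]; positivity
  have e2 : 0 < cr v (v + m * conj σ) (v + q * conj σ) := by
    have : cr v (v + m * conj σ) (v + q * conj σ) = (conj m * q).im * (σ.re ^ 2 + σ.im ^ 2) := by
      simp [cr_def]; ring
    rw [this]; positivity
  have e3 : 0 < cr v (v + m * conj σ) (v + m * σ) := by
    have : cr v (v + m * conj σ) (v + m * σ) = (m.re ^ 2 + m.im ^ 2) * (2 * σ.re * σ.im) := by
      simp [cr_def]; ring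
    rw [this]; positivity
  rcases hre with hre | hre
  · refine not_nonOverlapping_of_first_side h𝒯 hT₁ hT₂ k₁ k₂ e1 e2 ?_ e3
    have : cr v (v + p * σ) (v + m * conj σ) = (conj p * m).im * (σ.re ^ 2 - σ.im ^ 2) +
        -(conj p * m).re * (2 * σ.re * σ.im) := by
      simp [cr_def]; ring
    rw [this]
    exact add_pos_of_pos_of_nonneg (mul_pos hpm hσsq) (mul_nonneg (by linarith) hprod.le)
  · refine not_nonOverlapping_of_second_side h𝒯 hT₁ hT₂ k₁ k₂ e1 e2 e3 ?_
    have : cr v (v + m * σ) (v + q * conj σ) = (conj m * q).im * (σ.re ^ 2 - σ.im ^ 2) +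
        -(conj m * q).re * (2 * σ.re * σ.im) := by
      simp [cr_def]; ring
    rw [this]
    exact add_pos_of_pos_of_nonneg (mul_pos hmq hσsq) (mul_nonneg (by linarith) hprod.le)

/-! ### The corners of a converted rhombus -/

section
variable (hn : 3 ≤ n) (h2 : 0 < (τ ^ 2).re) (c : Bool) (k : ℤ) (X : ℂ)
include hn h2

/-- The corner of a converted rhombus at its base point is the corner of the rhombus, both of
whose sides are multiplied by the same `leg τ c`. -/
lemma corner_place_zero : Corner (place n τ c k X '' fan (stdPentagon n τ)) X
    (X + unitDir n (k - 1) * leg τ c) (X + unitDir n k * leg τ c) := by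
  have h := (corner_A hn h2).image (place n τ c k X)
  have e1 := unitDir_sub_one_mul n k
  have e2 := unitDir_mul_conj_one n k
  cases c
  · refine (?_ : Corner _ _ _ _).swap
    convert h using 1 <;> rw [place_false_apply] <;> simp [leg]
    · linear_combination -conj τ * e2
  · convert h using 1 <;> rw [place_true_apply] <;> simp [leg]
    · linear_combination -τ * e1

lemma corner_place_diag : Corner (place n τ c k X '' (halfTurn n τ '' fan (stdPentagon n τ)))
    (X + unitDir n (k - 1) * (2 * τ.re : ℝ) + unitDir n k * (2 * τ.re : ℝ))
    (X + unitDir n (k - 1) * (2 * τ.re : ℝ) + unitDir n k * (2 * τ.re : ℝ) +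
      -unitDir n (k - 1) * leg τ c)
    (X + unitDir n (k - 1) * (2 * τ.re : ℝ) + unitDir n k * (2 * τ.re : ℝ) +
      -unitDir n k * leg τ c) := by
  have h := ((corner_A hn h2).image (halfTurn n τ)).image (place n τ c k X)
  have e1 := unitDir_sub_one_mul n k
  have e2 := unitDir_mul_conj_one n k
  rw [← add_conj τ]
  cases c
  · refine (?_ : Corner _ _ _ _).swap
    convert h using 1 <;> rw [place_false_apply, halfTurn_apply] <;> simp [leg]
    · linear_combination -(τ + conj τ) * e2
    · linear_combination -(τ + conj τ) * e2
    · linear_combination -τ * e2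
  · convert h using 1 <;> rw [place_true_apply, halfTurn_apply] <;> simp [leg]
    · linear_combination -(τ + conj τ) * e1
    · linear_combination -(τ + conj τ) * e1
    · linear_combination -conj τ * e1

lemma corner_place_right : ∃ T, (T = place n τ c k X '' fan (stdPentagon n τ) ∨
      T = place n τ c k X '' (halfTurn n τ '' fan (stdPentagon n τ))) ∧
    Corner T (X + unitDir n (k - 1) * (2 * τ.re : ℝ))
      (X + unitDir n (k - 1) * (2 * τ.re : ℝ) + unitDir n k * leg τ (!c))
      (X + unitDir n (k - 1) * (2 * τ.re : ℝ) + -unitDir n (k - 1) * leg τ (!c)) := by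
  have e1 := unitDir_sub_one_mul n k
  have e2 := unitDir_mul_conj_one n k
  rw [← add_conj τ]
  cases c
  · have h := ((corner_C hn h2).image (halfTurn n τ)).image (place n τ false k X)
    refine ⟨_, Or.inr rfl, ?_⟩
    convert h using 1 <;> rw [place_false_apply, halfTurn_apply] <;> simp [leg]
    · linear_combination -(τ + conj τ) * e2
    · linear_combination -(τ + conj τ) * e2
    · linear_combination -conj τ * e2
  · have h := ((corner_C hn h2).image (place n τ true k X)).swap
    refine ⟨_, Or.inl rfl, ?_⟩
    convert h using 1 <;> rw [place_true_apply]
    · ring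
    · simp only [leg, Bool.not_true]; linear_combination -conj τ * e1
    · simp only [leg, Bool.not_true]; ring

lemma corner_place_left : ∃ T, (T = place n τ c k X '' fan (stdPentagon n τ) ∨
      T = place n τ c k X '' (halfTurn n τ '' fan (stdPentagon n τ))) ∧
    Corner T (X + unitDir n k * (2 * τ.re : ℝ))
      (X + unitDir n k * (2 * τ.re : ℝ) + -unitDir n k * leg τ (!c))
      (X + unitDir n k * (2 * τ.re : ℝ) + unitDir n (k - 1) * leg τ (!c)) := by
  have e1 := unitDir_sub_one_mul n k
  have e2 := unitDir_mul_conj_one n k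
  rw [← add_conj τ]
  cases c
  · have h := ((corner_C hn h2).image (place n τ false k X))
    refine ⟨_, Or.inl rfl, ?_⟩
    convert h using 1 <;> rw [place_false_apply] <;> simp [leg]
    · ring
    · ring
    · linear_combination -τ * e2
  · have h := (((corner_C hn h2).image (halfTurn n τ)).image (place n τ true k X)).swap
    refine ⟨_, Or.inr rfl, ?_⟩
    convert h using 1 <;> rw [place_true_apply, halfTurn_apply] <;> simp [leg]
    · linear_combination -(τ + conj τ) * e1
    · linear_combination -τ * e1
    · linear_combination -(τ + conj τ) * e1

end

/-! ### Alternation of the chiralities -/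

section
variable {𝒯 : Set (Set ℂ)} (h𝒯 : NonOverlapping 𝒯) (hn : 3 ≤ n) (h1 : 0 < τ.re)
  (h2 : 0 < (τ ^ 2).re) {c : ℤ → ℕ → ℕ → Bool}
  (hc : ∀ k i j, place n τ (c k i j) k (pt n τ k i j) '' fan (stdPentagon n τ) ∈ 𝒯 ∧
    place n τ (c k i j) k (pt n τ k i j) '' (halfTurn n τ '' fan (stdPentagon n τ)) ∈ 𝒯)
include h𝒯 hn h1 h2 hc

/-- Around an inner lattice point of a sector, the four corners are rotated in the same sense. -/
lemma chirality_alternates (h3 : τ.im ≠ 0) (k : ℤ) (i j : ℕ) :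
    c k (i + 1) j = (!c k i j) ∧ c k i (j + 1) = !c k i j := by
  have hs := unitDir_one_im_pos hn
  have P1 : pt n τ k (i + 1) (j + 1) = pt n τ k i j + unitDir n (k - 1) * (2 * τ.re : ℝ) +
      unitDir n k * (2 * τ.re : ℝ) := by rw [pt_succ_right, pt_succ_left]
  have P2 : pt n τ k (i + 1) (j + 1) = pt n τ k (i + 1) j + unitDir n k * (2 * τ.re : ℝ) :=
    pt_succ_right _ _ _
  have P3 : pt n τ k (i + 1) (j + 1) = pt n τ k i (j + 1) + unitDir n (k - 1) * (2 * τ.re : ℝ) :=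
    pt_succ_left _ _ _
  have k00 := corner_place_diag hn h2 (c k i j) k (pt n τ k i j)
  obtain ⟨T10, m10, k10⟩ := corner_place_left hn h2 (c k (i + 1) j) k (pt n τ k (i + 1) j)
  have k11 := corner_place_zero hn h2 (c k (i + 1) (j + 1)) k (pt n τ k (i + 1) (j + 1))
  obtain ⟨T01, m01, k01⟩ := corner_place_right hn h2 (c k i (j + 1)) k (pt n τ k i (j + 1))
  rw [← P1] at k00
  rw [← P2] at k10
  rw [← P3] at k01
  have m10 : T10 ∈ 𝒯 := by rcases m10 with rfl | rfl; exacts [(hc _ _ _).1, (hc _ _ _).2]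
  have m01 : T01 ∈ 𝒯 := by rcases m01 with rfl | rfl; exacts [(hc _ _ _).1, (hc _ _ _).2]
  have hω : conj (unitDir n (k - 1)) * unitDir n k = unitDir n 1 := by
    rw [conj_unitDir, ← unitDir_add]; congr 1; ring
  have hω' : conj (unitDir n k) * unitDir n (k - 1) = conj (unitDir n 1) := by
    rw [conj_unitDir, conj_unitDir, ← unitDir_add]; congr 1; ring
  have g1 : conj (-unitDir n (k - 1)) * -unitDir n k = unitDir n 1 := by
    rw [map_neg, neg_mul_neg, hω]
  have g2 : conj (-unitDir n k) * unitDir n (k - 1) = -conj (unitDir n 1) := by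
    rw [map_neg, neg_mul, hω']
  have g3 : conj (unitDir n k) * -unitDir n (k - 1) = -conj (unitDir n 1) := by
    rw [mul_neg, hω']
  have hre : (unitDir n 1).re ≤ 0 ∨ (-conj (unitDir n 1)).re ≤ 0 := by
    rw [neg_re, conj_re, neg_nonpos]; exact le_total _ _
  have hs' : 0 < (-conj (unitDir n 1)).im := by simpa using hs
  have i1 := leg_im_pos_of_adjacent h𝒯 (hc k i j).2 m10 h1 h2 k00 k10 (by rwa [g1]) (by rwa [g2])
    (by rwa [g1, g2])
  have i2 := leg_im_pos_of_adjacent h𝒯 m10 (hc k (i + 1) (j + 1)).1 h1 h2 k10 k11 (by rwa [g2])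
    (by rwa [hω]) (by rw [g2, hω]; exact hre.symm)
  have i3 := leg_im_pos_of_adjacent h𝒯 (hc k (i + 1) (j + 1)).1 m01 h1 h2 k11 k01 (by rwa [hω])
    (by rwa [g3]) (by rwa [hω, g3])
  have i4 := leg_im_pos_of_adjacent h𝒯 m01 (hc k i j).2 h1 h2 k01 k00 (by rwa [g3])
    (by rwa [g1]) (by rw [g3, g1]; exact hre.symm)
  have hb : ∀ b b' : Bool, (0 < (leg τ (!b)).im ↔ 0 < (leg τ b').im) → b = !b' := by
    intro b b'
    rcases lt_or_gt_of_ne h3 with h | h <;> cases b <;> cases b' <;> simp [leg, h, h.le]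
  exact ⟨hb _ _ ⟨fun h => i4 (i3 (i2 h)), i1⟩, hb _ _ ⟨i4, fun h => i3 (i2 (i1 h))⟩⟩

/-- Across the common ray of two consecutive sectors, at one of the two ends of an edge the two
corners are obtuse and cannot be rotated towards each other. -/
lemma leg_im_pos_of_next_sector (k : ℤ) (j : ℕ) (h : 0 < (leg τ (c k 0 (j + 1))).im) :
    0 < (leg τ (c (k + 1) j 0)).im := by
  have hs := unitDir_one_im_pos hn
  have hω : conj (unitDir n k) * unitDir n (k + 1) = unitDir n 1 := by
    rw [conj_unitDir, ← unitDir_add]; congr 1; ring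
  have hω1 : conj (unitDir n (k - 1)) * unitDir n k = unitDir n 1 := by
    rw [conj_unitDir, ← unitDir_add]; congr 1; ring
  have hk : k + 1 - 1 = k := by ring
  rcases le_total (unitDir n 1).re 0 with hre | hre
  · have k1 := corner_place_zero hn h2 (c k 0 (j + 1)) k (pt n τ k 0 (j + 1))
    have k2 := corner_place_zero hn h2 (c (k + 1) j 0) (k + 1) (pt n τ (k + 1) j 0)
    rw [← pt_zero_succ hn, hk] at k2
    have m2 := (hc (k + 1) j 0).1
    rw [← pt_zero_succ hn] at m2
    exact leg_im_pos_of_adjacent h𝒯 (hc k 0 (j + 1)).1 m2 h1 h2 k1 k2 (by rwa [hω1])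
      (by rwa [hω]) (by rw [hω]; exact Or.inr hre) h
  · obtain ⟨T1, m1, k1⟩ := corner_place_left hn h2 (c k 0 (j + 1)) k (pt n τ k 0 (j + 1))
    obtain ⟨T2, m2, k2⟩ := corner_place_right hn h2 (c (k + 1) j 0) (k + 1) (pt n τ (k + 1) j 0)
    have m1 : T1 ∈ 𝒯 := by rcases m1 with rfl | rfl; exacts [(hc _ _ _).1, (hc _ _ _).2]
    have m2 : T2 ∈ 𝒯 := by rcases m2 with rfl | rfl; exacts [(hc _ _ _).1, (hc _ _ _).2]
    rw [← pt_zero_succ hn, hk] at k2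
    have g1 : conj (unitDir n (k + 1)) * -unitDir n k = -conj (unitDir n 1) := by
      rw [← hω]; simp [mul_comm]
    have g2 : conj (-unitDir n k) * unitDir n (k - 1) = -conj (unitDir n 1) := by
      rw [← hω1]; simp [mul_comm]
    have hs' : 0 < (-conj (unitDir n 1)).im := by simpa using hs
    by_contra hcon
    have := leg_im_pos_of_adjacent h𝒯 m2 m1 h1 h2 k2 k1 (by rwa [g1]) (by rwa [g2])
      (by rw [g1]; left; simpa using hre)
    rw [leg_not_im, leg_not_im] at this
    have h4 : (leg τ (c (k + 1) j 0)).im ≠ 0 := by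
      intro h0
      have : (leg τ (c k 0 (j + 1))).im = 0 := by
        revert h0; cases c (k + 1) j 0 <;> cases c k 0 (j + 1) <;> simp [leg]
      linarith
    have := this (by rcases lt_or_gt_of_ne h4 with h5 | h5 <;> [linarith; exact absurd h5 hcon])
    linarith

/-- The innermost rhombuses of neighbouring sectors have opposite chiralities. -/
lemma chirality_next_sector (h3 : τ.im ≠ 0) (k : ℤ) : c (k + 1) 0 0 = !c k 0 0 := by
  have a1 := chirality_alternates h𝒯 hn h1 h2 hc h3
  have b0 := leg_im_pos_of_next_sector h𝒯 hn h1 h2 hc k 0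
  have b1 := leg_im_pos_of_next_sector h𝒯 hn h1 h2 hc k 1
  rw [(a1 (k + 1) 0 0).1, (a1 k 0 1).2] at b1
  rw [(a1 k 0 0).2] at b0 b1
  revert b0 b1
  rcases lt_or_gt_of_ne h3 with h | h <;> cases c (k + 1) 0 0 <;> cases c k 0 0 <;>
    simp [leg, h, h.le]

/-- Since the chiralities of the first rhombuses alternate from sector to sector, the number of
sectors is even. -/
lemma even_of_nonOverlapping (h3 : τ.im ≠ 0) (hper : c n 0 0 = c 0 0 0) : Even n := by
  have key : ∀ m : ℕ, c m 0 0 = if Even m then c 0 0 0 else !c 0 0 0 := by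
    intro m
    induction m with
    | zero => simp
    | succ m ih =>
      rw [Nat.cast_succ, chirality_next_sector h𝒯 hn h1 h2 hc h3, ih]
      by_cases hm : Even m <;> simp [hm, Nat.even_add_one]
  by_contra hev
  have := key n
  rw [if_neg hev, hper] at this
  cases h : c 0 0 0 <;> simp [h] at this

end

/-! ### Conversions of a single rhombus -/

/-- An isometry that maps a four-point set onto itself fixes its centroid. -/
lemma map_centroid {m d e : ℂ} (hd : d ≠ 0) (he : e ≠ 0) (hde : d + e ≠ 0) (hde' : d - e ≠ 0)
    (f : ℂ ≃ᵢ ℂ) (hf : f '' {m - d, m + e, m + d, m - e} = {m - d, m + e, m + d, m - e}) :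
    f m = m := by
  classical
  set S : Finset ℂ := {m - d, m + e, m + d, m - e} with hS
  have hS' : (S : Set ℂ) = {m - d, m + e, m + d, m - e} := by simp [hS]
  have himg : S.image f = S := by
    apply Finset.coe_injective
    rw [Finset.coe_image, hS', hf]
  have hsum : ∀ F : ℂ → ℂ, ∑ z ∈ S, F z = F (m - d) + (F (m + e) + (F (m + d) + F (m - e))) := by
    intro F
    rw [hS, Finset.sum_insert, Finset.sum_insert, Finset.sum_insert, Finset.sum_singleton]
    · rw [Finset.mem_singleton]
      intro h
      exact hde (by linear_combination h)
    · rw [Finset.mem_insert, Finset.mem_singleton, not_or]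
      exact ⟨fun h => hde' (by linear_combination -h), fun h => he (by linear_combination h / 2)⟩
    · rw [Finset.mem_insert, Finset.mem_insert, Finset.mem_singleton, not_or, not_or]
      exact ⟨fun h => hde (by linear_combination -h), fun h => hd (by linear_combination -h / 2),
        fun h => hde' (by linear_combination -h)⟩
  have h1 : ∑ z ∈ S, f z = ∑ z ∈ S, z := by
    conv_rhs => rw [← himg]
    rw [Finset.sum_image fun x _ y _ h => f.injective h]
  rw [hsum, hsum fun z => z] at h1
  obtain ⟨a, b, -, hab | hab⟩ := isometry_cases f <;> simp only [hab, map_add, map_sub] at h1 ⊢ <;>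
    linear_combination h1 / 4

/-- An isometry that permutes the vertices of the rhombus `A C A' C'` of a pentagonal pair is the
identity, the half-turn, or the composition of one of these with the reflection that exchanges the
two chiralities; the rhombus must not be a square. -/
lemma place_of_image_vertices (hn : 3 ≤ n) (h1 : 0 < τ.re) (hω : (unitDir n 1).re ≠ 0) (k : ℤ)
    (X : ℂ) (f : ℂ ≃ᵢ ℂ)
    (hf : f '' {stdPentagon n τ 0, stdPentagon n τ 2, partner (stdPentagon n τ) 0,
      partner (stdPentagon n τ) 2} = {stdPentagon n τ 0, stdPentagon n τ 2,
        partner (stdPentagon n τ) 0, partner (stdPentagon n τ) 2}) :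
    ∃ c : Bool, (∀ z, place n τ true k X (f z) = place n τ c k X z) ∨
      (∀ z, place n τ true k X (f z) = place n τ c k X (halfTurn n τ z)) := by
  have hr : (τ.re : ℂ) ≠ 0 := by exact_mod_cast h1.ne'
  have him := unitDir_one_im_pos hn
  have hτ := add_conj τ
  push_cast at hτ
  have hu := unitDir_mul_conj n 1
  have hk := unitDir_sub_one_mul n k
  set ω := unitDir n 1 with hωdef
  -- the centre of the rhombus and its two half-diagonals
  set d : ℂ := τ.re * (1 + ω) with hd
  set e : ℂ := τ.re * (1 - ω) with he
  set m : ℂ := -τ + d with hm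
  have hH : ∀ z, halfTurn n τ z = 2 * m - z := by
    intro z
    rw [halfTurn_apply, stdPentagon_three, stdPentagon_four, ← hωdef, hm, hd]
    linear_combination (1 + ω) * hτ
  have p0 : stdPentagon n τ 0 = m - d := by rw [stdPentagon_zero, hm]; ring
  have p2 : stdPentagon n τ 2 = m + e := by
    rw [stdPentagon_two, hm, hd, he]; linear_combination hτ
  rw [partner_stdPentagon, partner_stdPentagon, hH, hH, p0, p2,
    show 2 * m - (m - d) = m + d by ring, show 2 * m - (m + e) = m - e by ring] at hf
  have hd0 : d ≠ 0 := by
    intro h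
    have := congrArg Complex.im h
    rw [hd, im_ofReal_mul] at this
    simp [h1.ne', him.ne'] at this
  have he0 : e ≠ 0 := by
    intro h
    have := congrArg Complex.im h
    rw [he, im_ofReal_mul] at this
    simp [h1.ne', him.ne'] at this
  have hfm : f m = m := by
    refine map_centroid hd0 he0 ?_ ?_ f hf
    · rw [show d + e = 2 * τ.re by rw [hd, he]; ring]
      exact mul_ne_zero two_ne_zero hr
    · rw [show d - e = 2 * τ.re * ω by rw [hd, he]; ring]
      exact mul_ne_zero (mul_ne_zero two_ne_zero hr) (unitDir_ne_zero _ _)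
  -- the two diagonals have different lengths
  have hne : ‖d‖ ≠ ‖e‖ := by
    intro h
    have h2 := congrArg (· ^ 2) h
    simp only [hd, he, norm_mul, mul_pow] at h2
    rw [← normSq_eq_norm_sq (1 + ω), ← normSq_eq_norm_sq (1 - ω)] at h2
    have h4 := mul_left_cancel₀ (by simpa using h1.ne') h2
    apply hω
    simp only [normSq_apply] at h4
    simp at h4
    linarith
  have hdist : ‖f (m - d) - m‖ = ‖d‖ := by
    rw [← dist_eq_norm]
    nth_rewrite 2 [← hfm]
    rw [f.dist_eq, dist_eq_norm]
    simp
  have hfd : f (m - d) = m - d ∨ f (m - d) = m + d := by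
    have : f (m - d) ∈ ({m - d, m + e, m + d, m - e} : Set ℂ) := by
      rw [← hf]; exact mem_image_of_mem f (Or.inl rfl)
    rcases this with h | h | h | h
    · exact Or.inl h
    · rw [h, add_sub_cancel_left] at hdist; exact absurd hdist.symm hne
    · exact Or.inr h
    · rw [h, sub_sub_cancel_left, norm_neg] at hdist; exact absurd hdist.symm hne
  have hcd : ω * conj d = d := by
    rw [hd]; simp only [map_mul, map_add, map_one, conj_ofReal]
    linear_combination τ.re * hu
  have hcd0 : conj d ≠ 0 := by simpa using hd0
  obtain ⟨a, b, -, hab | hab⟩ := isometry_cases f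
  · rw [hab] at hfm
    refine ⟨true, ?_⟩
    rcases hfd with h | h <;> rw [hab] at h
    · have ha : a = 1 := mul_right_cancel₀ hd0 (by linear_combination hfm - h)
      refine Or.inl fun z => ?_
      rw [hab, show a * z + b = z by linear_combination hfm + (z - m) * ha]
    · have ha : a = -1 := mul_right_cancel₀ hd0 (by linear_combination hfm - h)
      refine Or.inr fun z => ?_
      rw [hab, hH, show a * z + b = 2 * m - z by linear_combination hfm + (z - m) * ha]
  · rw [hab] at hfm
    have hR : ∀ z, place n τ true k X (m + ω * conj (z - m)) = place n τ false k X z := by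
      intro z
      rw [place_true_apply, place_false_apply, ← hk, hm]
      simp only [map_sub, map_add, map_neg]
      linear_combination (-unitDir n (k - 1)) * hcd
    refine ⟨false, ?_⟩
    rcases hfd with h | h <;> rw [hab, map_sub] at h
    · have ha : a = ω := mul_right_cancel₀ hcd0 (by linear_combination hfm - h - hcd)
      refine Or.inl fun z => ?_
      rw [← hR, hab]; congr 1
      rw [map_sub]; linear_combination hfm + (conj z - conj m) * ha
    · have ha : a = -ω := mul_right_cancel₀ hcd0 (by linear_combination hfm - h + hcd)
      refine Or.inr fun z => ?_
      rw [← hR, hab, hH]; congr 1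
      simp only [map_sub, map_mul, map_ofNat]
      linear_combination hfm + (conj z - conj m) * ha

lemma exists_place_of_conversion (hn : 3 ≤ n) (h1 : 0 < τ.re) (hω : (unitDir n 1).re ≠ 0)
    {g : RhombusIndex n → (ℂ ≃ᵢ ℂ)} (hg : IsConversion n (stdPentagon n τ) g) (r : RhombusIndex n) :
    ∃ c : Bool, ((∀ z, g r z = place n τ c r.1.val (pt n τ r.1.val r.2.1 r.2.2) z) ∨
      (∀ z, g r z = place n τ c r.1.val (pt n τ r.1.val r.2.1 r.2.2) (halfTurn n τ z))) := by
  obtain ⟨k, i, j⟩ := r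
  set F := place n τ true k.val (pt n τ k.val i j) with hF
  have hrh : F '' {stdPentagon n τ 0, stdPentagon n τ 2, partner (stdPentagon n τ) 0,
      partner (stdPentagon n τ) 2} = rhombusVertices n (2 * τ.re) (k, i, j) := by
    have h := isConversion_stdConversion (n := n) (τ := τ) (e := 0) h1
    have h' := isConversion_stdConversion (n := n) (τ := τ) (e := 1) h1
    rw [IsConversion, dist_stdPentagon_zero_two h1] at h h'
    specialize h (k, i, j)
    specialize h' (k, i, j)
    by_cases hc : chir 0 k.val i j = true
    · rwa [stdConversion, placed, hc] at h
    · have hc' : chir 1 k.val i j = true := by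
        simp only [chir, decide_eq_true_eq] at hc ⊢
        rw [zero_add] at hc
        rw [add_assoc, add_assoc, add_comm, ← add_assoc, Int.even_add_one]
        exact hc
      rwa [stdConversion, placed, hc'] at h'
  have hgr := hg (k, i, j)
  rw [dist_stdPentagon_zero_two h1, ← hrh] at hgr
  obtain ⟨c, hc⟩ := place_of_image_vertices hn h1 hω k.val (pt n τ k.val i j)
    ((g (k, i, j)).trans F.symm) (by
      have : ∀ S : Set ℂ, (g (k, i, j)).trans F.symm '' S = F.symm '' (g (k, i, j) '' S) :=
        fun S => by rw [← image_comp]; rfl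
      rw [this, hgr, ← image_comp]
      simp)
  refine ⟨c, ?_⟩
  simpa only [IsometryEquiv.trans_apply, ← hF, IsometryEquiv.apply_symm_apply] using hc

lemma unitDir_one_re_ne_zero (hodd : Odd n) : (unitDir n 1).re ≠ 0 := by
  intro h
  have h1 := sq_add_sq_unitDir n 1
  have h2 : unitDir n 1 ^ 2 = -1 := by
    apply Complex.ext
    · simp [sq, h] at h1 ⊢; linarith
    · simp [sq, h]
  have h3 : ∀ m : ℕ, unitDir n 1 ^ m = unitDir n m := by
    intro m
    induction m with
    | zero => simp [unitDir_zero]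
    | succ m ih => rw [pow_succ, ih, ← unitDir_add]; push_cast; rfl
  have h4 := h3 n
  have h5 := unitDir_mul_period (n := n) (by rintro rfl; simp at hodd) 1
  rw [mul_one] at h5
  have h6 : (unitDir n 1 ^ 2) ^ n = 1 := by rw [pow_right_comm, h4, h5, one_pow]
  rw [h2, hodd.neg_one_pow] at h6
  norm_num at h6

/-- For odd `n` the pentagons of every conversion overlap. -/
lemma not_nonOverlapping_of_odd (hn : 3 ≤ n) (hodd : Odd n) (h1 : 0 < τ.re) (h2 : 0 < (τ ^ 2).re)
    (h3 : τ.im ≠ 0) {g : RhombusIndex n → (ℂ ≃ᵢ ℂ)} (hg : IsConversion n (stdPentagon n τ) g) :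
    ¬ NonOverlapping (tiles (stdPentagon n τ) g) := by
  intro h𝒯
  choose c hc using exists_place_of_conversion hn h1 (unitDir_one_re_ne_zero hodd) hg
  have hn0 : (0 : ℤ) < n := by omega
  have e1 := fun k : ℤ => Int.emod_nonneg k hn0.ne'
  have e2 := fun k : ℤ => Int.emod_lt_of_pos k hn0
  set κ : ℤ → Fin n := fun k => ⟨(k % n).toNat, by have := e1 k; have := e2 k; omega⟩ with hκ
  have hκv : ∀ k, ((κ k).val : ℤ) = k % n := fun k => Int.toNat_of_nonneg (e1 k)
  have hHH : ∀ S : Set ℂ, halfTurn n τ '' (halfTurn n τ '' S) = S := by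
    intro S
    rw [← image_comp]
    refine (image_congr' fun z => ?_).trans (image_id S)
    simp [halfTurn_apply]
  have hplace : ∀ (b : Bool) (k : ℤ) (i j : ℕ) (z : ℂ),
      place n τ b (κ k).val (pt n τ (κ k).val i j) z = place n τ b k (pt n τ k i j) z := by
    intro b k i j z
    have hp : pt n τ (k % n) i j = pt n τ k i j := by
      conv_rhs => rw [← Int.emod_add_mul_ediv k n, pt_period hn]
    have hu : unitDir n (k % n - 1) = unitDir n (k - 1) := by
      rw [sub_eq_add_neg, unitDir_add, unitDir_emod (by omega), ← unitDir_add, ← sub_eq_add_neg]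
    rw [hκv, hp]
    cases b
    · rw [place_false_apply, place_false_apply, unitDir_emod (by omega)]
    · rw [place_true_apply, place_true_apply, hu]
  have hmem : ∀ k i j, place n τ (c (κ k, i, j)) k (pt n τ k i j) '' fan (stdPentagon n τ) ∈
        tiles (stdPentagon n τ) g ∧
      place n τ (c (κ k, i, j)) k (pt n τ k i j) '' (halfTurn n τ '' fan (stdPentagon n τ)) ∈
        tiles (stdPentagon n τ) g := by
    intro k i j
    rw [tiles, region_stdPentagon hn h2, region_partner_stdPentagon hn h2]
    have hc' := hc (κ k, i, j)
    simp only [hplace] at hc'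
    rcases hc' with h | h
    · have h4 : ∀ S : Set ℂ, g (κ k, i, j) '' S =
          place n τ (c (κ k, i, j)) k (pt n τ k i j) '' S := fun S => image_congr' h
      exact ⟨⟨_, Or.inl (h4 _).symm⟩, ⟨_, Or.inr (h4 _).symm⟩⟩
    · have h4 : ∀ S : Set ℂ, g (κ k, i, j) '' S =
          place n τ (c (κ k, i, j)) k (pt n τ k i j) '' (halfTurn n τ '' S) := by
        intro S; rw [← image_comp]; exact image_congr' h
      exact ⟨⟨(κ k, i, j), Or.inr (by rw [h4, hHH])⟩, ⟨_, Or.inl (h4 _).symm⟩⟩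
  have := even_of_nonOverlapping h𝒯 hn h1 h2 (c := fun k i j => c (κ k, i, j)) hmem h3 (by
    have : κ n = κ 0 := by apply Fin.ext; simp [hκ]
    rw [this])
  exact (Nat.not_even_iff_odd.2 hodd) this

end

/-! ### Reduction to the standard position -/

section
variable {n : ℕ} {τ : ℂ} {p : Polygon ℂ 5} {f : ℂ ≃ᵢ ℂ}

lemma partner_eq_of_eq (hp : ∀ i, p i = f (stdPentagon n τ i)) (i : Fin 5) :
    partner p i = f (halfTurn n τ (stdPentagon n τ i)) := by
  have h := isometry_comb f (stdPentagon n τ 3) (stdPentagon n τ 4) (stdPentagon n τ i) 1 1 (-1)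
    (by norm_num)
  push_cast at h
  rw [halfTurn_apply, show stdPentagon n τ 3 + stdPentagon n τ 4 - stdPentagon n τ i =
    1 * stdPentagon n τ 3 + 1 * stdPentagon n τ 4 + -1 * stdPentagon n τ i by ring, h, ← hp, ← hp,
    ← hp]
  show p 3 + p 4 - p i = _
  ring

lemma isConversion_iff_of_eq (hp : ∀ i, p i = f (stdPentagon n τ i))
    (g : RhombusIndex n → (ℂ ≃ᵢ ℂ)) :
    IsConversion n p g ↔ IsConversion n (stdPentagon n τ) fun r => f.trans (g r) := by
  refine forall_congr' fun r => ?_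
  rw [hp 0, hp 2, f.dist_eq, partner_eq_of_eq hp, partner_eq_of_eq hp, partner_stdPentagon,
    partner_stdPentagon]
  simp only [image_insert_eq, image_singleton, IsometryEquiv.trans_apply]

lemma tiles_eq_of_eq (hn : 3 ≤ n) (h2 : 0 < (τ ^ 2).re) (hp : ∀ i, p i = f (stdPentagon n τ i))
    (g : RhombusIndex n → (ℂ ≃ᵢ ℂ)) :
    tiles p g = tiles (stdPentagon n τ) fun r => f.trans (g r) := by
  have hq := isFan_stdPentagon hn h2
  have e1 : region p = f '' fan (stdPentagon n τ) := region_eq_image_fan hq f hp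
  have e2 : region (partner p) = f '' (halfTurn n τ '' fan (stdPentagon n τ)) := by
    rw [region_eq_image_fan hq ((halfTurn n τ).trans f) (partner_eq_of_eq hp), ← image_comp]; rfl
  have e3 : ∀ r (S : Set ℂ), f.trans (g r) '' S = g r '' (f '' S) := by
    intro r S; rw [← image_comp]; rfl
  simp only [tiles, e1, e2, region_stdPentagon hn h2, region_partner_stdPentagon hn h2, e3]

end

end PentagonTiling

theorem mainTheorem2 (n : ℕ) [NeZero n] (hn : 3 ≤ n) (θ : ℝ) (hθ0 : 0 < θ) (hθπ : θ < Real.pi)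
    (hθ : θ ≠ Real.pi / 2) (p : Polygon ℂ 5) (hp : PentagonTiling.Satisfies n θ p) :
    (Even n →
      ∃ g : PentagonTiling.RhombusIndex n → (ℂ ≃ᵢ ℂ), PentagonTiling.IsConversion n p g ∧
        ∃ h : Polygon ℂ (2 * n),
          PentagonTiling.IsTilingWithHole (PentagonTiling.tiles p g) h ∧
          PentagonTiling.IsEquilateralConcave (dist (p 0) (p 1)) h ∧
          PentagonTiling.IsAlternating n (dist (p 0) (p 2)) h ∧
          PentagonTiling.IsDihedral (n / 2)
            (PentagonTiling.setSymmetries (PentagonTiling.region h)) ∧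
          PentagonTiling.tilingSymmetries (PentagonTiling.tiles p g) ∩
            PentagonTiling.orientationPreserving = PentagonTiling.rotations (n / 2) ∧
          (n ≠ 4 → PentagonTiling.tilingSymmetries (PentagonTiling.tiles p g) =
            PentagonTiling.rotations (n / 2))) ∧
    (Odd n →
      ¬ ∃ g : PentagonTiling.RhombusIndex n → (ℂ ≃ᵢ ℂ), PentagonTiling.IsConversion n p g ∧
        PentagonTiling.NonOverlapping (PentagonTiling.tiles p g)) := by
  open PentagonTiling in
  obtain ⟨τ, f, h1, h3, h2, hpf⟩ := exists_isometry_of_satisfies hθ0 hθπ hθ hp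
  have hd1 : dist (p 0) (p 1) = ‖τ‖ := by rw [hpf, hpf, f.dist_eq, dist_stdPentagon_zero_one]
  have hd2 : dist (p 0) (p 2) = 2 * τ.re := by
    rw [hpf, hpf, f.dist_eq, dist_stdPentagon_zero_two h1]
  rw [hd1, hd2]
  refine ⟨fun hev => ?_, ?_⟩
  · have hn4 : 4 ≤ n := by
      obtain ⟨m, rfl⟩ := hev; omega
    -- the chirality for which the edge `P₀P₁` is bent into the `n`-gon
    obtain ⟨e, he⟩ : ∃ e : ℤ, chir e 0 0 0 = decide (0 < τ.im) := by
      by_cases h : 0 < τ.im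
      · exact ⟨0, by simp [chir, h]⟩
      · exact ⟨1, by simp [chir, h]⟩
    have hcancel : (fun r => f.trans (f.symm.trans (stdConversion n τ e r))) =
        stdConversion n τ e := by
      funext r; ext z; simp
    refine ⟨fun r => f.symm.trans (stdConversion n τ e r), ?_, holePolygon n τ e, ?_⟩
    · rw [isConversion_iff_of_eq hpf, hcancel]
      exact isConversion_stdConversion h1
    · rw [tiles_eq_of_eq hn h2 hpf, hcancel]
      refine ⟨isTilingWithHole_stdConversion hn4 hev h1 h2,
        isEquilateralConcave_holePolygon hn4 hev h1 h2 h3 he,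
        isAlternating_holePolygon hn4 hev h1 h2 h3 he,
        isDihedral_holePolygon hn4 h1 h2 h3 he hev, ?_, fun h4 => ?_⟩
      · rw [tiles_stdConversion hn h2]
        exact tilingSymmetries_inter_orientationPreserving hn4 hev h1 h2 h3 he
      · rw [tiles_stdConversion hn h2]
        exact tilingSymmetries_eq hn4 hev h1 h2 h3 he h4
  · rintro hodd ⟨g, hg, hno⟩
    rw [tiles_eq_of_eq hn h2 hpf] at hno
    exact not_nonOverlapping_of_odd hn hodd h1 h2 h3 ((isConversion_iff_of_eq hpf g).1 hg) hno
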